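/- For finite graphs $G,H$ let $\mathrm{Hom}(G,H)$ be the polyhedral complex whose cells are indexed by the functions $\eta$ from $V(G)$ to the nonempty subsets of $V(H)$ such that $(\tilde x,\tilde y)\in E(H)$ whenever $(x,y)\in E(G)$, $\tilde x\in\eta(x)$, $\tilde y\in\eta(y)$; the cell $\eta$ is the product over $v\in V(G)$ of the simplices with vertex sets $\eta(v)$, and its closure consists of all cells $\tilde\eta$ with $\tilde\eta(v)\subseteq\eta(v)$ for all $v\in V(G)$. Let $C_{2r+1}$ be the cycle on the vertex set $\mathbb Z/(2r+1)\mathbb Z$, let $K_n$ be the complete graph on $n$ vertices, and let $\mathbb Z_2=\mathbb Z/2\mathbb Z$ act on $\mathrm{Hom}(C_{2r+1},K_n)$ through the reflection $x\mapsto -x$ of $C_{2r+1}$, that is by $\eta\mapsto(x\mapsto\eta(-x))$. Let $r\ge 2$ and $n\ge 5$ be integers. Then the (cellular) homology of $\mathrm{Hom}(C_{2r+1},K_n)$ satisfies the following. 1. $H_i(\mathrm{Hom}(C_{2r+1},K_n);\mathbb Z_2)\cong\mathbb Z_2$ for $i=0,\,n-3,\,n-2$, and $H_i(\mathrm{Hom}(C_{2r+1},K_n);\mathbb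 Z_2)=0$ for $1\le i\le n-4$. 2. $H_i(\mathrm{Hom}(C_{2r+1},K_n);\mathbb Z)=0$ for $1\le i\le n-4$. 3. If $n$ is odd, then $H_{n-3}(\mathrm{Hom}(C_{2r+1},K_n);\mathbb Z)\cong H_{n-2}(\mathrm{Hom}(C_{2r+1},K_n);\mathbb Z)\cong\mathbb Z$, and the generator of $\mathbb Z_2$ acts on $H_{n-3}(\mathrm{Hom}(C_{2r+1},K_n);\mathbb Z)$ as multiplication by $-1$. 4. If $n$ is even, then $H_{n-3}(\mathrm{Hom}(C_{2r+1},K_n);\mathbb Z)\cong\mathbb Z_2$ and $H_{n-2}(\mathrm{Hom}(C_{2r+1},K_n);\mathbb Z)=0$. -/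

import Mathlib

open CategoryTheory

set_option linter.unusedSectionVars false

noncomputable section

/-! The polyhedral complex `Hom(G, H)` of two finite graphs, its cellular chain complex over a
commutative ring, and the action of graph isomorphisms on it.  A cell is a function `η` assigning
to every vertex `v` of `G` a nonempty set `η v` of vertices of `H`; geometrically it is the product,
over the vertices `v` of `G`, of the simplices with vertex sets `η v`, and its closure consists of
the cells `τ` with `τ v ⊆ η v` for all `v`.  Simplices and products are oriented by means of linear
orders on the vertex sets. -/

namespace HomComplex

section

variable {V V' W : Type} [Fintype V] [LinearOrder V] [Fintype V'] [LinearOrder V']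
  [Fintype W] [LinearOrder W]

/-- `η` indexes a cell of `Hom(G, H)`: its values are nonempty, and all vertices in `η x` are
adjacent to all vertices in `η y` whenever `x` and `y` are adjacent. -/
def IsCell (G : SimpleGraph V) (H : SimpleGraph W) (η : V → Finset W) : Prop :=
  (∀ v, (η v).Nonempty) ∧ ∀ x y, G.Adj x y → ∀ a ∈ η x, ∀ b ∈ η y, H.Adj a b

/-- The dimension of the product of the simplices with (nonempty) vertex sets `η v`. -/
def cellDim (η : V → Finset W) : ℕ := ∑ v, ((η v).card - 1)

/-- The `i`-dimensional cells of `Hom(G, H)`. -/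
@[ext]
structure Cell (G : SimpleGraph V) (H : SimpleGraph W) (i : ℕ) : Type where
  val : V → Finset W
  isCell : IsCell G H val
  dim_eq : cellDim val = i

instance (G : SimpleGraph V) (H : SimpleGraph W) (i : ℕ) : Finite (Cell G H i) :=
  Finite.of_injective (fun η : Cell G H i => η.val) fun _ _ h => Cell.ext h

instance (G : SimpleGraph V) (H : SimpleGraph W) (i : ℕ) : Fintype (Cell G H i) :=
  Fintype.ofFinite _

/-- The exponent of the sign with which the facet of `η` obtained by deleting `w` from `η v`
enters the boundary of the product cell `η`: the sum of the dimensions of the factors preceding the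
factor `v`, plus the position of the vertex `w` in the simplex `η v`. -/
def signExp (η : V → Finset W) (v : V) (w : W) : ℕ :=
  ∑ u ∈ Finset.univ.filter (· < v), ((η u).card - 1) + ((η v).filter (· < w)).card

/-- Deletion of `w` from `η v`. -/
def del (η : V → Finset W) (v : V) (w : W) : V → Finset W :=
  Function.update η v ((η v).erase w)

/-- The incidence number of a cell `η` and a cell `τ` of one dimension less. -/
def incidence (η τ : V → Finset W) : ℤ :=
  ∑ v, ∑ w ∈ η v, if τ = del η v w then (-1) ^ signExp η v w else 0

/-- The `i`-th cellular chain module of `Hom(G, H)`, free on the `i`-dimensional cells. -/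
abbrev Chains (R : Type) [CommRing R] (G : SimpleGraph V) (H : SimpleGraph W) (i : ℕ) : Type :=
  Cell G H i →₀ R

/-- The cellular boundary map. -/
def boundary (R : Type) [CommRing R] (G : SimpleGraph V) (H : SimpleGraph W) (i : ℕ) :
    Chains R G H (i + 1) →ₗ[R] Chains R G H i :=
  Finsupp.linearCombination R fun η =>
    ∑ τ : Cell G H i, Finsupp.single τ ((incidence η.val τ.val : ℤ) : R)

theorem mem_del (η : V → Finset W) (v : V) (w : W)
    (x : V) (y : W) : y ∈ del η v w x ↔ y ∈ η x ∧ (x, y) ≠ (v, w) := by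
  unfold del
  by_cases h : x = v
  · subst h; simp [and_comm]
  · simp [h]

theorem del_comm (η : V → Finset W)
    (v : V) (w : W) (v' : V) (w' : W) : del (del η v w) v' w' = del (del η v' w') v w := by
  funext x
  ext y
  simp only [mem_del]; tauto

theorem incidence_eq (η τ : V → Finset W) : incidence η τ =
      ∑ p : V × W, if p.2 ∈ η p.1 ∧ τ = del η p.1 p.2 then (-1) ^ signExp η p.1 p.2 else 0 := by
  rw [Fintype.sum_prod_type]
  unfold incidence
  refine Finset.sum_congr rfl fun v _ => ?_
  simp [ite_and, Finset.sum_ite_mem]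

theorem card_del (η : V → Finset W) (v : V) (w : W) (hw : w ∈ η v) (u : V) :
    (η u).card = (del η v w u).card + if u = v then 1 else 0 := by
  unfold del
  by_cases h : u = v
  · subst h
    have := Finset.card_pos.2 ⟨w, hw⟩
    simp [Finset.card_erase_of_mem hw]; omega
  · simp [h]

theorem card_sub_del (η : V → Finset W) (v : V) (w : W) (hw : w ∈ η v)
    (hne : ∀ u, (del η v w u).Nonempty) (u : V) :
    (η u).card - 1 = ((del η v w u).card - 1) + if u = v then 1 else 0 := by
  have := card_del η v w hw u
  have := (hne u).card_pos
  omega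

theorem cellDim_del (η : V → Finset W) (v : V) (w : W) (hw : w ∈ η v)
    (hne : ∀ u, (del η v w u).Nonempty) : cellDim η = cellDim (del η v w) + 1 := by
  unfold cellDim
  rw [Finset.sum_congr rfl fun u _ => card_sub_del η v w hw hne u, Finset.sum_add_distrib]
  simp

theorem IsCell.of_subset {G : SimpleGraph V} {H : SimpleGraph W} {η τ : V → Finset W}
    (h : IsCell G H η) (hs : ∀ v, τ v ⊆ η v) (hne : ∀ v, (τ v).Nonempty) : IsCell G H τ :=
  ⟨hne, fun x y hxy a ha b hb => h.2 x y hxy a (hs x ha) b (hs y hb)⟩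

/-- Deleting an earlier vertex lowers the exponent of the sign of a later one by one. -/
theorem signExp_del (η : V → Finset W) (p q : V × W) (hp : p.2 ∈ η p.1)
    (hne : ∀ u, (del η p.1 p.2 u).Nonempty) :
    signExp η q.1 q.2 = signExp (del η p.1 p.2) q.1 q.2 +
      if p.1 < q.1 ∨ p.1 = q.1 ∧ p.2 < q.2 then 1 else 0 := by
  unfold signExp
  rw [Finset.sum_congr rfl fun u _ => card_sub_del η p.1 p.2 hp hne u, Finset.sum_add_distrib]
  have h2 : ((η q.1).filter (· < q.2)).card = ((del η p.1 p.2 q.1).filter (· < q.2)).card +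
      if p.1 = q.1 ∧ p.2 < q.2 then 1 else 0 := by
    unfold del
    by_cases h : q.1 = p.1
    · rw [h, Function.update_self, Finset.filter_erase]
      by_cases h' : p.2 < q.2
      · have hm : p.2 ∈ (η p.1).filter (· < q.2) := by simp [hp, h']
        have := Finset.card_pos.2 ⟨_, hm⟩
        simp [Finset.card_erase_of_mem hm, h']; omega
      · rw [Finset.erase_eq_of_notMem (by simp [h'])]
        simp [h']
    · simp [Function.update_of_ne h, Ne.symm h]
  rw [h2]
  simp only [Finset.sum_ite_eq', Finset.mem_filter, Finset.mem_univ, true_and]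
  rcases lt_trichotomy p.1 q.1 with h | h | h
  · simp [h, h.ne]; omega
  · simp [h]; omega
  · simp [h.not_gt, h.ne']

theorem sum_incidence_mul_incidence (η ρ : V → Finset W) (hρ : ∀ v, (ρ v).Nonempty) :
    ∑ p : V × W, (if p.2 ∈ η p.1 then
      (-1) ^ signExp η p.1 p.2 * incidence (del η p.1 p.2) ρ else 0) = 0 := by
  set F : V × W → V × W → ℤ := fun p q =>
    if p.2 ∈ η p.1 ∧ q.2 ∈ η q.1 ∧ p ≠ q ∧ ρ = del (del η p.1 p.2) q.1 q.2 then
      (-1) ^ (signExp η p.1 p.2 + signExp (del η p.1 p.2) q.1 q.2) else 0 with hF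
  have h1 : ∀ p : V × W, (if p.2 ∈ η p.1 then
      (-1) ^ signExp η p.1 p.2 * incidence (del η p.1 p.2) ρ else 0) = ∑ q, F p q := by
    intro p
    by_cases hp : p.2 ∈ η p.1
    · rw [if_pos hp, incidence_eq, Finset.mul_sum]
      refine Finset.sum_congr rfl fun q _ => ?_
      simp only [hF, mem_del, hp, true_and, mul_ite, mul_zero, pow_add, ne_eq, and_assoc,
        Prod.mk.eta, eq_comm (a := q) (b := p)]
    · simp [hF, hp]
  have h2 : ∀ p q, F p q = - F q p := by
    intro p q
    simp only [hF]
    by_cases h : p.2 ∈ η p.1 ∧ q.2 ∈ η q.1 ∧ p ≠ q ∧ ρ = del (del η p.1 p.2) q.1 q.2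
    · have h' : q.2 ∈ η q.1 ∧ p.2 ∈ η p.1 ∧ q ≠ p ∧ ρ = del (del η q.1 q.2) p.1 p.2 :=
        ⟨h.2.1, h.1, h.2.2.1.symm, by rw [del_comm]; exact h.2.2.2⟩
      rw [if_pos h, if_pos h']
      obtain ⟨hp, hq, hpq, he⟩ := h
      have n1 : ∀ u, (del η p.1 p.2 u).Nonempty := fun u => by
        refine (hρ u).mono fun y hy => ?_
        rw [he, mem_del] at hy; exact hy.1
      have n2 : ∀ u, (del η q.1 q.2 u).Nonempty := fun u => by
        refine (hρ u).mono fun y hy => ?_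
        rw [h'.2.2.2, mem_del] at hy; exact hy.1
      have e1 := signExp_del η p q hp n1
      have e2 := signExp_del η q p hq n2
      have e3 : (-1 : ℤ) ^ (signExp η p.1 p.2 + signExp (del η p.1 p.2) q.1 q.2) =
          (-1) ^ (signExp η q.1 q.2 + signExp (del η q.1 q.2) p.1 p.2 + 1) := by
        apply neg_one_pow_congr
        have hx : (p.1 < q.1 ∨ p.1 = q.1 ∧ p.2 < q.2) ↔ ¬ (q.1 < p.1 ∨ q.1 = p.1 ∧ q.2 < p.2) := by
          rcases lt_trichotomy p.1 q.1 with h | h | h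
          · simp [h, h.not_gt, h.ne']
          · have : p.2 ≠ q.2 := fun h2 => hpq (Prod.ext h h2)
            rw [h]; simp only [lt_irrefl, true_and, false_or, not_lt]
            exact ⟨le_of_lt, fun h => lt_of_le_of_ne h this⟩
          · simp [h, h.not_gt, h.ne']
        rw [e1, e2]
        by_cases hc : (q.1 < p.1 ∨ q.1 = p.1 ∧ q.2 < p.2)
        · rw [if_neg (fun h => hx.1 h hc), if_pos hc]; simp only [Nat.even_iff]; omega
        · rw [if_pos (hx.2 hc), if_neg hc]; simp only [Nat.even_iff]; omega
      rw [e3, pow_succ]; ring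
    · have h' : ¬ (q.2 ∈ η q.1 ∧ p.2 ∈ η p.1 ∧ q ≠ p ∧ ρ = del (del η q.1 q.2) p.1 p.2) := by
        intro h'
        exact h ⟨h'.2.1, h'.1, h'.2.2.1.symm, by rw [del_comm]; exact h'.2.2.2⟩
      rw [if_neg h, if_neg h', neg_zero]
  rw [Finset.sum_congr rfl fun p _ => h1 p]
  have h3 : ∑ p, ∑ q, F p q = - ∑ p, ∑ q, F p q := by
    conv_lhs => rw [Finset.sum_comm]
    simp only [← Finset.sum_neg_distrib]
    exact Finset.sum_congr rfl fun p _ => Finset.sum_congr rfl fun q _ => h2 q p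
  linarith

theorem exists_of_incidence_ne_zero (η τ : V → Finset W) (h : incidence η τ ≠ 0) :
    ∃ v, ∃ w ∈ η v, τ = del η v w := by
  by_contra! hc
  exact h (Finset.sum_eq_zero fun v _ => Finset.sum_eq_zero fun w hw => if_neg (hc v w hw))

theorem sum_cell_incidence (G : SimpleGraph V) (H : SimpleGraph W) (i : ℕ)
    (η : Cell G H (i + 2)) (ρ : Cell G H i) :
    ∑ τ : Cell G H (i + 1), incidence η.val τ.val * incidence τ.val ρ.val = 0 := by
  rw [← sum_incidence_mul_incidence η.val ρ.val ρ.isCell.1]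
  simp only [incidence_eq η.val, Finset.sum_mul]
  rw [Finset.sum_comm]
  refine Finset.sum_congr rfl fun p _ => ?_
  by_cases hp : p.2 ∈ η.val p.1
  · simp only [hp, true_and, if_true]
    by_cases h0 : incidence (del η.val p.1 p.2) ρ.val = 0
    · rw [h0, mul_zero]
      refine Finset.sum_eq_zero fun τ _ => ?_
      by_cases h : τ.val = del η.val p.1 p.2
      · rw [h, h0, mul_zero]
      · rw [if_neg h, zero_mul]
    · obtain ⟨v, w, hw, he⟩ := exists_of_incidence_ne_zero _ _ h0
      have hne : ∀ u, (del η.val p.1 p.2 u).Nonempty := fun u => by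
        refine (ρ.isCell.1 u).mono fun y hy => ?_
        rw [he, mem_del] at hy; exact hy.1
      have hc : IsCell G H (del η.val p.1 p.2) :=
        η.isCell.of_subset (fun v y hy => ((mem_del _ _ _ _ _).1 hy).1) hne
      have hd : cellDim (del η.val p.1 p.2) = i + 1 := by
        have := cellDim_del η.val p.1 p.2 hp hne
        have := η.dim_eq
        omega
      rw [Finset.sum_eq_single (⟨del η.val p.1 p.2, hc, hd⟩ : Cell G H (i + 1))]
      · simp
      · intro τ _ hτ
        rw [if_neg (fun h => hτ (Cell.ext h)), zero_mul]
      · simp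
  · simp [hp]

theorem boundary_comp_boundary (R : Type) [CommRing R] (G : SimpleGraph V) (H : SimpleGraph W)
    (i : ℕ) : boundary R G H i ∘ₗ boundary R G H (i + 1) = 0 := by
  refine Finsupp.lhom_ext' fun η => LinearMap.ext_ring ?_
  ext ρ
  classical
  have := congrArg (Int.cast (R := R)) (sum_cell_incidence G H i η ρ)
  push_cast at this
  simpa [boundary, Finsupp.linearCombination_single, Finsupp.finsetSum_apply,
    Finsupp.single_apply] using this

/-- The cellular chain complex of `Hom(G, H)` with coefficients in `R`. -/
def chainComplex (R : Type) [CommRing R] (G : SimpleGraph V) (H : SimpleGraph W) :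
    ChainComplex (ModuleCat.{0} R) ℕ :=
  ChainComplex.of (fun i => ModuleCat.of R (Chains R G H i))
    (fun i => ModuleCat.ofHom (boundary R G H i)) fun i => by
      rw [← ModuleCat.ofHom_comp, boundary_comp_boundary]; rfl

/-- The exponent of the sign of the permutation of factors
`∏ u : V', Δ(η u) → ∏ x : V, Δ(η (φ x))` with respect to the product orientations: the sum of the
products of the dimensions of all pairs of factors whose order is reversed. -/
def permExp (φ : V ≃ V') (η : V' → Finset W) : ℕ :=
  ∑ x : V, ∑ y : V, if x < y ∧ φ y < φ x then
    ((η (φ x)).card - 1) * ((η (φ y)).card - 1) else 0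

/-- Precomposition of a cell of `Hom(G', H)` with a graph isomorphism `G ≃g G'`. -/
def Cell.pullback {G : SimpleGraph V} {G' : SimpleGraph V'} (φ : G ≃g G') (H : SimpleGraph W)
    {i : ℕ} (η : Cell G' H i) : Cell G H i :=
  ⟨fun v => η.val (φ v), ⟨fun _ => η.isCell.1 _, fun _ _ h => η.isCell.2 _ _ (φ.map_rel_iff.2 h)⟩,
    (φ.toEquiv.sum_comp fun v => ((η.val v).card - 1)).trans η.dim_eq⟩

/-- The map on cellular chains induced by precomposition with a graph isomorphism. -/
def pullbackChains (R : Type) [CommRing R] {G : SimpleGraph V} {G' : SimpleGraph V'}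
    (φ : G ≃g G') (H : SimpleGraph W) (i : ℕ) : Chains R G' H i →ₗ[R] Chains R G H i :=
  Finsupp.linearCombination R fun η =>
    Finsupp.single (η.pullback φ H) ((-1) ^ permExp φ.toEquiv η.val)

theorem del_comp (φ : V ≃ V') (η : V' → Finset W) (x : V) (w : W) :
    del (fun v => η (φ v)) x w = fun v => del η (φ x) w (φ v) := by
  funext v
  unfold del
  by_cases h : v = x
  · subst h; simp
  · simp [Function.update_of_ne h, Function.update_of_ne (φ.injective.ne h)]

theorem parity_aux (φ : V ≃ V') (D : V → ℕ) (z : V) :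
    Even ((∑ x, ∑ y, if x < y ∧ φ y < φ x then
        (D x + if x = z then 1 else 0) * (D y + if y = z then 1 else 0) else 0) +
      (∑ x, ∑ y, if x < y ∧ φ y < φ x then D x * D y else 0) +
      (∑ x, if x < z then D x else 0) + ∑ x, if φ x < φ z then D x else 0) := by
  have h1 : ∀ x y, (if x < y ∧ φ y < φ x then
        (D x + if x = z then 1 else 0) * (D y + if y = z then 1 else 0) else 0) =
      (if x < y ∧ φ y < φ x then D x * D y else 0) +
      ((if y = z then (if x < z ∧ φ z < φ x then D x else 0) else 0) +
       (if x = z then (if z < y ∧ φ y < φ z then D y else 0) else 0)) := by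
    intro x y
    by_cases hx : x = z <;> by_cases hy : y = z
    · subst hx; subst hy; simp
    · subst hx
      by_cases h : x < y ∧ φ y < φ x
      · simp [hy, h]; ring
      · simp [hy, h]
    · subst hy
      by_cases h : x < y ∧ φ y < φ x
      · simp [hx, h]; ring
      · simp [hx, h]
    · simp [hx, hy]
  simp only [h1, Finset.sum_add_distrib]
  have h2 : ∑ x : V, ∑ y : V, (if y = z then (if x < z ∧ φ z < φ x then D x else 0) else 0) =
      ∑ x, (if x < z ∧ φ z < φ x then D x else 0) := by simp
  have h3 : ∑ x : V, ∑ y : V, (if x = z then (if z < y ∧ φ y < φ z then D y else 0) else 0) =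
      ∑ x, (if z < x ∧ φ x < φ z then D x else 0) := by rw [Finset.sum_comm]; simp
  rw [h2, h3]
  have h4 : Even (∑ x, ((if x < z ∧ φ z < φ x then D x else 0) +
      (if z < x ∧ φ x < φ z then D x else 0) + (if x < z then D x else 0) +
      (if φ x < φ z then D x else 0))) := by
    refine Finset.even_sum _ fun x _ => ?_
    rcases lt_trichotomy x z with h | h | h
    · rcases lt_trichotomy (φ x) (φ z) with h' | h' | h'
      · simp [h, h', h.not_gt, h'.not_gt]
      · exact absurd (φ.injective h') h.ne
      · simp [h, h', h.not_gt, h'.not_gt]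
    · subst h; simp
    · rcases lt_trichotomy (φ x) (φ z) with h' | h' | h'
      · simp [h, h', h.not_gt, h'.not_gt]
      · exact absurd (φ.injective h') h.ne'
      · simp [h, h', h.not_gt, h'.not_gt]
  simp only [Finset.sum_add_distrib] at h4
  rw [Nat.even_iff] at h4 ⊢
  omega

theorem sign_pullback (φ : V ≃ V') (η : V' → Finset W) (z : V) (w : W) (hw : w ∈ η (φ z))
    (hne : ∀ u, (del η (φ z) w u).Nonempty) :
    (-1 : ℤ) ^ permExp φ η * (-1) ^ signExp (fun v => η (φ v)) z w =
      (-1) ^ signExp η (φ z) w * (-1) ^ permExp φ (del η (φ z) w) := by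
  have hc := card_sub_del η (φ z) w hw hne
  have e := parity_aux φ (fun x => (del η (φ z) w (φ x)).card - 1) z
  have hD : ∀ x, (η (φ x)).card - 1 =
      ((del η (φ z) w (φ x)).card - 1) + if x = z then 1 else 0 := by
    intro x; rw [hc (φ x)]; simp
  rw [← pow_add, ← pow_add]
  apply neg_one_pow_congr
  have s1 : signExp (fun v => η (φ v)) z w =
      (∑ x, if x < z then (del η (φ z) w (φ x)).card - 1 else 0) +
        ((η (φ z)).filter (· < w)).card := by
    unfold signExp
    rw [← Finset.sum_filter]
    congr 1
    refine Finset.sum_congr rfl fun x hx => ?_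
    have : x ≠ z := (Finset.mem_filter.1 hx).2.ne
    rw [hD x]; simp [this]
  have s2 : signExp η (φ z) w =
      (∑ x, if φ x < φ z then (del η (φ z) w (φ x)).card - 1 else 0) +
        ((η (φ z)).filter (· < w)).card := by
    unfold signExp
    rw [φ.sum_comp fun u => if u < φ z then (del η (φ z) w u).card - 1 else 0,
      ← Finset.sum_filter]
    congr 1
    refine Finset.sum_congr rfl fun x hx => ?_
    have : x ≠ φ z := (Finset.mem_filter.1 hx).2.ne
    rw [hc x]; simp [this]
  have s3 : permExp φ η = ∑ x, ∑ y, if x < y ∧ φ y < φ x then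
      (((del η (φ z) w (φ x)).card - 1) + if x = z then 1 else 0) *
      (((del η (φ z) w (φ y)).card - 1) + if y = z then 1 else 0) else 0 := by
    unfold permExp
    simp only [hD]
  rw [s1, s2, s3]
  unfold permExp
  simp only [Nat.even_iff] at e ⊢
  omega

theorem incidence_pullback (φ : V ≃ V') (η τ : V' → Finset W) (hτ : ∀ v, (τ v).Nonempty) :
    (-1) ^ permExp φ η * incidence (fun v => η (φ v)) (fun v => τ (φ v)) =
      incidence η τ * (-1) ^ permExp φ τ := by
  unfold incidence
  rw [← φ.sum_comp fun v => ∑ w ∈ η v, if τ = del η v w then (-1) ^ signExp η v w else 0,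
    Finset.mul_sum, Finset.sum_mul]
  refine Finset.sum_congr rfl fun z _ => ?_
  rw [Finset.mul_sum, Finset.sum_mul]
  refine Finset.sum_congr rfl fun w hw => ?_
  have hiff : ((fun v => τ (φ v)) = del (fun v => η (φ v)) z w) ↔ τ = del η (φ z) w := by
    rw [del_comp]
    refine ⟨fun h => funext fun u => ?_, fun h => by rw [← h]⟩
    have := congrFun h (φ.symm u)
    simpa using this
  by_cases h : τ = del η (φ z) w
  · rw [if_pos (hiff.2 h), if_pos h, sign_pullback φ η z w hw (fun u => h ▸ hτ u), ← h]
  · rw [if_neg (fun h' => h (hiff.1 h')), if_neg h, mul_zero, zero_mul]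

theorem pullbackChains_comm (R : Type) [CommRing R] {G : SimpleGraph V} {G' : SimpleGraph V'}
    (φ : G ≃g G') (H : SimpleGraph W) (i : ℕ) :
    boundary R G H i ∘ₗ pullbackChains R φ H (i + 1) =
      pullbackChains R φ H i ∘ₗ boundary R G' H i := by
  refine Finsupp.lhom_ext' fun η => LinearMap.ext_ring ?_
  have hinj : Function.Bijective (Cell.pullback φ H (i := i)) := by
    refine ⟨fun a b h => Cell.ext (funext fun u => ?_), fun τ => ⟨τ.pullback φ.symm H, ?_⟩⟩
    · have := congrFun (congrArg Cell.val h) (φ.symm u)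
      simpa [Cell.pullback] using this
    · exact Cell.ext (funext fun u => by simp [Cell.pullback])
  have key : ∀ τ : Cell G' H i, ((-1 : R) ^ permExp φ.toEquiv η.val) *
      ((incidence (η.pullback φ H).1 (τ.pullback φ H).1 : ℤ) : R) =
      ((incidence η.val τ.val : ℤ) : R) * (-1) ^ permExp φ.toEquiv τ.val := fun τ => by
    have := congrArg (Int.cast (R := R)) (incidence_pullback φ.toEquiv η.val τ.val τ.isCell.1)
    push_cast at this
    exact this
  simp only [LinearMap.comp_apply, Finsupp.lsingle_apply, pullbackChains, boundary,
    Finsupp.linearCombination_single, one_smul, map_sum, Finset.smul_sum, Finsupp.smul_single,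
    smul_eq_mul]
  rw [← hinj.sum_comp]
  exact Finset.sum_congr rfl fun τ _ => by rw [key]

/-- The chain map `C(Hom(G', H)) ⟶ C(Hom(G, H))` induced by a graph isomorphism `G ≃g G'`. -/
def pullback (R : Type) [CommRing R] {G : SimpleGraph V} {G' : SimpleGraph V'}
    (φ : G ≃g G') (H : SimpleGraph W) : chainComplex R G' H ⟶ chainComplex R G H :=
  ChainComplex.ofHom (fun i => ModuleCat.ofHom (pullbackChains R φ H i)) fun i => by
    simp only [chainComplex, ChainComplex.of_d]
    rw [← ModuleCat.ofHom_comp, ← ModuleCat.ofHom_comp, pullbackChains_comm]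

/-- The `i`-th (cellular) homology of `Hom(G, H)` with coefficients in `R`. -/
def homology (R : Type) [CommRing R] (G : SimpleGraph V) (H : SimpleGraph W) (i : ℕ) :
    ModuleCat.{0} R := (chainComplex R G H).homology i

/-- The map induced on homology by a graph isomorphism `G ≃g G'`. -/
def homologyPullback (R : Type) [CommRing R] {G : SimpleGraph V} {G' : SimpleGraph V'}
    (φ : G ≃g G') (H : SimpleGraph W) (i : ℕ) : homology R G' H i ⟶ homology R G H i :=
  HomologicalComplex.homologyMap (pullback R φ H) i

end

/-- The reflection `x ↦ -x` of the cycle on `ℤ/m`. -/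
def cycleReflection (m : ℕ) [NeZero m] : SimpleGraph.cycleGraph m ≃g SimpleGraph.cycleGraph m where
  toEquiv := Equiv.neg (Fin m)
  map_rel_iff' := by
    intro a b
    simp only [SimpleGraph.cycleGraph_adj', Equiv.neg_apply, sub_neg_eq_add]
    rw [neg_add_eq_sub, neg_add_eq_sub, or_comm]

end HomComplex

end

noncomputable section

/-! Colouring the vertices `1, …, 2r` only gives the complex of a path, which has the homology of
the sphere of dimension `n - 2`. The mapping cone of the restriction from the complex of the cycle
to that of the path is concrete. It is `cone`: its members are nonempty at `1, …, 2r`, while the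
vertex `0` may or may not be coloured. Members with `0` uncoloured (`pathCells`) form a subcomplex,
and members with `0` coloured (`cycleCells`) form the quotient. Everything is read off the long
exact sequence of this pair.

All complexes are relative complexes of convex families of subsets of (vertex, colour), graded by
cardinality: a cycle cell of dimension `i` has `i + 2r + 1` elements, a path cell of dimension `i`
has `i + 2r`.

The cone is computed by toggling: a family closed under adding and removing one element is acyclic,
and such families are cut off one by one. If some colour is missing at both neighbours of `0`, it
can be toggled at `0`. On the remaining part (`full`) further toggles leave, below cardinality `2n +
2r - 5`, the single member `baseCell` (`acyclicAt_maxFamily`, `acyclicAt_altFamily`). Hence in this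
range the cone has one homology class, in cardinality `n + 2r - 2`. It is detected by `phi`, which
sums the coefficients over complementary colour sets at `1` and `2r` with shuffle signs.

The top class of the path is detected by `alpha 1`. The map from the path to the cone is therefore
one number in that degree, and `phi_eq_alpha` finds `phi = -(1 + (-1)^n) alpha 1`. So the homology
of the cycle in dimensions `n - 2` and `n - 3` is the kernel and the cokernel of multiplication by
`1 + (-1)^n`, and the bottom class of the path gives dimension `0`.

The reflection swaps the two colour sets that enter `phi`. Counting inversions shows that it
multiplies `phi` by `-(-1)^r` (`phi_reindex`). Passing from joins of simplices to products
contributes another `(-1)^r` (`neg_one_pow_permExp`), so the reflection acts by `-1` in dimension `n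
- 3`. -/

namespace SetComplex

open Finset

/-! ### Relative chain complexes of convex families of finite sets. -/

section

variable {T : Type} [LinearOrder T] [Fintype T] (R : Type) [CommRing R]

/-- The sign with which `s` enters the boundary of `insert x s`. -/
def sg (x : T) (s : Finset T) : R := (-1) ^ (s.filter (· < x)).card

theorem sg_mul_self (x : T) (s : Finset T) : sg R x s * sg R x s = 1 := by
  unfold sg
  rw [← pow_add, ← two_mul, pow_mul]; simp

theorem sg_insert {x : T} {s : Finset T} (hx : x ∉ s) (y : T) :
    sg R y (insert x s) = (if x < y then -1 else 1) * sg R y s := by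
  unfold sg
  rw [filter_insert]
  split_ifs with h
  · rw [card_insert_of_notMem (by simp [hx]), pow_succ]; ring
  · simp

theorem sg_insert_mul {x y : T} {s : Finset T} (hx : x ∉ s) (hy : y ∉ s) (hxy : x ≠ y) :
    sg R y (insert x s) * sg R x (insert y s) = -(sg R y s * sg R x s) := by
  rw [sg_insert R hx, sg_insert R hy]
  rcases lt_or_gt_of_ne hxy with h | h
  · simp [h, h.not_gt]
  · simp [h, h.not_gt]

theorem sg_mul_sg_insert {x y : T} {s : Finset T} (hx : x ∉ s) (hy : y ∉ s) (hxy : x ≠ y) :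
    sg R x s * sg R y (insert x s) = -(sg R y s * sg R x (insert y s)) := by
  rw [sg_insert R hx, sg_insert R hy]
  rcases lt_or_gt_of_ne hxy with h | h
  · simp [h, h.not_gt]; ring
  · simp [h, h.not_gt]; ring

/-- The boundary of the (augmented) full simplex with vertex set `T`. -/
def bd : (Finset T → R) →ₗ[R] (Finset T → R) where
  toFun c s := ∑ x ∈ sᶜ, sg R x s * c (insert x s)
  map_add' c d := by ext s; simp [mul_add, sum_add_distrib]
  map_smul' a c := by
    ext s; simp only [Pi.smul_apply, smul_eq_mul, RingHom.id_apply, mul_sum]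
    exact sum_congr rfl fun _ _ => by ring

theorem bd_apply (c : Finset T → R) (s : Finset T) :
    bd R c s = ∑ x ∈ sᶜ, sg R x s * c (insert x s) := rfl

theorem bd_bd (c : Finset T → R) : bd R (bd R c) = 0 := by
  ext s
  simp only [bd_apply, mul_sum, Pi.zero_apply]
  rw [sum_sigma']
  refine sum_involution (fun p _ => ⟨p.2, p.1⟩) ?_ ?_ ?_ ?_
  · rintro ⟨x, y⟩ h
    simp only [mem_sigma, mem_compl, mem_insert, not_or] at h
    simp only
    rw [Finset.insert_comm y x, ← mul_assoc, ← mul_assoc,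
      sg_mul_sg_insert R h.1 h.2.2 (Ne.symm h.2.1)]
    ring
  · rintro ⟨x, y⟩ h _ he
    simp only [mem_sigma, mem_compl, mem_insert, not_or] at h
    simp only [Sigma.mk.injEq, heq_eq_eq] at he
    exact h.2.1 he.1
  · rintro ⟨x, y⟩ h
    simp only [mem_sigma, mem_compl, mem_insert, not_or] at h ⊢
    exact ⟨h.2.2, Ne.symm h.2.1, h.1⟩
  · rintro ⟨x, y⟩ h
    rfl

/-- Chains of cardinality `i` supported on the family `P`. -/
def chains (P : Set (Finset T)) (i : ℕ) : Submodule R (Finset T → R) where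
  carrier := {c | ∀ s, c s ≠ 0 → s ∈ P ∧ s.card = i}
  zero_mem' := by simp
  add_mem' := by
    intro a b ha hb s hs
    by_cases h : a s = 0
    · exact hb s (by simpa [h] using hs)
    · exact ha s h
  smul_mem' := by
    intro a c hc s hs
    exact hc s (fun h => hs (by simp [h]))

variable {R}

theorem chains_mono {P Q : Set (Finset T)} (h : P ⊆ Q) (i : ℕ) : chains R P i ≤ chains R Q i :=
  fun _ hc s hs => ⟨h (hc s hs).1, (hc s hs).2⟩

theorem chains_apply_of_notMem {P : Set (Finset T)} {i : ℕ} {c : Finset T → R}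
    (hc : c ∈ chains R P i) {s : Finset T} (hs : s ∉ P) : c s = 0 := by
  by_contra h; exact hs (hc s h).1

variable (R)

/-- Restriction of a chain to a family. -/
def res (P : Set (Finset T)) : (Finset T → R) →ₗ[R] (Finset T → R) where
  toFun c := P.indicator c
  map_add' c d := Set.indicator_add P c d
  map_smul' a c := Set.indicator_const_smul P a c

variable {R}

theorem res_apply_mem {P : Set (Finset T)} (c : Finset T → R) {s : Finset T} (h : s ∈ P) :
    res R P c s = c s := Set.indicator_of_mem h c

theorem res_apply_notMem {P : Set (Finset T)} (c : Finset T → R) {s : Finset T} (h : s ∉ P) :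
    res R P c s = 0 := Set.indicator_of_notMem h c

theorem res_mem_chains {P Q : Set (Finset T)} {i : ℕ} {c : Finset T → R}
    (hc : c ∈ chains R P i) : res R Q c ∈ chains R (P ∩ Q) i := by
  intro s hs
  by_cases h : s ∈ Q
  · rw [res_apply_mem _ h] at hs
    exact ⟨⟨(hc s hs).1, h⟩, (hc s hs).2⟩
  · exact absurd (res_apply_notMem _ h) hs

theorem res_eq_self {P : Set (Finset T)} {i : ℕ} {c : Finset T → R}
    (hc : c ∈ chains R P i) : res R P c = c := by
  ext s
  by_cases h : s ∈ P
  · exact res_apply_mem _ h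
  · rw [res_apply_notMem _ h, chains_apply_of_notMem hc h]

theorem bd_card {i : ℕ} {P : Set (Finset T)} {c : Finset T → R} (hc : c ∈ chains R P (i + 1))
    {s : Finset T} (hs : bd R c s ≠ 0) : s.card = i := by
  rw [bd_apply] at hs
  obtain ⟨x, hx, h⟩ := exists_ne_zero_of_sum_ne_zero hs
  have := (hc _ (right_ne_zero_of_mul h)).2
  rw [card_insert_of_notMem (by simpa using hx)] at this
  omega

theorem res_bd_mem_chains {i : ℕ} {P Q : Set (Finset T)} {c : Finset T → R}
    (hc : c ∈ chains R P (i + 1)) : res R Q (bd R c) ∈ chains R Q i := by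
  intro s hs
  by_cases h : s ∈ Q
  · rw [res_apply_mem _ h] at hs
    exact ⟨h, bd_card hc hs⟩
  · exact absurd (res_apply_notMem _ h) hs

variable (R)

/-- Relative cycles of the family `P`. -/
def cyc (P : Set (Finset T)) (i : ℕ) : Submodule R (Finset T → R) :=
  chains R P i ⊓ LinearMap.ker (res R P ∘ₗ bd R)

/-- Relative boundaries of the family `P`. -/
def bdry (P : Set (Finset T)) (i : ℕ) : Submodule R (Finset T → R) :=
  (chains R P (i + 1)).map (res R P ∘ₗ bd R)

/-- The relative complex of the family `P` is exact at cardinality `i`. -/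
def AcyclicAt (P : Set (Finset T)) (i : ℕ) : Prop := cyc R P i ≤ bdry R P i

variable {R}

theorem mem_cyc {P : Set (Finset T)} {i : ℕ} {c : Finset T → R} :
    c ∈ cyc R P i ↔ c ∈ chains R P i ∧ ∀ s ∈ P, bd R c s = 0 := by
  refine and_congr Iff.rfl ⟨fun h s hs => ?_, fun h => ?_⟩
  · rw [← res_apply_mem (bd R c) hs]; exact congrFun h s
  · ext s
    by_cases hs : s ∈ P
    · simpa [res_apply_mem _ hs] using h s hs
    · simp [res_apply_notMem _ hs]

theorem bdry_le_chains (P : Set (Finset T)) (i : ℕ) : bdry R P i ≤ chains R P i := by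
  rintro _ ⟨b, hb, rfl⟩
  exact res_bd_mem_chains hb

theorem mem_bdry' {P : Set (Finset T)} {i : ℕ} {c : Finset T → R} (hc : c ∈ chains R P i) :
    c ∈ bdry R P i ↔ ∃ b ∈ chains R P (i + 1), ∀ s ∈ P, bd R b s = c s := by
  refine exists_congr fun b => and_congr Iff.rfl ⟨?_, fun h => ?_⟩
  · rintro rfl s hs
    exact (res_apply_mem _ hs).symm
  · ext s
    by_cases hs : s ∈ P
    · exact (res_apply_mem _ hs).trans (h s hs)
    · rw [chains_apply_of_notMem hc hs]; exact res_apply_notMem _ hs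

/-- A face of a set outside an upper set `Q` is again outside `Q`. -/
theorem bd_eq_zero_of_isLowerSet {P Q : Set (Finset T)} {i : ℕ} (hQ : IsUpperSet Q)
    {c : Finset T → R} (hc : c ∈ chains R (P ∩ Qᶜ) i) {s : Finset T} (hs : s ∈ Q) :
    bd R c s = 0 := by
  rw [bd_apply]
  refine sum_eq_zero fun x _ => ?_
  rw [chains_apply_of_notMem hc fun h => h.2 (hQ (subset_insert x s) hs), mul_zero]

/-- The relative boundary of a convex family squares to zero. -/
theorem bd_res_bd {P : Set (Finset T)} (hP : P.OrdConnected) {i : ℕ} {c : Finset T → R}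
    (hc : c ∈ chains R P i) {s : Finset T} (hs : s ∈ P) : bd R (res R P (bd R c)) s = 0 := by
  have h0 : bd R (bd R c) s = 0 := by rw [bd_bd]; rfl
  rw [← h0, bd_apply, bd_apply R (bd R c)]
  refine sum_congr rfl fun x _ => ?_
  by_cases h : insert x s ∈ P
  · rw [res_apply_mem _ h]
  -- By convexity, once `insert x s` has left `P` no larger set can lie in `P`, so the terms
  -- discarded by the restriction were zero already.
  · rw [res_apply_notMem _ h, bd_apply]
    congr 1
    symm
    refine sum_eq_zero fun y _ => ?_
    rw [chains_apply_of_notMem hc, mul_zero]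
    exact fun h' => h (hP.out hs h' ⟨subset_insert _ _, subset_insert _ _⟩)

theorem bdry_le_cyc {P : Set (Finset T)} (hP : P.OrdConnected) (i : ℕ) :
    bdry R P i ≤ cyc R P i := by
  rintro _ ⟨b, hb, rfl⟩
  exact mem_cyc.2 ⟨res_bd_mem_chains hb, fun s hs => bd_res_bd hP hb hs⟩

theorem acyclicAt_of_card {P : Set (Finset T)} {i : ℕ} (h : ∀ s ∈ P, s.card ≠ i) :
    AcyclicAt R P i := by
  intro c hc
  have : c = 0 := by
    ext s
    by_contra hs
    exact h s ((mem_cyc.1 hc).1 s hs).1 ((mem_cyc.1 hc).1 s hs).2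
  rw [this]; exact zero_mem _

/-! ### The long exact sequence of an upper and a lower part of a family. -/

section Pair

variable {P Q : Set (Finset T)} {i : ℕ}

/-- For an upper set `Q`, chains on `P ∩ Qᶜ` form a subcomplex of the chains on `P`, and chains on
`P ∩ Q` form the quotient. Restriction to `Q` is the projection. -/
theorem res_mem_cyc (hQ : IsUpperSet Q) {c : Finset T → R} (hc : c ∈ cyc R P i) :
    res R Q c ∈ cyc R (P ∩ Q) i := by
  obtain ⟨h1, h2⟩ := mem_cyc.1 hc
  refine mem_cyc.2 ⟨res_mem_chains h1, fun s hs => ?_⟩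
  rw [← h2 s hs.1, bd_apply, bd_apply]
  refine sum_congr rfl fun x _ => ?_
  rw [res_apply_mem _ (hQ (subset_insert x s) hs.2)]

/-- A cycle of `P` can be pushed off an upper part of `P` which is acyclic. -/
theorem exists_sub_mem_cyc_of_res (hP : P.OrdConnected) {c : Finset T → R} (hc : c ∈ cyc R P i)
    (h : res R Q c ∈ bdry R (P ∩ Q) i) :
    ∃ c' ∈ cyc R (P ∩ Qᶜ) i, c - c' ∈ bdry R P i := by
  obtain ⟨b, hb, hbc⟩ := h
  have hb' := chains_mono (R := R) (Set.inter_subset_left (s := P) (t := Q)) _ hb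
  have hd : res R P (bd R b) ∈ bdry R P i := ⟨b, hb', rfl⟩
  have hc' : c - res R P (bd R b) ∈ cyc R P i := sub_mem hc (bdry_le_cyc hP i hd)
  refine ⟨c - res R P (bd R b), mem_cyc.2 ⟨fun s hs => ?_, fun s hs => (mem_cyc.1 hc').2 s hs.1⟩,
    by simpa using hd⟩
  obtain ⟨h1, h2⟩ := (mem_cyc.1 hc').1 s hs
  refine ⟨⟨h1, fun hsQ => hs ?_⟩, h2⟩
  have := congrFun hbc s
  simp only [LinearMap.comp_apply] at this
  rw [res_apply_mem (P := P ∩ Q) _ ⟨h1, hsQ⟩, res_apply_mem _ hsQ] at this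
  rw [Pi.sub_apply, res_apply_mem _ h1, this, sub_self]

theorem exists_sub_mem_cyc (hP : P.OrdConnected) (hQ : IsUpperSet Q)
    (h : AcyclicAt R (P ∩ Q) i) {c : Finset T → R} (hc : c ∈ cyc R P i) :
    ∃ c' ∈ cyc R (P ∩ Qᶜ) i, c - c' ∈ bdry R P i :=
  exists_sub_mem_cyc_of_res hP hc (h (res_mem_cyc hQ hc))

theorem bdry_lower_le (hQ : IsUpperSet Q) : bdry R (P ∩ Qᶜ) i ≤ bdry R P i := by
  rintro _ ⟨b, hb, rfl⟩
  refine ⟨b, chains_mono Set.inter_subset_left _ hb, ?_⟩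
  ext s
  simp only [LinearMap.comp_apply]
  by_cases hs : s ∈ P
  · by_cases hsQ : s ∈ Q
    · rw [res_apply_mem _ hs, res_apply_notMem (P := P ∩ Qᶜ) _ (fun h => h.2 hsQ),
        bd_eq_zero_of_isLowerSet hQ hb hsQ]
    · rw [res_apply_mem _ hs, res_apply_mem (P := P ∩ Qᶜ) _ ⟨hs, hsQ⟩]
  · rw [res_apply_notMem _ hs, res_apply_notMem (P := P ∩ Qᶜ) _ fun h => hs h.1]

theorem cyc_lower_le (hQ : IsUpperSet Q) : cyc R (P ∩ Qᶜ) i ≤ cyc R P i := by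
  intro c hc
  refine mem_cyc.2 ⟨chains_mono Set.inter_subset_left _ (mem_cyc.1 hc).1, fun s hs => ?_⟩
  by_cases hsQ : s ∈ Q
  · exact bd_eq_zero_of_isLowerSet hQ (mem_cyc.1 hc).1 hsQ
  · exact (mem_cyc.1 hc).2 s ⟨hs, hsQ⟩

/-- Exactness of the long sequence at the homology of `P`. Each toggling argument below cuts a
family by an upper condition and treats the two parts separately. -/
theorem AcyclicAt.split (hP : P.OrdConnected) (hQ : IsUpperSet Q)
    (h1 : AcyclicAt R (P ∩ Q) i) (h2 : AcyclicAt R (P ∩ Qᶜ) i) : AcyclicAt R P i := by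
  intro c hc
  obtain ⟨c', hc', h⟩ := exists_sub_mem_cyc hP hQ h1 hc
  have := add_mem h (bdry_lower_le hQ (h2 hc'))
  simpa using this

/-- The connecting homomorphism on cycles. -/
theorem connecting_mem_cyc (hP : P.OrdConnected) {c : Finset T → R}
    (hc : c ∈ cyc R (P ∩ Q) (i + 1)) : res R (P ∩ Qᶜ) (bd R c) ∈ cyc R (P ∩ Qᶜ) i := by
  obtain ⟨h1, h2⟩ := mem_cyc.1 hc
  refine mem_cyc.2 ⟨res_bd_mem_chains h1, fun s hs => ?_⟩
  -- A relative cycle of the upper part has no boundary there, so its boundary in the lower part is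
  -- its whole boundary in `P`, to which `bd_res_bd` applies.
  have e : res R (P ∩ Qᶜ) (bd R c) = res R P (bd R c) := by
    ext t
    by_cases ht : t ∈ P
    · by_cases htQ : t ∈ Q
      · rw [res_apply_mem _ ht, res_apply_notMem (P := P ∩ Qᶜ) _ (fun h => h.2 htQ), h2 t ⟨ht, htQ⟩]
      · rw [res_apply_mem _ ht, res_apply_mem (P := P ∩ Qᶜ) _ ⟨ht, htQ⟩]
    · rw [res_apply_notMem _ ht, res_apply_notMem (P := P ∩ Qᶜ) _ fun h => ht h.1]
  rw [e]
  exact bd_res_bd hP (chains_mono Set.inter_subset_left _ h1) hs.1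

/-- Cycles of the upper part whose connecting cycle bounds `y` extend to cycles of `P`. -/
theorem sub_mem_cyc_of_connecting (hQ : IsUpperSet Q) {c y : Finset T → R}
    (hc : c ∈ cyc R (P ∩ Q) i) (hy : y ∈ chains R (P ∩ Qᶜ) i)
    (h : res R (P ∩ Qᶜ) (bd R y) = res R (P ∩ Qᶜ) (bd R c)) : c - y ∈ cyc R P i := by
  obtain ⟨h1, h2⟩ := mem_cyc.1 hc
  refine mem_cyc.2 ⟨sub_mem (chains_mono Set.inter_subset_left _ h1)
    (chains_mono Set.inter_subset_left _ hy), fun s hs => ?_⟩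
  rw [map_sub, Pi.sub_apply]
  by_cases hsQ : s ∈ Q
  · rw [h2 s ⟨hs, hsQ⟩, bd_eq_zero_of_isLowerSet hQ hy hsQ, sub_self]
  · have := congrFun h s
    rw [res_apply_mem (P := P ∩ Qᶜ) _ ⟨hs, hsQ⟩, res_apply_mem (P := P ∩ Qᶜ) _ ⟨hs, hsQ⟩] at this
    rw [this, sub_self]

/-- Restriction of boundaries to the upper part. -/
theorem res_mem_bdry (hQ : IsUpperSet Q) {c : Finset T → R} (hc : c ∈ bdry R P i) :
    res R Q c ∈ bdry R (P ∩ Q) i := by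
  obtain ⟨b, hb, rfl⟩ := hc
  refine ⟨res R Q b, res_mem_chains hb, ?_⟩
  ext s
  simp only [LinearMap.comp_apply]
  by_cases hsQ : s ∈ Q
  · rw [res_apply_mem _ hsQ]
    by_cases hs : s ∈ P
    · rw [res_apply_mem _ hs, res_apply_mem (P := P ∩ Q) _ ⟨hs, hsQ⟩, bd_apply, bd_apply]
      refine sum_congr rfl fun x _ => ?_
      rw [res_apply_mem _ (hQ (subset_insert x s) hsQ)]
    · rw [res_apply_notMem _ hs, res_apply_notMem (P := P ∩ Q) _ fun h => hs h.1]
  · rw [res_apply_notMem _ hsQ, res_apply_notMem (P := P ∩ Q) _ fun h => hsQ h.2]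

theorem res_upper_eq {c : Finset T → R} (hc : c ∈ chains R (P ∩ Q) i) : res R Q c = c := by
  refine res_eq_self (i := i) (P := Q) ?_
  exact chains_mono Set.inter_subset_right _ hc

theorem res_lower_eq_zero {c : Finset T → R} (hc : c ∈ chains R (P ∩ Qᶜ) i) :
    res R Q c = 0 := by
  ext s
  by_cases hs : s ∈ Q
  · rw [res_apply_mem _ hs, chains_apply_of_notMem hc fun h => h.2 hs]; rfl
  · rw [res_apply_notMem _ hs]; rfl

/-- Injectivity of the connecting homomorphism where `P` is acyclic: correcting `c` by `y` gives a
cycle of `P`, which bounds, and the correction disappears on the upper part. -/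
theorem mem_bdry_of_connecting (hQ : IsUpperSet Q)
    (hac : AcyclicAt R P i) {c : Finset T → R} (hc : c ∈ cyc R (P ∩ Q) i)
    {y : Finset T → R} (hy : y ∈ chains R (P ∩ Qᶜ) i)
    (h : res R (P ∩ Qᶜ) (bd R y) = res R (P ∩ Qᶜ) (bd R c)) : c ∈ bdry R (P ∩ Q) i := by
  have := res_mem_bdry hQ (hac (sub_mem_cyc_of_connecting hQ hc hy h))
  rwa [map_sub, res_upper_eq (mem_cyc.1 hc).1, res_lower_eq_zero hy, sub_zero] at this

theorem AcyclicAt.upper (hP : P.OrdConnected) (hQ : IsUpperSet Q)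
    (h1 : AcyclicAt R P (i + 1)) (h2 : AcyclicAt R (P ∩ Qᶜ) i) : AcyclicAt R (P ∩ Q) (i + 1) := by
  intro c hc
  obtain ⟨y, hy, h⟩ := h2 (connecting_mem_cyc hP hc)
  exact mem_bdry_of_connecting hQ h1 hc hy h

/-- A cycle of the lower part which bounds in `P` is, up to boundaries, a connecting cycle. -/
theorem exists_connecting (hQ : IsUpperSet Q) {a : Finset T → R}
    (ha : a ∈ chains R (P ∩ Qᶜ) i) (h : a ∈ bdry R P i) :
    ∃ c ∈ cyc R (P ∩ Q) (i + 1), res R (P ∩ Qᶜ) (bd R c) - a ∈ bdry R (P ∩ Qᶜ) i := by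
  obtain ⟨b, hb, hba⟩ := h
  have hbs : b = res R Q b + res R Qᶜ b := (Set.indicator_self_add_compl Q b).symm
  have hl := res_mem_chains (Q := Qᶜ) hb
  refine ⟨res R Q b, mem_cyc.2 ⟨res_mem_chains hb, fun s hs => ?_⟩, ?_⟩
  · have e : bd R b s = bd R (res R Q b) s + bd R (res R Qᶜ b) s := by
      conv_lhs => rw [hbs, map_add]
      rfl
    rw [bd_eq_zero_of_isLowerSet hQ hl hs.2, add_zero] at e
    rw [← e]
    have := congrFun hba s
    simp only [LinearMap.comp_apply] at this
    rw [res_apply_mem _ hs.1] at this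
    rw [this, chains_apply_of_notMem ha fun h => h.2 hs.2]
  · refine ⟨-res R Qᶜ b, neg_mem hl, ?_⟩
    have : res R (P ∩ Qᶜ) a = a := res_eq_self ha
    rw [← this, ← hba]
    simp only [LinearMap.comp_apply]
    have e2 : res R (P ∩ Qᶜ) (res R P (bd R b)) = res R (P ∩ Qᶜ) (bd R b) := by
      ext s
      by_cases hs : s ∈ P ∩ Qᶜ
      · rw [res_apply_mem _ hs, res_apply_mem _ hs, res_apply_mem _ hs.1]
      · rw [res_apply_notMem _ hs, res_apply_notMem _ hs]
    rw [e2]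
    have e3 : bd R b = bd R (res R Q b) + bd R (res R Qᶜ b) := by rw [← map_add, ← hbs]
    simp only [e3, map_add, map_neg]
    abel

end Pair

/-! ### Acyclicity criteria. -/

/-- Exactness can be checked on the fibres of a monotone map to finite sets. -/
theorem AcyclicAt.of_fibers {ι : Type} {P : Set (Finset T)} (hP : P.OrdConnected) {i : ℕ}
    (κ : Finset T → Finset ι) (hκ : ∀ s t, s ⊆ t → κ s ⊆ κ t)
    (h : ∀ a, AcyclicAt R (P ∩ {s | κ s = a}) i) : AcyclicAt R P i := by
  -- Induction on a strict bound `p` for the size of `κ` on the support. Each step replaces the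
  -- cycle by a homologous one without its top layer.
  have key : ∀ p, ∀ c ∈ cyc R P i, (∀ s, c s ≠ 0 → (κ s).card < p) → c ∈ bdry R P i := by
    intro p
    induction p with
    | zero =>
      intro c _ hs
      have : c = 0 := by ext s; by_contra hn; exact absurd (hs s hn) (by omega)
      rw [this]; exact zero_mem _
    | succ p ih =>
      intro c hc hs
      obtain ⟨hc1, hc2⟩ := mem_cyc.1 hc
      -- In the top layer fibres do not interact: if `insert x s` is in the support, its value under
      -- `κ` contains `a` and has at most as many elements, so it equals `a`.
      have hf : ∀ a : Finset ι, a.card = p →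
          res R {s | κ s = a} c ∈ cyc R (P ∩ {s | κ s = a}) i := by
        intro a ha
        refine mem_cyc.2 ⟨res_mem_chains hc1, fun s hsa => ?_⟩
        rw [← hc2 s hsa.1, bd_apply, bd_apply]
        refine sum_congr rfl fun x _ => ?_
        by_cases hx : insert x s ∈ {s | κ s = a}
        · rw [res_apply_mem _ hx]
        · rw [res_apply_notMem _ hx]
          by_cases h0 : c (insert x s) = 0
          · rw [h0]
          · have h1 := hs _ h0
            have h2 := hκ s _ (subset_insert x s)
            have h3 : κ s = a := hsa.2
            exact absurd ((eq_of_subset_of_card_le h2 (by rw [h3]; omega)).symm.trans h3) hx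
      have hb : ∀ a : Finset ι, ∃ b ∈ chains R (P ∩ {s | κ s = a}) (i + 1),
          (a.card = p → ∀ s ∈ P, κ s = a → bd R b s = c s) ∧ (a.card ≠ p → b = 0) := by
        intro a
        by_cases ha : a.card = p
        · obtain ⟨b, hb, hbc⟩ := h a (hf a ha)
          refine ⟨b, hb, fun _ s hs hsa => ?_, fun h => absurd ha h⟩
          have := congrFun hbc s
          simp only [LinearMap.comp_apply] at this
          rwa [res_apply_mem (P := P ∩ {s | κ s = a}) _ ⟨hs, hsa⟩,
            res_apply_mem _ (show s ∈ {s | κ s = a} from hsa)] at this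
        · exact ⟨0, zero_mem _, fun h => absurd h ha, fun _ => rfl⟩
      choose b hb hb1 hb2 using hb
      -- The fillings in the separate fibres glue to one chain, whose relative boundary agrees with
      -- `c` on the top layer and vanishes on higher layers.
      set B : Finset T → R := fun t => b (κ t) t with hB
      have hBc : B ∈ chains R P (i + 1) := fun s hs => ⟨(hb _ s hs).1.1, (hb _ s hs).2⟩
      have hd : res R P (bd R B) ∈ bdry R P i := ⟨B, hBc, rfl⟩
      have hc' : c - res R P (bd R B) ∈ cyc R P i := sub_mem hc (bdry_le_cyc hP i hd)
      have := ih _ hc' fun s hsn => ?_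
      · simpa using add_mem this hd
      · have hsP := ((mem_cyc.1 hc').1 s hsn).1
        rw [Pi.sub_apply, res_apply_mem _ hsP] at hsn
        by_contra hge
        apply hsn
        have hBx : bd R B s = if (κ s).card = p then bd R (b (κ s)) s else 0 := by
          by_cases he : (κ s).card = p
          · rw [if_pos he, bd_apply, bd_apply]
            refine sum_congr rfl fun x _ => ?_
            congr 1
            simp only [hB]
            by_cases hk : κ (insert x s) = κ s
            · rw [hk]
            · have h2 := hκ s _ (subset_insert x s)
              have h3 : (κ (insert x s)).card ≠ p := fun h4 =>
                hk (eq_of_subset_of_card_le h2 (by omega)).symm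
              rw [hb2 _ h3]
              symm
              exact chains_apply_of_notMem (hb (κ s)) fun h5 => hk h5.2
          · rw [if_neg he, bd_apply]
            refine sum_eq_zero fun x _ => ?_
            have h2 := card_le_card (hκ s _ (subset_insert x s))
            simp only [hB]
            rw [hb2 _ (by omega)]; simp
        rw [hBx]
        split_ifs with he
        · rw [hb1 _ he s hsP rfl, sub_self]
        · rw [sub_zero]
          by_contra h0
          have := hs s h0
          omega
  intro c hc
  exact key (∑ s, ((κ s).card + 1)) c hc fun s _ =>
    Nat.lt_of_lt_of_le (Nat.lt_succ_self _)
      (single_le_sum (f := fun s => (κ s).card + 1) (fun _ _ => Nat.zero_le _) (mem_univ s))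

/-- A family which is closed under adding and removing a fixed element is acyclic. -/
theorem acyclicAt_of_cone {P : Set (Finset T)} (x : T) (h : ∀ s ∈ P, insert x s ∈ P ∧ s.erase x ∈ P)
    (i : ℕ) : AcyclicAt R P i := by
  intro c hc
  obtain ⟨hc1, hc2⟩ := mem_cyc.1 hc
  -- The filling is the cone over `c` with apex `x`. Where `x ∈ s` its boundary is computed from the
  -- cycle condition for `c` at `s.erase x`.
  refine (mem_bdry' hc1).2 ⟨fun t => if x ∈ t then sg R x (t.erase x) * c (t.erase x) else 0,
    fun t ht => ?_, fun s hs => ?_⟩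
  · simp only [ne_eq, ite_eq_right_iff, not_forall] at ht
    obtain ⟨hx, ht⟩ := ht
    have := hc1 _ (right_ne_zero_of_mul ht)
    refine ⟨?_, ?_⟩
    · rw [← insert_erase hx]; exact (h _ this.1).1
    · have := this.2
      rw [card_erase_of_mem hx] at this
      have := card_pos.2 ⟨x, hx⟩
      omega
  · rw [bd_apply]
    by_cases hx : x ∈ s
    · obtain ⟨s', hs', rfl⟩ : ∃ s', x ∉ s' ∧ s = insert x s' :=
        ⟨s.erase x, notMem_erase _ _, (insert_erase hx).symm⟩
      have hsP := (h _ hs).2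
      rw [erase_insert hs'] at hsP
      have e := hc2 _ hsP
      rw [bd_apply, show s'ᶜ = insert x (insert x s')ᶜ by ext y; by_cases hy : y = x <;> simp [hy, hs'],
        sum_insert (by simp)] at e
      have e2 : ∑ y ∈ (insert x s')ᶜ, sg R y s' * c (insert y s') =
          - (sg R x s' * c (insert x s')) := by
        linear_combination e
      have e3 : ∀ y ∈ (insert x s')ᶜ, sg R y (insert x s') *
          (if x ∈ insert y (insert x s') then sg R x ((insert y (insert x s')).erase x) *
            c ((insert y (insert x s')).erase x) else 0) =
          -(sg R x s' * (sg R y s' * c (insert y s'))) := by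
        intro y hy
        simp only [mem_compl, mem_insert, not_or] at hy
        rw [if_pos (by simp), Finset.insert_comm, erase_insert (by simp [hs', Ne.symm hy.1]), ← mul_assoc,
          sg_insert_mul R hs' hy.2 (Ne.symm hy.1)]
        ring
      rw [sum_congr rfl e3, sum_neg_distrib, ← mul_sum, e2, mul_neg, neg_neg, ← mul_assoc,
        sg_mul_self, one_mul]
    · rw [sum_eq_single x]
      · rw [if_pos (mem_insert_self _ _), erase_insert hx, ← mul_assoc, sg_mul_self, one_mul]
      · intro y _ hy
        rw [if_neg, mul_zero]
        simp [hx, Ne.symm hy]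
      · intro hx'; simp [hx] at hx'

/-- The adjoint of the boundary. -/
theorem sum_mul_bd (g c : Finset T → R) :
    ∑ s, g s * bd R c s = ∑ t, (∑ x ∈ t, sg R x (t.erase x) * g (t.erase x)) * c t := by
  simp only [bd_apply, mul_sum, sum_mul]
  rw [sum_sigma', sum_sigma']
  refine sum_bij' (fun p _ => ⟨insert p.2 p.1, p.2⟩) (fun p _ => ⟨p.1.erase p.2, p.2⟩) ?_ ?_ ?_ ?_ ?_
  · rintro ⟨s, x⟩ h; simp
  · rintro ⟨s, x⟩ h; simp
  · rintro ⟨s, x⟩ h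
    have : x ∉ s := by simpa using h
    simp [erase_insert this]
  · rintro ⟨s, x⟩ h
    have : x ∈ s := by simpa using h
    simp [insert_erase this]
  · rintro ⟨s, x⟩ h
    have : x ∉ s := by simpa using h
    simp only [erase_insert this]
    ring

end

/-! ### Members as sets of pairs (vertex, colour), and the mapping cone. -/

section

variable {R : Type} [CommRing R]

/-- Possible vertices of cells: pairs of a vertex of the cycle and a colour. -/
abbrev Vtx (r n : ℕ) : Type := Fin (2 * r + 1) ×ₗ Fin n

variable {r n : ℕ}

/-- The pair consisting of the `j`-th vertex of the cycle and the colour `w`. -/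
def pt (r : ℕ) {n : ℕ} (j : ℕ) (w : Fin n) : Vtx r n := toLex (Fin.ofNat (2 * r + 1) j, w)

theorem pt_inj {i j : ℕ} {w x : Fin n} (hi : i ≤ 2 * r) (hj : j ≤ 2 * r) :
    pt r i w = pt r j x ↔ i = j ∧ w = x := by
  simp only [pt, EmbeddingLike.apply_eq_iff_eq, Prod.mk.injEq, Fin.ext_iff, Fin.val_ofNat]
  rw [Nat.mod_eq_of_lt (by omega), Nat.mod_eq_of_lt (by omega)]

theorem exists_pt (x : Vtx r n) : ∃ j ≤ 2 * r, ∃ w, x = pt r j w := by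
  refine ⟨(ofLex x).1.val, by omega, (ofLex x).2, ?_⟩
  simp [pt]

theorem pt_mem_insert {i j : ℕ} {w x : Fin n} {s : Finset (Vtx r n)} (hi : i ≤ 2 * r)
    (hj : j ≤ 2 * r) : pt r i w ∈ insert (pt r j x) s ↔ i = j ∧ w = x ∨ pt r i w ∈ s := by
  rw [mem_insert, pt_inj hi hj]

theorem pt_mem_erase {i j : ℕ} {w x : Fin n} {s : Finset (Vtx r n)} (hi : i ≤ 2 * r)
    (hj : j ≤ 2 * r) : pt r i w ∈ s.erase (pt r j x) ↔ ¬(i = j ∧ w = x) ∧ pt r i w ∈ s := by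
  rw [mem_erase, ne_eq, pt_inj hi hj]

theorem pt_lt_pt {i j : ℕ} {w x : Fin n} (hi : i ≤ 2 * r) (hj : j ≤ 2 * r) :
    pt r i w < pt r j x ↔ i < j ∨ i = j ∧ w < x := by
  simp only [pt, Prod.Lex.toLex_lt_toLex, Fin.lt_def, Fin.ext_iff, Fin.val_ofNat]
  rw [Nat.mod_eq_of_lt (by omega), Nat.mod_eq_of_lt (by omega)]

/-- The set of colours at the `j`-th vertex. -/
def sec (s : Finset (Vtx r n)) (j : ℕ) : Finset (Fin n) := univ.filter fun w => pt r j w ∈ s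

@[simp] theorem mem_sec {s : Finset (Vtx r n)} {j : ℕ} {w : Fin n} :
    w ∈ sec s j ↔ pt r j w ∈ s := by simp [sec]

theorem sum_eq_sum_sec {M : Type} [AddCommMonoid M] (s : Finset (Vtx r n)) (f : Vtx r n → M) :
    ∑ x ∈ s, f x = ∑ j ∈ range (2 * r + 1), ∑ w ∈ sec s j, f (pt r j w) := by
  rw [sum_sigma']
  refine (sum_bij (fun p _ => pt r p.1 p.2) ?_ ?_ ?_ ?_).symm
  · rintro ⟨j, w⟩ h; simpa using (mem_sigma.1 h).2
  · rintro ⟨j, w⟩ h ⟨j', w'⟩ h' e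
    have h1 : j < 2 * r + 1 := mem_range.1 (mem_sigma.1 h).1
    have h2 : j' < 2 * r + 1 := mem_range.1 (mem_sigma.1 h').1
    obtain ⟨rfl, rfl⟩ := (pt_inj (Nat.le_of_lt_succ h1) (Nat.le_of_lt_succ h2)).1 e
    rfl
  · intro x hx
    obtain ⟨j, hj, w, rfl⟩ := exists_pt x
    exact ⟨⟨j, w⟩, by simp; exact ⟨by omega, hx⟩, rfl⟩
  · intros; rfl

theorem card_eq_sum_sec (s : Finset (Vtx r n)) :
    s.card = ∑ j ∈ range (2 * r + 1), (sec s j).card := by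
  rw [card_eq_sum_ones, sum_eq_sum_sec]; simp

theorem AcyclicAt.of_sec {P : Set (Finset (Vtx r n))} (hP : P.OrdConnected) {i : ℕ} (j : ℕ)
    (h : ∀ U : Finset (Fin n), AcyclicAt R (P ∩ {s | sec s j = U}) i) : AcyclicAt R P i :=
  AcyclicAt.of_fibers hP (fun s => sec s j) (fun s t h w => by simpa using @h _) h

/-- A family is acyclic if, for given colours at the vertices other than `j`, it is closed under
adding and removing one fixed colour at `j`. -/
theorem acyclicAt_of_toggle {P : Set (Finset (Vtx r n))} (hP : P.OrdConnected) (j : ℕ)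
    (hj : j ≤ 2 * r)
    (h : ∀ s ∈ P, ∃ w, ∀ t ∈ P, (∀ i ≤ 2 * r, i ≠ j → ∀ x, pt r i x ∈ t ↔ pt r i x ∈ s) →
      insert (pt r j w) t ∈ P ∧ t.erase (pt r j w) ∈ P) (i : ℕ) : AcyclicAt R P i := by
  -- The fibres are taken over the part of the set away from the vertex `j`. On each fibre the
  -- toggled colour is fixed, so `acyclicAt_of_cone` applies.
  have hκ : ∀ s t : Finset (Vtx r n), s.filter (fun x => ∀ w, x ≠ pt r j w) =
      t.filter (fun x => ∀ w, x ≠ pt r j w) ↔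
      ∀ i ≤ 2 * r, i ≠ j → ∀ x, pt r i x ∈ s ↔ pt r i x ∈ t := by
    intro s t
    rw [Finset.ext_iff]
    constructor
    · intro h i hi hij x
      have := h (pt r i x)
      simpa [pt_inj hi hj, hij] using this
    · intro h x
      obtain ⟨i, hi, w, rfl⟩ := exists_pt x
      by_cases hij : i = j
      · subst hij; simp
      · simp [pt_inj hi hj, hij, h i hi hij]
  refine AcyclicAt.of_fibers hP (fun s => s.filter fun x => ∀ w, x ≠ pt r j w)
    (fun s t h => filter_subset_filter _ h) fun a => ?_
  by_cases hne : ∃ s ∈ P, s.filter (fun x => ∀ w, x ≠ pt r j w) = a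
  · obtain ⟨s, hs, rfl⟩ := hne
    obtain ⟨w, hw⟩ := h s hs
    refine acyclicAt_of_cone (pt r j w) (fun t ht => ?_) i
    have h2 := (hκ t s).1 ht.2
    obtain ⟨h3, h4⟩ := hw t ht.1 h2
    refine ⟨⟨h3, (hκ _ s).2 fun i hi hij x => ?_⟩, ⟨h4, (hκ _ s).2 fun i hi hij x => ?_⟩⟩
    · rw [pt_mem_insert hi hj, ← h2 i hi hij x]; simp [hij]
    · rw [pt_mem_erase hi hj, ← h2 i hi hij x]; simp [hij]
  · exact acyclicAt_of_card fun s hs => absurd ⟨s, hs⟩ hne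

theorem IsUpperSet.of_mem {x : Vtx r n} : IsUpperSet {s : Finset (Vtx r n) | x ∈ s} :=
  fun _ _ h hs => h hs

variable (r n)

/-- Families of pairs which satisfy the disjointness conditions of the cycle, and which are nonempty
at all vertices except possibly the vertex `0`. -/
def cone : Set (Finset (Vtx r n)) :=
  {s | (∀ j, 1 ≤ j → j ≤ 2 * r → ∃ w, pt r j w ∈ s) ∧
    (∀ j, 1 ≤ j → j < 2 * r → ∀ w, pt r j w ∈ s → pt r (j + 1) w ∉ s) ∧
    ∀ w, pt r 0 w ∈ s → pt r 1 w ∉ s ∧ pt r (2 * r) w ∉ s}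

variable {r n}

theorem cone_ordConnected : (cone r n).OrdConnected :=
  ⟨fun _ hs _ hu _ ht => ⟨fun j h1 h2 => (hs.1 j h1 h2).imp fun _ h => ht.1 h,
    fun j h1 h2 w h3 h4 => hu.2.1 j h1 h2 w (ht.2 h3) (ht.2 h4),
    fun w h => ⟨fun h1 => (hu.2.2 w (ht.2 h)).1 (ht.2 h1),
      fun h1 => (hu.2.2 w (ht.2 h)).2 (ht.2 h1)⟩⟩⟩

/-- Adjacency in the cycle. -/
def nb (r i j : ℕ) : Prop := i + 1 = j ∨ j + 1 = i ∨ i = 0 ∧ j = 2 * r ∨ i = 2 * r ∧ j = 0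

theorem insert_mem_cone {s : Finset (Vtx r n)} (hs : s ∈ cone r n) {j : ℕ} {w : Fin n}
    (hr : 1 ≤ r) (hj : j ≤ 2 * r) (h : ∀ i ≤ 2 * r, nb r i j → pt r i w ∉ s) :
    insert (pt r j w) s ∈ cone r n := by
  obtain ⟨h1, h2, h3⟩ := hs
  refine ⟨fun i hi hi' => (h1 i hi hi').imp fun _ h => mem_insert_of_mem h, fun i hi hi' x => ?_,
    fun x => ?_⟩
  · rw [pt_mem_insert (by omega) hj, pt_mem_insert (by omega) hj]
    have h4 := h i (by omega)
    have h5 := h (i + 1) (by omega)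
    have h6 := h2 i hi hi' x
    unfold nb at h4 h5
    rintro (⟨rfl, rfl⟩ | h7) (⟨h8, h9⟩ | h8)
    · omega
    · exact h5 (by omega) h8
    · rw [← h9] at h4; exact h4 (by omega) h7
    · exact h6 h7 h8
  · rw [pt_mem_insert (by omega) hj, pt_mem_insert (by omega) hj, pt_mem_insert (by omega) hj]
    have h4 := h 0 (by omega)
    have h5 := h 1 (by omega)
    have h6 := h (2 * r) (by omega)
    unfold nb at h4 h5 h6
    have h7 := h3 x
    rintro (⟨rfl, rfl⟩ | h8)
    · exact ⟨by rintro (⟨h9, -⟩ | h9); · omega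
                · exact h5 (by omega) h9, by
             rintro (⟨h9, -⟩ | h9)
             · omega
             · exact h6 (by omega) h9⟩
    · exact ⟨by rintro (⟨h9, rfl⟩ | h9); · exact h4 (by omega) h8
                · exact (h7 h8).1 h9, by
             rintro (⟨h9, rfl⟩ | h9)
             · exact h4 (by omega) h8
             · exact (h7 h8).2 h9⟩

theorem erase_mem_cone {s : Finset (Vtx r n)} (hs : s ∈ cone r n) {j : ℕ} {w : Fin n}
    (hj : j ≤ 2 * r) (h : j = 0 ∨ ∃ x, x ≠ w ∧ pt r j x ∈ s) :
    s.erase (pt r j w) ∈ cone r n := by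
  obtain ⟨h1, h2, h3⟩ := hs
  refine ⟨fun i hi hi' => ?_, fun i hi hi' x h4 h5 => h2 i hi hi' x (mem_of_mem_erase h4)
    (mem_of_mem_erase h5), fun x h4 => ⟨fun h5 => (h3 x (mem_of_mem_erase h4)).1
    (mem_of_mem_erase h5), fun h5 => (h3 x (mem_of_mem_erase h4)).2 (mem_of_mem_erase h5)⟩⟩
  by_cases hij : i = j
  · subst hij
    obtain rfl | ⟨x, hx, hxs⟩ := h
    · omega
    · exact ⟨x, (pt_mem_erase hi' hj).2 ⟨fun h => hx h.2, hxs⟩⟩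
  · obtain ⟨x, hx⟩ := h1 i hi hi'
    exact ⟨x, (pt_mem_erase hi' hj).2 ⟨fun h => hij h.1, hx⟩⟩

theorem notMem_of_nb {s : Finset (Vtx r n)} (hs : s ∈ cone r n) {i j : ℕ} (hi : i ≤ 2 * r)
    (hj : j ≤ 2 * r) (h : nb r i j) {w : Fin n} (hw : pt r i w ∈ s) : pt r j w ∉ s := by
  obtain ⟨h1, h2, h3⟩ := hs
  intro hw'
  rcases h with h | h | ⟨rfl, rfl⟩ | ⟨rfl, rfl⟩
  · subst h
    by_cases h0 : i = 0
    · subst h0; exact (h3 w hw).1 hw'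
    · exact h2 i (by omega) (by omega) w hw hw'
  · subst h
    by_cases h0 : j = 0
    · subst h0; exact (h3 w hw').1 hw
    · exact h2 j (by omega) (by omega) w hw' hw
  · exact (h3 w hw).2 hw'
  · exact (h3 w hw').2 hw

variable (r n)

/-- The union of the colours at the neighbours of the vertex `0` is everything. -/
def full : Set (Finset (Vtx r n)) := {s | ∀ w, pt r 1 w ∈ s ∨ pt r (2 * r) w ∈ s}

variable {r n}

theorem full_isUpperSet : IsUpperSet (full r n) :=
  fun _ _ h hs w => (hs w).imp (fun h' => h h') fun h' => h h'

/-- A part of the cone on which the vertex `0` can be coloured is acyclic. -/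
theorem acyclicAt_cone_inter_compl_full (hr : 1 ≤ r) (i : ℕ) :
    AcyclicAt R (cone r n ∩ (full r n)ᶜ) i := by
  refine acyclicAt_of_toggle (cone_ordConnected.inter full_isUpperSet.compl.ordConnected) 0
    (by omega) (fun s hs => ?_) i
  -- A colour absent from both neighbours of `0` is free at `0`, and `0` is allowed to become empty.
  obtain ⟨w, hw⟩ := not_forall.1 hs.2
  push Not at hw
  refine ⟨w, fun t ht hts => ?_⟩
  have h1 : pt r 1 w ∉ t := by rw [hts 1 (by omega) (by omega)]; exact hw.1
  have h2 : pt r (2 * r) w ∉ t := by rw [hts (2 * r) (by omega) (by omega)]; exact hw.2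
  refine ⟨⟨insert_mem_cone ht.1 hr (by omega) fun i hi h => ?_, fun h => ?_⟩,
    ⟨erase_mem_cone ht.1 (by omega) (Or.inl rfl), fun h => ?_⟩⟩
  · rcases h with h | h | h | h
    · omega
    · rwa [← h]
    · omega
    · rwa [h.1]
  · rcases h w with h | h
    · exact h1 (by simpa [pt_mem_insert (show 1 ≤ 2 * r by omega) (show 0 ≤ 2 * r by omega)] using h)
    · refine h2 ?_
      rw [pt_mem_insert (by omega) (by omega)] at h
      exact h.resolve_left fun h => by omega
  · rcases h w with h | h
    · exact h1 (mem_of_mem_erase h)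
    · exact h2 (mem_of_mem_erase h)

/-- Cells which are nonempty at the vertices `1, …, 2 r` have at least that many elements. -/
theorem card_ge {s : Finset (Vtx r n)} (hs : s ∈ cone r n) (J : Finset ℕ) (hJ : J ⊆ Icc 1 (2 * r)) :
    ∑ j ∈ J, (sec s j).card + (2 * r - J.card) ≤ s.card := by
  rw [card_eq_sum_sec, range_eq_Ico, sum_eq_sum_Ico_succ_bot (by omega)]
  have h1 : Ico (0 + 1) (2 * r + 1) = J ∪ (Icc 1 (2 * r) \ J) := by
    rw [union_sdiff_of_subset hJ]; ext; simp
  rw [h1, sum_union disjoint_sdiff]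
  have h2 : (Icc 1 (2 * r) \ J).card = 2 * r - J.card := by
    rw [card_sdiff_of_subset hJ]; simp
  have h3 : (Icc 1 (2 * r) \ J).card ≤ ∑ j ∈ Icc 1 (2 * r) \ J, (sec s j).card := by
    rw [card_eq_sum_ones]
    refine sum_le_sum fun j hj => ?_
    simp only [mem_sdiff, mem_Icc] at hj
    obtain ⟨w, hw⟩ := hs.1 j hj.1.1 hj.1.2
    exact card_pos.2 ⟨w, by simpa using hw⟩
  omega

/-- This and the next two bounds serve to exclude low degrees: where no toggle is available, several
colour sets together nearly exhaust all colours, and `card_ge` makes the member large. -/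
theorem le_card_add_card {s : Finset (Vtx r n)} {i j : ℕ} (h : ∀ w, pt r i w ∈ s ∨ pt r j w ∈ s) :
    n ≤ (sec s i).card + (sec s j).card := by
  have : sec s i ∪ sec s j = univ := by ext w; simpa using h w
  have h2 := card_union_le (sec s i) (sec s j)
  rw [this] at h2
  simpa using h2

theorem le_card_add_card' {s : Finset (Vtx r n)} {i j : ℕ} {x : Fin n}
    (h : ∀ w, w ≠ x → pt r i w ∈ s ∨ pt r j w ∈ s) :
    n - 1 ≤ (sec s i).card + (sec s j).card := by
  have : univ.erase x ⊆ sec s i ∪ sec s j := fun w hw => by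
    simpa using h w (ne_of_mem_erase hw)
  have h2 := card_union_le (sec s i) (sec s j)
  have h3 := card_le_card this
  rw [card_erase_of_mem (mem_univ _)] at h3
  simp at h3
  omega

theorem le_card_sec {s : Finset (Vtx r n)} {j : ℕ} {x : Fin n}
    (h : ∀ w, w ≠ x → pt r j w ∈ s) : n - 1 ≤ (sec s j).card := by
  have : univ.erase x ⊆ sec s j := fun w hw => by
    simpa using h w (ne_of_mem_erase hw)
  have h3 := card_le_card this
  rw [card_erase_of_mem (mem_univ _)] at h3
  simpa using h3

end

/-! ### The full part with a nonzero largest colour at the last vertex is acyclic in low degrees. -/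

section

variable {R : Type} [CommRing R]
variable {r n : ℕ} [NeZero n]

theorem cone_inter_full_ordConnected : (cone r n ∩ full r n).OrdConnected :=
  cone_ordConnected.inter full_isUpperSet.ordConnected

/-- No element of the family has a colour at the vertex `0`. -/
theorem pt_zero_notMem {s : Finset (Vtx r n)} (hs : s ∈ cone r n) (hf : s ∈ full r n) (w : Fin n) :
    pt r 0 w ∉ s := by
  intro h
  rcases hf w with h1 | h1
  · exact (hs.2.2 w h).1 h1
  · exact (hs.2.2 w h).2 h1

/-- The family of cells whose largest colour at the last vertex is `x`. -/
def maxFamily (r : ℕ) (x : Fin n) : Set (Finset (Vtx r n)) :=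
  (cone r n ∩ full r n) ∩ {s | pt r (2 * r) x ∈ s ∧ ∀ w, x < w → pt r (2 * r) w ∉ s}

theorem maxFamily_ordConnected (x : Fin n) : (maxFamily r x).OrdConnected :=
  cone_inter_full_ordConnected.inter
    ⟨fun _ hs _ hu _ ht => ⟨ht.1 hs.1, fun w hw h => hu.2 w hw (ht.2 h)⟩⟩

theorem insert_mem_maxFamily {x : Fin n} {s : Finset (Vtx r n)} (hs : s ∈ maxFamily r x) {j : ℕ}
    {w : Fin n} (hr : 2 ≤ r) (hj0 : 1 ≤ j) (hj : j ≤ 2 * r)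
    (h1 : ∀ i ≤ 2 * r, 1 ≤ i → nb r i j → pt r i w ∉ s)
    (h2 : j = 2 * r → w ≤ x) : insert (pt r j w) s ∈ maxFamily r x := by
  refine ⟨⟨insert_mem_cone hs.1.1 (by omega) hj fun i hi h => ?_,
    full_isUpperSet (subset_insert _ _) hs.1.2⟩, mem_insert_of_mem hs.2.1, fun y hy => ?_⟩
  · by_cases h0 : i = 0
    · subst h0; exact pt_zero_notMem hs.1.1 hs.1.2 w
    · exact h1 i hi (by omega) h
  · rw [pt_mem_insert (by omega) hj]
    rintro (⟨rfl, rfl⟩ | h)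
    · exact absurd (h2 rfl) (not_le.2 hy)
    · exact hs.2.2 y hy h

theorem erase_mem_maxFamily {x : Fin n} {s : Finset (Vtx r n)} (hs : s ∈ maxFamily r x) {j : ℕ}
    {w : Fin n} (hr : 2 ≤ r) (hj : j ≤ 2 * r) (h : ∃ x, x ≠ w ∧ pt r j x ∈ s)
    (h1 : j = 1 → pt r (2 * r) w ∈ s) (h2 : j = 2 * r → w ≠ x ∧ pt r 1 w ∈ s) :
    s.erase (pt r j w) ∈ maxFamily r x := by
  refine ⟨⟨erase_mem_cone hs.1.1 hj (Or.inr h), fun y => ?_⟩,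
    ?_, fun y hy h => hs.2.2 y hy (mem_of_mem_erase h)⟩
  · simp (disch := omega) only [pt_mem_erase]
    rcases eq_or_ne y w with rfl | hy
    · by_cases hj1 : j = 1
      · right; exact ⟨by omega, h1 hj1⟩
      · by_cases hj2 : j = 2 * r
        · left; exact ⟨by omega, (h2 hj2).2⟩
        · exact (hs.1.2 y).imp (fun h => ⟨by omega, h⟩) fun h => ⟨by omega, h⟩
    · exact (hs.1.2 y).imp (fun h => ⟨fun h => hy h.2, h⟩) fun h => ⟨fun h => hy h.2, h⟩
  · simp (disch := omega) only [pt_mem_erase]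
    exact ⟨fun h => (h2 h.1.symm).1 h.2.symm, hs.2.1⟩

theorem exists_ne_pt_one {x : Fin n} {s : Finset (Vtx r n)} (hs : s ∈ maxFamily r x)
    (hr : 2 ≤ r) : ∃ y, y ≠ x ∧ pt r 1 y ∈ s := by
  obtain ⟨y, hy⟩ := hs.1.1.1 (2 * r - 1) (by omega) (by omega)
  have h1 := notMem_of_nb hs.1.1 (by omega) le_rfl (Or.inl (by omega) : nb r (2 * r - 1) (2 * r)) hy
  refine ⟨y, ?_, (hs.1.2 y).resolve_right h1⟩
  rintro rfl
  exact h1 hs.2.1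

/-- Five cuts, each with a toggle that keeps all earlier conditions. If `x` is missing at `2`,
toggle `x` at `1`. If some `w ≠ x` is missing at `1` and `3`, toggle it at `2`, where `x` remains.
If `1` misses a colour other than `x`, work at `3`. Otherwise `1` has all colours but possibly `x`,
so fullness no longer restricts nonzero-maximum changes at `2r` by `0`: toggle `0` there if it is
missing at `2r - 1`, else toggle at `2r - 1`. What resists has at least `2n + 2r - 5` elements,
which is the bound on `i`. -/
theorem acyclicAt_maxFamily (hr : 2 ≤ r) {x : Fin n} (hx : x ≠ 0) {i : ℕ}
    (hi : i + 5 < 2 * n + 2 * r) : AcyclicAt R (maxFamily r x) i := by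
  have hx0 : 0 ≤ x := Fin.zero_le _
  refine AcyclicAt.split (Q := {s | pt r 2 x ∈ s}) (maxFamily_ordConnected x)
    IsUpperSet.of_mem ?_ ?_
  swap
  · -- the colour `x` can be added at the vertex `1`
    refine acyclicAt_of_toggle ((maxFamily_ordConnected x).inter
      IsUpperSet.of_mem.compl.ordConnected) 1 (by omega) (fun s hs => ⟨x, fun t ht _ => ⟨⟨?_, ?_⟩,
        ⟨?_, fun h => ht.2 (mem_of_mem_erase h)⟩⟩⟩) i
    · refine insert_mem_maxFamily ht.1 hr le_rfl (by omega) (fun i hi hi' h => ?_) (by omega)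
      obtain rfl : i = 2 := by unfold nb at h; omega
      exact ht.2
    · intro h
      refine ht.2 ?_
      simp only [Set.mem_ofPred_eq, pt_mem_insert (show 2 ≤ 2 * r by omega) (show 1 ≤ 2 * r by omega)] at h ⊢
      exact h.resolve_left (by omega)
    · exact erase_mem_maxFamily ht.1 hr (by omega) (exists_ne_pt_one ht.1 hr) (fun _ => ht.1.2.1)
        (by omega)
  have c1 : (maxFamily r x ∩ {s | pt r 2 x ∈ s}).OrdConnected :=
    (maxFamily_ordConnected x).inter IsUpperSet.of_mem.ordConnected
  have u1 : IsUpperSet {s : Finset (Vtx r n) | ∀ w, w ≠ x → pt r 1 w ∈ s ∨ pt r 3 w ∈ s} :=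
    fun _ _ h hs w hw => (hs w hw).imp (fun h' => h h') fun h' => h h'
  refine AcyclicAt.split c1 u1 ?_ ?_
  swap
  · -- some colour can be added at the vertex `2`
    refine acyclicAt_of_toggle (c1.inter u1.compl.ordConnected) 2 (by omega) (fun s hs => ?_) i
    obtain ⟨w, hw⟩ := not_forall.1 hs.2
    push Not at hw
    obtain ⟨hwx, hw1, hw3⟩ := hw
    refine ⟨w, fun t ht hts => ?_⟩
    rw [← hts 1 (by omega) (by omega)] at hw1
    rw [← hts 3 (by omega) (by omega)] at hw3
    refine ⟨⟨⟨?_, mem_insert_of_mem ht.1.2⟩, fun h => ?_⟩, ⟨⟨?_, ?_⟩, fun h => ?_⟩⟩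
    · refine insert_mem_maxFamily ht.1.1 hr (by omega) (by omega) (fun i hi hi' h => ?_) (by omega)
      obtain rfl | rfl : i = 1 ∨ i = 3 := by unfold nb at h; omega
      · exact hw1
      · exact hw3
    · have := h w hwx
      simp (disch := omega) only [pt_mem_insert] at this
      grind
    · exact erase_mem_maxFamily ht.1.1 hr (by omega) ⟨x, hwx.symm, ht.1.2⟩ (by omega) (by omega)
    · exact (pt_mem_erase (by omega) (by omega)).2 ⟨fun h => hwx h.2.symm, ht.1.2⟩
    · have := h w hwx
      exact this.elim (fun h => hw1 (mem_of_mem_erase h)) fun h => hw3 (mem_of_mem_erase h)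
  have c2 := c1.inter u1.ordConnected
  have u2 : IsUpperSet {s : Finset (Vtx r n) | ∀ w, w ≠ x → pt r 1 w ∈ s} :=
    fun _ _ h hs w hw => h (hs w hw)
  refine AcyclicAt.split c2 u2 ?_ ?_
  swap
  · -- the vertex `1` misses a colour other than `x`
    -- The colours at `1` are frozen because "every colour at `1` occurs at `4`" is an upper
    -- condition only for a fixed colour set at `1`.
    refine AcyclicAt.of_sec (c2.inter u2.compl.ordConnected) 1 fun U => ?_
    have c3 := (c2.inter u2.compl.ordConnected).inter
      (⟨fun _ hs _ hu _ ht => subset_antisymm (fun w hw => hu ▸ (by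
        have := ht.2; rw [mem_sec] at hw ⊢; exact this hw)) (fun w hw => by
          have := ht.1; rw [← hs] at hw; rw [mem_sec] at hw ⊢; exact this hw)⟩ :
      {s : Finset (Vtx r n) | sec s 1 = U}.OrdConnected)
    have u3 : IsUpperSet {s : Finset (Vtx r n) | ∀ w ∈ U, pt r 4 w ∈ s} :=
      fun _ _ h hs w hw => h (hs w hw)
    refine AcyclicAt.split c3 u3 ?_ ?_
    · refine acyclicAt_of_card fun s hs => ?_
      obtain ⟨⟨⟨⟨⟨hm, h2⟩, h13⟩, hn⟩, hU⟩, h4⟩ := hs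
      have hU : sec s 1 = U := hU
      obtain ⟨w, hw⟩ := not_forall.1 hn
      obtain ⟨hwx, hw1⟩ := Classical.not_imp.1 hw
      have hw3 := (h13 w hwx).resolve_left hw1
      have hw4 := (hm.1.2 w).resolve_left hw1
      -- The missing colour lies at `3` and at `2r`, which are adjacent if `r = 2`. So `1`, `3`,
      -- `4`, `2r` are distinct. The colour sets at `1` and `2r` have together at least `n`
      -- elements, those at `3` and `4` at least `n - 1`, and every other vertex from `1` to `2r`
      -- adds at least one.
      have hr2 : r ≠ 2 := by
        rintro rfl
        exact notMem_of_nb hm.1.1 (by omega) (by omega) (Or.inl rfl : nb 2 3 4) hw3 hw4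
      have e1 := le_card_add_card hm.1.2
      have e2 := le_card_add_card' h13
      have e3 : (sec s 1).card ≤ (sec s 4).card := card_le_card fun w hw => by
        rw [mem_sec]; exact h4 w (hU ▸ hw)
      have e4 := card_ge hm.1.1 {1, 3, 4, 2 * r} (by
        intro j hj; simp only [mem_insert, mem_singleton] at hj; rw [mem_Icc]; omega)
      rw [sum_insert (by simp; omega), sum_insert (by simp; omega), sum_insert (by simp; omega),
        sum_singleton, card_insert_of_notMem (by simp; omega),
        card_insert_of_notMem (by simp; omega), card_insert_of_notMem (by simp; omega),
        card_singleton] at e4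
      omega
    · refine acyclicAt_of_toggle (c3.inter u3.compl.ordConnected) 3 (by omega) (fun s hs => ?_) i
      obtain ⟨w, hw⟩ := not_forall.1 hs.2
      obtain ⟨hwU, hw4⟩ := Classical.not_imp.1 hw
      refine ⟨w, fun t ht hts => ?_⟩
      rw [← hts 4 (by omega) (by omega)] at hw4
      obtain ⟨⟨⟨⟨⟨hm, h2⟩, h13⟩, hn⟩, hU⟩, -⟩ := ht
      have hU : sec t 1 = U := hU
      have hw1 : pt r 1 w ∈ t := by rw [← mem_sec, hU]; exact hwU
      -- The colour `w` is toggled at `3`. It is absent at `2` because it is present at `1`, and its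
      -- presence at `1` also keeps the covering condition on `1` and `3`.
      have hw2 : pt r 2 w ∉ t :=
        notMem_of_nb hm.1.1 (by omega) (by omega) (Or.inl rfl : nb r 1 2) hw1
      obtain ⟨y, hy⟩ := not_forall.1 hn
      obtain ⟨hyx, hy1⟩ := Classical.not_imp.1 hy
      have hy3 := (h13 y hyx).resolve_left hy1
      refine ⟨⟨⟨⟨⟨⟨?_, mem_insert_of_mem h2⟩, u1 (subset_insert _ _) h13⟩, fun h => ?_⟩, ?_⟩,
        fun h => ?_⟩, ⟨⟨⟨⟨⟨?_, ?_⟩, fun z hz => ?_⟩, fun h => ?_⟩, ?_⟩, fun h => ?_⟩⟩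
      · refine insert_mem_maxFamily hm hr (by omega) (by omega) (fun i hi hi' h => ?_) (by omega)
        obtain rfl | rfl : i = 2 ∨ i = 4 := by unfold nb at h; omega
        · exact hw2
        · exact hw4
      · have := h y hyx
        simp (disch := omega) only [pt_mem_insert] at this
        exact this.elim (by omega) hy1
      · change sec _ 1 = U
        rw [← hU]
        ext z
        simp (disch := omega) only [mem_sec, pt_mem_insert]
        simp
      · have := h w hwU
        simp (disch := omega) only [pt_mem_insert] at this
        exact this.elim (by omega) hw4
      · exact erase_mem_maxFamily hm hr (by omega) ⟨y, by rintro rfl; exact hy1 hw1, hy3⟩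
          (by omega) (by omega)
      · exact (pt_mem_erase (by omega) (by omega)).2 ⟨by omega, h2⟩
      · simp (disch := omega) only [pt_mem_erase]
        by_cases hzw : z = w
        · subst hzw; exact Or.inl ⟨by omega, hw1⟩
        · exact (h13 z hz).imp (fun h => ⟨fun h => hzw h.2, h⟩) fun h => ⟨fun h => hzw h.2, h⟩
      · exact hy1 (mem_of_mem_erase (h y hyx))
      · change sec _ 1 = U
        rw [← hU]
        ext z
        simp (disch := omega) only [mem_sec, pt_mem_erase]
        simp
      · exact hw4 (mem_of_mem_erase (h w hwU))
  have c3 := c2.inter u2.ordConnected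
  refine AcyclicAt.split (Q := {s | pt r (2 * r - 1) 0 ∈ s}) c3 IsUpperSet.of_mem ?_ ?_
  swap
  · -- the colour `0` can be added at the last vertex
    refine acyclicAt_of_toggle (c3.inter IsUpperSet.of_mem.compl.ordConnected) (2 * r) (by omega)
      (fun s hs => ⟨0, fun t ht _ => ?_⟩) i
    obtain ⟨⟨⟨⟨hm, h2⟩, h13⟩, h1⟩, h0⟩ := ht
    refine ⟨⟨⟨⟨⟨?_, mem_insert_of_mem h2⟩, u1 (subset_insert _ _) h13⟩,
      u2 (subset_insert _ _) h1⟩, fun h => ?_⟩, ⟨⟨⟨⟨?_, ?_⟩, fun z hz => Or.inl ?_⟩, fun z hz => ?_⟩,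
      fun h => h0 (mem_of_mem_erase h)⟩⟩
    · refine insert_mem_maxFamily hm hr (by omega) (by omega) (fun i hi hi' h => ?_) fun _ => hx0
      obtain rfl : i = 2 * r - 1 := by unfold nb at h; omega
      exact h0
    · rw [Set.mem_ofPred_eq, pt_mem_insert (by omega) (by omega)] at h
      exact h.elim (by omega) h0
    · exact erase_mem_maxFamily hm hr (by omega) ⟨x, hx, hm.2.1⟩ (by omega)
        fun _ => ⟨hx.symm, h1 0 hx.symm⟩
    · exact (pt_mem_erase (by omega) (by omega)).2 ⟨by omega, h2⟩
    · exact (pt_mem_erase (by omega) (by omega)).2 ⟨by omega, h1 z hz⟩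
    · exact (pt_mem_erase (by omega) (by omega)).2 ⟨by omega, h1 z hz⟩
  have c4 := c3.inter (IsUpperSet.of_mem (x := pt r (2 * r - 1) (0 : Fin n))).ordConnected
  have u4 : IsUpperSet {s : Finset (Vtx r n) |
      ∀ w, w ≠ 0 → pt r (2 * r) w ∈ s ∨ pt r (2 * r - 2) w ∈ s} :=
    fun _ _ h hs w hw => (hs w hw).imp (fun h' => h h') fun h' => h h'
  refine AcyclicAt.split c4 u4 ?_ ?_
  -- Here the vertex `1` has at least `n - 1` colours, and the vertices `2r - 2` and `2r` together
  -- at least `n - 1`.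
  · refine acyclicAt_of_card fun s hs => ?_
    obtain ⟨⟨⟨⟨⟨hm, h2⟩, h13⟩, h1⟩, h0⟩, h4⟩ := hs
    have e1 := le_card_sec h1
    have e2 := le_card_add_card' h4
    have e4 := card_ge hm.1.1 {1, 2 * r - 2, 2 * r} (by
      intro j hj; simp only [mem_insert, mem_singleton] at hj; rw [mem_Icc]; omega)
    rw [sum_insert (by simp; omega), sum_insert (by simp; omega),
      sum_singleton, card_insert_of_notMem (by simp; omega),
      card_insert_of_notMem (by simp; omega), card_singleton] at e4
    omega
  · -- some colour can be added at the next to last vertex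
    refine acyclicAt_of_toggle (c4.inter u4.compl.ordConnected) (2 * r - 1) (by omega)
      (fun s hs => ?_) i
    obtain ⟨w, hw⟩ := not_forall.1 hs.2
    push Not at hw
    obtain ⟨hw0, hwk, hwk2⟩ := hw
    refine ⟨w, fun t ht hts => ?_⟩
    rw [← hts _ (by omega) (by omega)] at hwk
    rw [← hts _ (by omega) (by omega)] at hwk2
    obtain ⟨⟨⟨⟨⟨hm, h2⟩, h13⟩, h1⟩, h0⟩, h4⟩ := ht
    refine ⟨⟨⟨⟨⟨⟨?_, mem_insert_of_mem h2⟩, u1 (subset_insert _ _) h13⟩,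
      u2 (subset_insert _ _) h1⟩, mem_insert_of_mem h0⟩, fun h => ?_⟩,
      ⟨⟨⟨⟨⟨?_, ?_⟩, fun z hz => Or.inl ?_⟩, fun z hz => ?_⟩, ?_⟩, fun h => ?_⟩⟩
    · refine insert_mem_maxFamily hm hr (by omega) (by omega) (fun i hi hi' h => ?_) (by omega)
      obtain rfl | rfl : i = 2 * r ∨ i = 2 * r - 2 := by unfold nb at h; omega
      · exact hwk
      · exact hwk2
    · have := h w hw0
      simp (disch := omega) only [pt_mem_insert] at this
      rcases this with (h | h) | (h | h)
      · omega
      · exact hwk h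
      · omega
      · exact hwk2 h
    · exact erase_mem_maxFamily hm hr (by omega) ⟨0, hw0.symm, h0⟩ (by omega) (by omega)
    · exact (pt_mem_erase (by omega) (by omega)).2 ⟨by omega, h2⟩
    · exact (pt_mem_erase (by omega) (by omega)).2 ⟨by omega, h1 z hz⟩
    · exact (pt_mem_erase (by omega) (by omega)).2 ⟨by omega, h1 z hz⟩
    · exact (pt_mem_erase (by omega) (by omega)).2 ⟨fun h => hw0 h.2.symm, h0⟩
    · exact (h w hw0).elim (fun h => hwk (mem_of_mem_erase h)) fun h => hwk2 (mem_of_mem_erase h)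

end

/-! ### Collapsing the rest of the full part to one cell. -/

section

variable {R : Type} [CommRing R]
variable {r n : ℕ} [NeZero n]

theorem acyclicAt_exists_ne_zero (hr : 2 ≤ r) {i : ℕ} (hi : i + 5 < 2 * n + 2 * r) :
    AcyclicAt R ((cone r n ∩ full r n) ∩ {s | ∃ w, w ≠ 0 ∧ pt r (2 * r) w ∈ s}) i := by
  have hQ : IsUpperSet {s : Finset (Vtx r n) | ∃ w, w ≠ 0 ∧ pt r (2 * r) w ∈ s} :=
    fun _ _ h hs => hs.imp fun w hw => ⟨hw.1, h hw.2⟩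
  refine AcyclicAt.of_fibers (cone_inter_full_ordConnected.inter hQ.ordConnected)
    -- The largest colour is recorded by the down-set it generates, which makes the map to finite
    -- sets monotone.
    (fun s => univ.filter fun y => ∃ w, y ≤ w ∧ pt r (2 * r) w ∈ s)
    (fun s t h y => by simpa using fun w h1 h2 => ⟨w, h1, h h2⟩) fun a => ?_
  by_cases hne : ∃ s, s ∈ ((cone r n ∩ full r n) ∩ {s | ∃ w, w ≠ 0 ∧ pt r (2 * r) w ∈ s}) ∧
      (univ.filter fun y => ∃ w, y ≤ w ∧ pt r (2 * r) w ∈ s) = a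
  · obtain ⟨s, hs, rfl⟩ := hne
    obtain ⟨w0, hw0, hws⟩ := hs.2
    have hsec : (sec s (2 * r)).Nonempty := ⟨w0, by simpa using hws⟩
    have hmax : ∀ w, pt r (2 * r) w ∈ s → w ≤ (sec s (2 * r)).max' hsec :=
      fun w hw => le_max' _ _ (by simpa using hw)
    have hmem : pt r (2 * r) ((sec s (2 * r)).max' hsec) ∈ s := by
      simpa using max'_mem _ hsec
    have hx : (sec s (2 * r)).max' hsec ≠ 0 := by
      intro h
      have := hmax w0 hws
      rw [h] at this
      exact hw0 (le_antisymm this (Fin.zero_le _))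
    have hlower : ∀ t : Finset (Vtx r n), (univ.filter fun y => ∃ w, y ≤ w ∧ pt r (2 * r) w ∈ t) =
        (univ.filter fun y => ∃ w, y ≤ w ∧ pt r (2 * r) w ∈ s) ↔
        pt r (2 * r) ((sec s (2 * r)).max' hsec) ∈ t ∧
          ∀ w, (sec s (2 * r)).max' hsec < w → pt r (2 * r) w ∉ t := by
      intro t
      simp only [Finset.ext_iff, mem_filter, mem_univ, true_and]
      constructor
      · intro h
        have h1 : ∀ w, (sec s (2 * r)).max' hsec < w → pt r (2 * r) w ∉ t := by
          intro w hw hwt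
          obtain ⟨w', h2, h3⟩ := (h w).1 ⟨w, le_rfl, hwt⟩
          exact absurd (hmax w' h3) (not_le.2 (hw.trans_le h2))
        refine ⟨?_, h1⟩
        obtain ⟨w', h2, h3⟩ := (h _).2 ⟨_, le_rfl, hmem⟩
        rcases h2.lt_or_eq with h4 | h4
        · exact absurd h3 (h1 _ h4)
        · rwa [h4]
      · rintro ⟨h1, h2⟩ y
        constructor
        · rintro ⟨w, h3, h4⟩
          exact ⟨_, h3.trans (not_lt.1 fun h => h2 w h h4), hmem⟩
        · rintro ⟨w, h3, h4⟩
          exact ⟨_, h3.trans (hmax w h4), h1⟩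
    have := acyclicAt_maxFamily (R := R) hr hx hi
    convert this using 1
    ext t
    simp only [maxFamily, Set.mem_inter_iff, Set.mem_ofPred_eq, hlower]
    constructor
    · rintro ⟨⟨h1, -⟩, h2⟩; exact ⟨h1, h2⟩
    · rintro ⟨h1, h2⟩; exact ⟨⟨h1, _, hx, h2.1⟩, h2⟩
  · exact acyclicAt_of_card fun s hs => absurd ⟨s, hs⟩ hne

/-- The colours alternating between `0` at even vertices and `e` at odd vertices. -/
def col (e : Fin n) (j : ℕ) : Fin n := if Odd j then e else 0

theorem col_succ_ne {e : Fin n} (he : e ≠ 0) (j : ℕ) : col e (j + 1) ≠ col e j := by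
  unfold col
  by_cases h : Odd j
  · have : ¬ Odd (j + 1) := by rw [Nat.not_odd_iff_even]; exact h.add_one
    rw [if_pos h, if_neg this]; exact he.symm
  · have : Odd (j + 1) := (Nat.not_odd_iff_even.1 h).add_one
    rw [if_neg h, if_pos this]; exact he

/-- Cells which agree with the alternating colouring at the vertices `2, …, j` and have the colour
`0` at the last vertex. -/
def altFamily (r : ℕ) (e : Fin n) (j : ℕ) : Set (Finset (Vtx r n)) :=
  (cone r n ∩ full r n) ∩ {s | (∀ w, pt r (2 * r) w ∈ s → w = 0) ∧
    ∀ v, 2 ≤ v → v ≤ j → ∀ w, pt r v w ∈ s → w = col e v}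

theorem altFamily_ordConnected (e : Fin n) (j : ℕ) : (altFamily r e j).OrdConnected :=
  cone_inter_full_ordConnected.inter ⟨fun _ _ _ hu _ ht => ⟨fun w hw => hu.1 w (ht.2 hw),
    fun v h1 h2 w hw => hu.2 v h1 h2 w (ht.2 hw)⟩⟩

theorem insert_mem_altFamily {e : Fin n} {k : ℕ} {s : Finset (Vtx r n)}
    (hs : s ∈ altFamily r e k) {j : ℕ}
    {w : Fin n} (hr : 2 ≤ r) (hk : k < j) (hj : j < 2 * r)
    (h1 : ∀ i ≤ 2 * r, 1 ≤ i → nb r i j → pt r i w ∉ s) :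
    insert (pt r j w) s ∈ altFamily r e k := by
  refine ⟨⟨insert_mem_cone hs.1.1 (by omega) hj.le fun i hi h => ?_,
    full_isUpperSet (subset_insert _ _) hs.1.2⟩, fun y => ?_, fun v h2 h3 y => ?_⟩
  · by_cases h0 : i = 0
    · subst h0; exact pt_zero_notMem hs.1.1 hs.1.2 w
    · exact h1 i hi (by omega) h
  · rw [pt_mem_insert (by omega) hj.le]
    rintro (⟨h, -⟩ | h)
    · omega
    · exact hs.2.1 y h
  · rw [pt_mem_insert (by omega) hj.le]
    rintro (⟨h, -⟩ | h)
    · omega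
    · exact hs.2.2 v h2 h3 y h

theorem erase_mem_altFamily {e : Fin n} {k : ℕ} {s : Finset (Vtx r n)}
    (hs : s ∈ altFamily r e k) {j : ℕ}
    {w : Fin n} (hr : 2 ≤ r) (hj0 : 2 ≤ j) (hj : j < 2 * r) (h : ∃ x, x ≠ w ∧ pt r j x ∈ s) :
    s.erase (pt r j w) ∈ altFamily r e k := by
  refine ⟨⟨erase_mem_cone hs.1.1 hj.le (Or.inr h), fun y => ?_⟩,
    fun y h => hs.2.1 y (mem_of_mem_erase h), fun v h1 h2 y h => hs.2.2 v h1 h2 y (mem_of_mem_erase h)⟩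
  simp (disch := omega) only [pt_mem_erase]
  exact (hs.1.2 y).imp (fun h => ⟨by omega, h⟩) fun h => ⟨by omega, h⟩

theorem altFamily_pt_one {e : Fin n} {k : ℕ} {s : Finset (Vtx r n)}
    (hs : s ∈ altFamily r e k) {w : Fin n} (hw : w ≠ 0) : pt r 1 w ∈ s :=
  (hs.1.2 w).resolve_right fun h => hw (hs.2.1 w h)

/-- Let `c` be the prescribed colour at `j + 1`; it differs from the only colour at `j`. If `c` is
missing at `j + 2`, it can be toggled at `j + 1`, where another colour remains. Otherwise a colour
other than `c` missing at `j + 1` and `j + 3` can be toggled at `j + 2`. If there is none, these two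
vertices have together at least `n - 1` colours and the vertex `1` has another `n - 1`, so the
member is too large. -/
theorem acyclicAt_altFamily (hr : 2 ≤ r) {e : Fin n} (he : e ≠ 0) {j : ℕ} (hj : 2 ≤ j)
    (hj' : j + 1 < 2 * r) {i : ℕ} (hi : i + 5 < 2 * n + 2 * r) :
    AcyclicAt R (altFamily r e j ∩ {s | ∃ w, w ≠ col e (j + 1) ∧ pt r (j + 1) w ∈ s}) i := by
  have u0 : IsUpperSet {s : Finset (Vtx r n) | ∃ w, w ≠ col e (j + 1) ∧ pt r (j + 1) w ∈ s} :=
    fun _ _ h hs => hs.imp fun w hw => ⟨hw.1, h hw.2⟩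
  have c0 := (altFamily_ordConnected (r := r) e j).inter u0.ordConnected
  refine AcyclicAt.split (Q := {s | pt r (j + 2) (col e (j + 1)) ∈ s}) c0 IsUpperSet.of_mem ?_ ?_
  swap
  · refine acyclicAt_of_toggle (c0.inter IsUpperSet.of_mem.compl.ordConnected) (j + 1) (by omega)
      (fun s _ => ⟨col e (j + 1), fun t ht _ => ?_⟩) i
    obtain ⟨⟨hm, y, hy, hyt⟩, h2⟩ := ht
    refine ⟨⟨⟨?_, y, hy, mem_insert_of_mem hyt⟩, fun h => ?_⟩, ⟨⟨?_, y, hy, ?_⟩, fun h => ?_⟩⟩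
    · refine insert_mem_altFamily hm hr (by omega) (by omega)
        fun i hi hi' h => ?_
      obtain rfl | rfl : i = j ∨ i = j + 2 := by unfold nb at h; omega
      · exact fun h => col_succ_ne he i (hm.2.2 i hj le_rfl _ h)
      · exact h2
    · rw [Set.mem_ofPred_eq, pt_mem_insert (by omega) (by omega)] at h
      exact h.elim (by omega) h2
    · exact erase_mem_altFamily hm hr (by omega) (by omega) ⟨y, hy, hyt⟩
    · exact (pt_mem_erase (by omega) (by omega)).2 ⟨fun h => hy h.2, hyt⟩
    · exact h2 (mem_of_mem_erase h)
  have c1 := c0.inter (IsUpperSet.of_mem (x := pt r (j + 2) (col e (j + 1)))).ordConnected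
  have u1 : IsUpperSet {s : Finset (Vtx r n) |
      ∀ w, w ≠ col e (j + 1) → pt r (j + 1) w ∈ s ∨ pt r (j + 3) w ∈ s} :=
    fun _ _ h hs w hw => (hs w hw).imp (fun h' => h h') fun h' => h h'
  -- The last vertex carries only the colour `0`. If `j + 2 = 2r`, then `j + 1` is odd and its
  -- prescribed colour is `e ≠ 0`.
  have hlast : ∀ s ∈ altFamily r e j, pt r (j + 2) (col e (j + 1)) ∈ s → j + 2 < 2 * r := by
    intro s hs h
    by_contra hlt
    have hj2 : j + 2 = 2 * r := by omega
    rw [hj2] at h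
    have h1 := hs.2.1 _ h
    have : Odd (j + 1) := ⟨r - 1, by omega⟩
    rw [col, if_pos this] at h1
    exact he h1
  refine AcyclicAt.split c1 u1 ?_ ?_
  · refine acyclicAt_of_card fun s hs => ?_
    obtain ⟨⟨⟨hm, -⟩, h2⟩, h3⟩ := hs
    have hl := hlast s hm h2
    have e1 := le_card_sec (s := s) (x := 0) fun w hw => altFamily_pt_one hm hw
    have e2 := le_card_add_card' h3
    have e4 := card_ge hm.1.1 {1, j + 1, j + 3} (by
      intro j hj; simp only [mem_insert, mem_singleton] at hj; rw [mem_Icc]; omega)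
    rw [sum_insert (by simp; omega), sum_insert (by simp),
      sum_singleton, card_insert_of_notMem (by simp; omega),
      card_insert_of_notMem (by simp), card_singleton] at e4
    omega
  -- The minimum is formal: the toggling vertex must be a vertex of the cycle even when the family
  -- is empty. For members of the family it equals `j + 2`.
  · refine acyclicAt_of_toggle (c1.inter u1.compl.ordConnected) (min (j + 2) (2 * r)) (by omega)
      (fun s hs => ?_) i
    obtain ⟨w, hw⟩ := not_forall.1 hs.2
    push Not at hw
    obtain ⟨hwc, hw1, hw3⟩ := hw
    refine ⟨w, fun t ht hts => ?_⟩
    obtain ⟨⟨⟨hm, y, hy, hyt⟩, h2⟩, h3⟩ := ht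
    have hl := hlast t hm h2
    rw [min_eq_left hl.le] at hts ⊢
    rw [← hts _ (by omega) (by omega)] at hw1
    rw [← hts _ (by omega) (by omega)] at hw3
    refine ⟨⟨⟨⟨?_, y, hy, mem_insert_of_mem hyt⟩, mem_insert_of_mem h2⟩, fun h => ?_⟩,
      ⟨⟨⟨?_, y, hy, ?_⟩, ?_⟩, fun h => ?_⟩⟩
    · refine insert_mem_altFamily hm hr (by omega) (by omega)
        fun i hi hi' h => ?_
      obtain rfl | rfl : i = j + 1 ∨ i = j + 3 := by unfold nb at h; omega
      · exact hw1
      · exact hw3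
    · have := h w hwc
      simp (disch := omega) only [pt_mem_insert] at this
      rcases this with (h | h) | (h | h)
      · omega
      · exact hw1 h
      · omega
      · exact hw3 h
    · exact erase_mem_altFamily hm hr (by omega) (by omega) ⟨_, hwc.symm, h2⟩
    · exact (pt_mem_erase (by omega) (by omega)).2 ⟨by omega, hyt⟩
    · exact (pt_mem_erase (by omega) (by omega)).2 ⟨fun h => hwc h.2.symm, h2⟩
    · exact (h w hwc).elim (fun h => hw1 (mem_of_mem_erase h)) fun h => hw3 (mem_of_mem_erase h)

/-- The cell with all colours but `0` at the vertex `1`, continued by the alternating colouring. -/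
def baseCell (r : ℕ) (e : Fin n) : Finset (Vtx r n) :=
  univ.filter fun x => ((ofLex x).1.val = 1 ∧ (ofLex x).2 ≠ 0) ∨
    (2 ≤ (ofLex x).1.val ∧ (ofLex x).2 = col e (ofLex x).1.val)

theorem pt_mem_baseCell {e : Fin n} {j : ℕ} (hj : j ≤ 2 * r) {w : Fin n} :
    pt r j w ∈ baseCell r e ↔ (j = 1 ∧ w ≠ 0) ∨ (2 ≤ j ∧ w = col e j) := by
  simp [baseCell, pt, Nat.mod_eq_of_lt (show j < 2 * r + 1 by omega)]

/-- All vertices from `2` on are prescribed. Since `2r` only has the colour `0`, fullness puts all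
other colours at `1`, and `0` is excluded there because it occurs at `2`. -/
theorem eq_baseCell (hr : 2 ≤ r) {e : Fin n} {s : Finset (Vtx r n)}
    (hs : s ∈ altFamily r e (2 * r - 1)) : s = baseCell r e := by
  have hcol : ∀ j, 2 ≤ j → j ≤ 2 * r → ∀ w, pt r j w ∈ s ↔ w = col e j := by
    intro j hj hj'
    have h1 : ∀ w, pt r j w ∈ s → w = col e j := by
      intro w hw
      by_cases h : j ≤ 2 * r - 1
      · exact hs.2.2 j hj h w hw
      · obtain rfl : j = 2 * r := by omega
        rw [col, if_neg (by simp)]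
        exact hs.2.1 w hw
    obtain ⟨y, hy⟩ := hs.1.1.1 j (by omega) hj'
    exact fun w => ⟨h1 w, fun h => by rw [h, ← h1 y hy]; exact hy⟩
  ext x
  obtain ⟨j, hj, w, rfl⟩ := exists_pt x
  rw [pt_mem_baseCell hj]
  rcases Nat.lt_or_ge j 2 with h | h
  · by_cases h0 : j = 0
    · subst h0
      simpa using pt_zero_notMem hs.1.1 hs.1.2 w
    · obtain rfl : j = 1 := by omega
      have : pt r 1 w ∈ s ↔ w ≠ 0 := by
        refine ⟨?_, fun h => altFamily_pt_one hs h⟩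
        rintro h1 rfl
        refine notMem_of_nb hs.1.1 (by omega) (by omega) (Or.inl rfl : nb r 1 2) h1 ?_
        rw [hcol 2 le_rfl (by omega)]
        simp [col]
      simp [this]
  · rw [hcol j h hj]
    simp [h]; omega

theorem baseCell_mem (hr : 2 ≤ r) {e : Fin n} (he : e ≠ 0) :
    baseCell r e ∈ cone r n ∩ full r n := by
  refine ⟨⟨fun j h1 h2 => ?_, fun j h1 h2 w => ?_, fun w => ?_⟩, fun w => ?_⟩
  · simp only [pt_mem_baseCell h2]
    by_cases h : j = 1
    · exact ⟨e, Or.inl ⟨h, he⟩⟩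
    · exact ⟨col e j, Or.inr ⟨by omega, rfl⟩⟩
  · rw [pt_mem_baseCell (by omega), pt_mem_baseCell (by omega)]
    rintro (⟨rfl, h⟩ | ⟨-, rfl⟩) (⟨h3, h4⟩ | ⟨-, h4⟩)
    · omega
    · exact h (by rw [h4]; simp [col])
    · omega
    · exact col_succ_ne he j h4.symm
  · rw [pt_mem_baseCell (by omega)]; omega
  · rw [pt_mem_baseCell (by omega), pt_mem_baseCell (by omega)]
    by_cases h : w = 0
    · right; right; exact ⟨by omega, by simp [col, h]⟩
    · left; left; exact ⟨rfl, h⟩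

theorem sec_baseCell_one (hr : 2 ≤ r) (e : Fin n) : sec (baseCell r e) 1 = univ.erase 0 := by
  ext w; simp [pt_mem_baseCell (show 1 ≤ 2 * r by omega)]

theorem sec_baseCell {e : Fin n} {j : ℕ} (h2 : 2 ≤ j) (hj : j ≤ 2 * r) :
    sec (baseCell r e) j = {col e j} := by
  ext w; simp [pt_mem_baseCell hj]; omega

theorem card_baseCell (hr : 2 ≤ r) (e : Fin n) : (baseCell r e).card = n + 2 * r - 2 := by
  have hn := NeZero.pos n
  rw [card_eq_sum_sec, range_eq_Ico, sum_eq_sum_Ico_succ_bot (by omega),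
    sum_eq_sum_Ico_succ_bot (by omega), zero_add, sec_baseCell_one hr,
    sum_congr rfl fun j hj => by
      rw [sec_baseCell (by simp at hj; omega) (by simp at hj; omega), card_singleton]]
  have : sec (baseCell r e) 0 = ∅ := by ext w; simp [pt_mem_baseCell]
  rw [this, card_erase_of_mem (mem_univ _)]
  simp; omega

/-- In low degrees, cycles of the family are homologous to multiples of the base cell. -/
theorem exists_altFamily (hr : 2 ≤ r) {e : Fin n} (he : e ≠ 0) {i : ℕ}
    (hi : i + 5 < 2 * n + 2 * r) {c : Finset (Vtx r n) → R} (hc : c ∈ cyc R (cone r n ∩ full r n) i)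
    {j : ℕ} (hj : 2 ≤ j) (hj' : j < 2 * r) :
    ∃ c' ∈ cyc R (altFamily r e j) i, c - c' ∈ bdry R (cone r n ∩ full r n) i := by
  induction j, hj using Nat.le_induction with
  | base =>
    have hQ : IsUpperSet {s : Finset (Vtx r n) | ∃ w, w ≠ 0 ∧ pt r (2 * r) w ∈ s} :=
      fun _ _ h hs => hs.imp fun w hw => ⟨hw.1, h hw.2⟩
    -- The condition at the vertex `2` is automatic: all nonzero colours are at `1`, so only `0` is
    -- left for `2`.
    have hfam : altFamily r e 2 =
        (cone r n ∩ full r n) ∩ {s | ∃ w, w ≠ 0 ∧ pt r (2 * r) w ∈ s}ᶜ := by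
      ext s
      constructor
      · rintro ⟨h, h1, -⟩
        exact ⟨h, fun ⟨w, h2, h3⟩ => h2 (h1 w h3)⟩
      · rintro ⟨h, h1⟩
        have h2 : ∀ w, pt r (2 * r) w ∈ s → w = 0 := fun w hw => by
          by_contra hw0
          exact h1 ⟨w, hw0, hw⟩
        refine ⟨h, h2, fun v hv hv' w hw => ?_⟩
        obtain rfl : v = 2 := le_antisymm hv' hv
        by_contra hw0
        have : w ≠ 0 := by simpa [col, show ¬Odd 2 by decide] using hw0
        exact notMem_of_nb h.1 (by omega) (by omega) (Or.inr (Or.inl rfl) : nb r 2 1) hw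
          ((h.2 w).resolve_right fun h => this (h2 w h))
    rw [hfam]
    exact exists_sub_mem_cyc cone_inter_full_ordConnected hQ (acyclicAt_exists_ne_zero hr hi) hc
  | succ j hj ih =>
    obtain ⟨c', hc', hcc'⟩ := ih (by omega)
    have hQ : IsUpperSet {s : Finset (Vtx r n) | ∃ w, w ≠ col e (j + 1) ∧ pt r (j + 1) w ∈ s} :=
      fun _ _ h hs => hs.imp fun w hw => ⟨hw.1, h hw.2⟩
    have hfam : altFamily r e (j + 1) =
        altFamily r e j ∩ {s | ∃ w, w ≠ col e (j + 1) ∧ pt r (j + 1) w ∈ s}ᶜ := by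
      ext s
      constructor
      · rintro ⟨h, h1, h2⟩
        exact ⟨⟨h, h1, fun v hv hv' => h2 v hv (by omega)⟩,
          fun ⟨w, h3, h4⟩ => h3 (h2 _ (by omega) le_rfl w h4)⟩
      · rintro ⟨⟨h, h1, h2⟩, h3⟩
        refine ⟨h, h1, fun v hv hv' w hw => ?_⟩
        rcases hv'.lt_or_eq with h4 | rfl
        · exact h2 v hv (by omega) w hw
        · by_contra hw0
          exact h3 ⟨w, hw0, hw⟩
    obtain ⟨c'', hc'', hcc''⟩ := exists_sub_mem_cyc (altFamily_ordConnected e j) hQ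
      (acyclicAt_altFamily hr he hj hj' hi) hc'
    refine ⟨c'', hfam ▸ hc'', ?_⟩
    have hle : bdry R (altFamily r e j) i ≤ bdry R (cone r n ∩ full r n) i := by
      have hL : IsLowerSet {s : Finset (Vtx r n) | (∀ w, pt r (2 * r) w ∈ s → w = 0) ∧
          ∀ v, 2 ≤ v → v ≤ j → ∀ w, pt r v w ∈ s → w = col e v} :=
        fun _ _ h hs => ⟨fun w hw => hs.1 w (h hw), fun v h1 h2 w hw => hs.2 v h1 h2 w (h hw)⟩
      have := bdry_lower_le (R := R) (P := cone r n ∩ full r n) (i := i) hL.compl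
      rwa [compl_compl] at this
    have := add_mem hcc' (hle hcc'')
    simpa using this

/-- The last stage of the collapse is a one-member family, so in low degrees the homology of the
full part is generated by that member, in its own cardinality. -/
theorem exists_smul_baseCell (hr : 2 ≤ r) {e : Fin n} (he : e ≠ 0) {i : ℕ}
    (hi : i + 5 < 2 * n + 2 * r) {c : Finset (Vtx r n) → R}
    (hc : c ∈ cyc R (cone r n ∩ full r n) i) :
    ∃ a : R, c - a • Pi.single (baseCell r e) 1 ∈ bdry R (cone r n ∩ full r n) i ∧
      (i ≠ n + 2 * r - 2 → a = 0) := by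
  obtain ⟨c', hc', h⟩ := exists_altFamily hr he hi hc (j := 2 * r - 1) (by omega) (by omega)
  refine ⟨c' (baseCell r e), ?_, fun hne => ?_⟩
  · convert h using 2
    ext s
    by_cases hs : s = baseCell r e
    · subst hs; simp
    · rw [chains_apply_of_notMem (mem_cyc.1 hc').1 fun h => hs (eq_baseCell hr h)]
      simp [Pi.single_eq_of_ne hs]
  · by_contra h0
    have := ((mem_cyc.1 hc').1 _ h0).2
    rw [card_baseCell hr] at this
    exact hne this.symm

theorem acyclicAt_cone (hr : 2 ≤ r) {e : Fin n} (he : e ≠ 0) {i : ℕ}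
    (hi : i + 5 < 2 * n + 2 * r) (hne : i ≠ n + 2 * r - 2) : AcyclicAt R (cone r n) i := by
  refine AcyclicAt.split cone_ordConnected full_isUpperSet (fun c hc => ?_)
    (acyclicAt_cone_inter_compl_full (by omega) i)
  obtain ⟨a, h1, h2⟩ := exists_smul_baseCell hr he hi hc
  simpa [h2 hne] using h1

end

/-! ### Cochains on the path that depend on two vertices. -/

section

variable {R : Type} [CommRing R]
variable {r n : ℕ}

theorem sec_filter_lt {j : ℕ} (hj : j ≤ 2 * r) (w : Fin n) (s : Finset (Vtx r n)) {i : ℕ}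
    (hi : i ≤ 2 * r) : sec (s.filter (· < pt r j w)) i =
      if i < j then sec s i else if i = j then (sec s i).filter (· < w) else ∅ := by
  ext x
  rw [mem_sec, mem_filter, pt_lt_pt hi hj]
  split_ifs with h1 h2
  · simp [h1]
  · simp [h2]
  · simp [h1, h2]

theorem card_filter_lt {j : ℕ} (hj : j ≤ 2 * r) (w : Fin n) (s : Finset (Vtx r n)) :
    (s.filter (· < pt r j w)).card =
      ∑ i ∈ range j, (sec s i).card + ((sec s j).filter (· < w)).card := by
  rw [card_eq_sum_sec, ← sum_range_add_sum_Ico (m := j) _ (by omega),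
    sum_eq_sum_Ico_succ_bot (by omega)]
  rw [sec_filter_lt hj w s hj, if_neg (lt_irrefl j), if_pos rfl]
  rw [sum_congr rfl fun i hi => by
    rw [sec_filter_lt hj w s (by simp at hi; omega), if_pos (mem_range.1 hi)]]
  rw [sum_eq_zero (s := Ico (j + 1) (2 * r + 1)) fun i hi => by
    rw [mem_Ico] at hi
    rw [sec_filter_lt hj w s (by omega), if_neg (by omega), if_neg (by omega), card_empty]]
  simp

theorem sg_pt {j : ℕ} (hj : j ≤ 2 * r) (w : Fin n) (s : Finset (Vtx r n)) :
    sg R (pt r j w) s = (-1) ^ (∑ i ∈ range j, (sec s i).card) *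
      (-1) ^ ((sec s j).filter (· < w)).card := by
  rw [sg, card_filter_lt hj, pow_add]

theorem sec_erase {j : ℕ} (hj : j ≤ 2 * r) (w : Fin n) (s : Finset (Vtx r n)) {i : ℕ}
    (hi : i ≤ 2 * r) : sec (s.erase (pt r j w)) i =
      if i = j then (sec s i).erase w else sec s i := by
  ext x
  rw [mem_sec, pt_mem_erase hi hj]
  split_ifs with h
  · simp [h]
  · simp [h]

theorem sg_erase {j : ℕ} (hj : j ≤ 2 * r) (w : Fin n) (s : Finset (Vtx r n)) :
    sg R (pt r j w) (s.erase (pt r j w)) = (-1) ^ (∑ i ∈ range j, (sec s i).card) *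
      (-1) ^ ((sec s j).filter (· < w)).card := by
  rw [sg_pt hj, sum_congr rfl fun i hi => by
    rw [sec_erase hj w s (by simp at hi; omega), if_neg (mem_range.1 hi).ne],
    sec_erase hj w s hj, if_pos rfl, filter_erase, erase_eq_of_notMem (by simp)]

variable (r n)

/-- Families with a colour at the vertex `0`. -/
def zeroFull : Set (Finset (Vtx r n)) := {s | ∃ w, pt r 0 w ∈ s}

/-- Cells of the complex of the path `1, …, 2 r`. -/
def pathCells : Set (Finset (Vtx r n)) := cone r n ∩ (zeroFull r n)ᶜ

variable {r n}

theorem zeroFull_isUpperSet : IsUpperSet (zeroFull r n) :=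
  fun _ _ h hs => hs.imp fun _ hw => h hw

theorem sec_zero {s : Finset (Vtx r n)} (hs : s ∈ pathCells r n) : sec s 0 = ∅ := by
  ext w
  simpa using fun h => hs.2 ⟨w, h⟩

theorem sec_nonempty {s : Finset (Vtx r n)} (hs : s ∈ cone r n) {j : ℕ} (h1 : 1 ≤ j)
    (h2 : j ≤ 2 * r) : (sec s j).Nonempty :=
  (hs.1 j h1 h2).imp fun w hw => by simpa using hw

theorem erase_mem_pathCells {s : Finset (Vtx r n)} (hs : s ∈ pathCells r n) {j : ℕ} (h1 : 1 ≤ j)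
    (h2 : j ≤ 2 * r) (w : Fin n) :
    s.erase (pt r j w) ∈ pathCells r n ↔ ((sec s j).erase w).Nonempty := by
  constructor
  · intro h
    have := sec_nonempty h.1 h1 h2
    rwa [sec_erase h2 w s h2, if_pos rfl] at this
  · rintro ⟨x, hx⟩
    rw [mem_erase, mem_sec] at hx
    exact ⟨erase_mem_cone hs.1 h2 (Or.inr ⟨x, hx⟩), fun ⟨y, hy⟩ => hs.2 ⟨y, mem_of_mem_erase hy⟩⟩

/-- The cochain on cells of the path given by a function of the colours at two vertices. -/
def twoBlock (F : Finset (Fin n) → Finset (Fin n) → R) (p q e : ℕ) (s : Finset (Vtx r n)) : R :=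
  open Classical in
  if s ∈ pathCells r n ∧ s.card + 2 = e + 2 * r then F (sec s p) (sec s q) else 0

/-- The coboundary of a function on pairs of sets. -/
def coboundary (F : Finset (Fin n) → Finset (Fin n) → R) (U W : Finset (Fin n)) : R :=
  ∑ w ∈ U, (-1) ^ (U.filter (· < w)).card * F (U.erase w) W +
    (-1) ^ U.card * ∑ w ∈ W, (-1) ^ (W.filter (· < w)).card * F U (W.erase w)

theorem twoBlock_erase {F : Finset (Fin n) → Finset (Fin n) → R} {p q e : ℕ}
    {t : Finset (Vtx r n)} (ht : t ∈ pathCells r n) (hc : t.card + 1 = e + 2 * r) {j : ℕ}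
    (h1 : 1 ≤ j) (h2 : j ≤ 2 * r) {w : Fin n} (hw : w ∈ sec t j) :
    twoBlock F p q e (t.erase (pt r j w)) = open Classical in if ((sec t j).erase w).Nonempty then
      F (sec (t.erase (pt r j w)) p) (sec (t.erase (pt r j w)) q) else 0 := by
  have : (t.erase (pt r j w)).card + 2 = e + 2 * r := by
    rw [mem_sec] at hw
    rw [card_erase_of_mem hw]
    have := card_pos.2 ⟨_, hw⟩
    omega
  unfold twoBlock
  rw [erase_mem_pathCells ht h1 h2]
  simp [this]

/-- Let `e` be the degree of `F`. A face obtained at `p` or `q` contributes only if all other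
vertices of the path have one colour. These vertices give the sign `(-1)^(p - 1)` before `p` and, as
`q - p` is odd, no sign between `p` and `q`. A face obtained at another vertex contributes only if
that vertex has two colours, and then its two faces cancel. -/
theorem sum_twoBlock {F : Finset (Fin n) → Finset (Fin n) → R} {p q e : ℕ} (hp : 1 ≤ p)
    (hpq : p < q) (hq : q ≤ 2 * r) (hodd : Odd (q - p)) (hF1 : ∀ W, F ∅ W = 0) (hF2 : ∀ U, F U ∅ = 0)
    (hF : ∀ U W, F U W ≠ 0 → U.card + W.card = e) {t : Finset (Vtx r n)} (ht : t ∈ pathCells r n)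
    (hc : t.card + 1 = e + 2 * r) :
    ∑ x ∈ t, sg R x (t.erase x) * twoBlock F p q e (t.erase x) =
      (-1) ^ (p - 1) * coboundary F (sec t p) (sec t q) := by
  have hcard : ∀ j, 1 ≤ j → j ≤ 2 * r → j ≠ p → j ≠ q →
      (sec t p).card + (sec t q).card + (sec t j).card + 2 * r ≤ t.card + 3 := by
    intro j h1 h2 h3 h4
    have := card_ge ht.1 {p, q, j} (by
      intro j hj; simp only [mem_insert, mem_singleton] at hj; rw [mem_Icc]; omega)
    rw [sum_insert (by simp; omega), sum_insert (by simp; omega),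
      sum_singleton, card_insert_of_notMem (by simp; omega),
      card_insert_of_notMem (by simp; omega), card_singleton] at this
    omega
  have hone : ∀ i, (sec t p).card + (sec t q).card = e + 1 → i ≤ 2 * r → i ≠ p → i ≠ q →
      (sec t i).card = if i = 0 then 0 else 1 := by
    intro i he hi hip hiq
    split_ifs with h0
    · subst h0; rw [sec_zero ht, card_empty]
    · have h1 := hcard i (by omega) hi hip hiq
      have h2 := (sec_nonempty ht.1 (show 1 ≤ i by omega) hi).card_pos
      omega
  have hsum : ∀ m, (sec t p).card + (sec t q).card = e + 1 → m ≤ p →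
      ∑ i ∈ range m, (sec t i).card = m - 1 := by
    intro m he hm
    induction m with
    | zero => simp
    | succ m ih =>
      rw [sum_range_succ, ih (by omega), hone m he (by omega) (by omega) (by omega)]
      split_ifs with h <;> omega
  rw [sum_eq_sum_sec, sum_eq_add p q hpq.ne, coboundary, mul_add]
  · congr 1
    · rw [mul_sum]
      refine sum_congr rfl fun w hw => ?_
      rw [twoBlock_erase ht hc hp (by omega) hw, sg_erase (by omega),
        sec_erase (by omega) w t (by omega), sec_erase (by omega) w t hq, if_pos rfl,
        if_neg (show ¬ q = p by omega)]
      by_cases h0 : F ((sec t p).erase w) (sec t q) = 0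
      · simp [h0]
      · have h1 := hF _ _ h0
        rw [card_erase_of_mem hw] at h1
        have h2 := card_pos.2 ⟨_, hw⟩
        rw [if_pos, hsum p (by omega) le_rfl, mul_assoc]
        rw [nonempty_iff_ne_empty]
        intro h; exact h0 (by rw [h, hF1])
    · rw [mul_sum, mul_sum]
      refine sum_congr rfl fun w hw => ?_
      rw [twoBlock_erase ht hc (by omega) (by omega) hw, sg_erase (by omega),
        sec_erase (by omega) w t (by omega), sec_erase (by omega) w t hq, if_pos rfl,
        if_neg (show ¬ p = q by omega)]
      by_cases h0 : F (sec t p) ((sec t q).erase w) = 0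
      · simp [h0]
      · have h1 := hF _ _ h0
        rw [card_erase_of_mem hw] at h1
        have h2 := card_pos.2 ⟨_, hw⟩
        have he : (sec t p).card + (sec t q).card = e + 1 := by omega
        rw [if_pos]
        · have h3 : ∑ i ∈ range q, (sec t i).card = (p - 1) + (sec t p).card + (q - p - 1) := by
            rw [← sum_range_add_sum_Ico (m := p) _ (by omega), sum_eq_sum_Ico_succ_bot hpq,
              hsum p he le_rfl, sum_congr (g := fun _ => 1) rfl fun i hi => by
                rw [mem_Ico] at hi
                rw [hone i he (by omega) (by omega) (by omega), if_neg (by omega)]]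
            simp; omega
          have h4 : Even (q - p - 1) := by
            obtain ⟨k, hk⟩ := hodd
            exact ⟨k, by omega⟩
          rw [h3, pow_add, pow_add, h4.neg_one_pow]
          ring
        · rw [nonempty_iff_ne_empty]
          intro h; exact h0 (by rw [h, hF2])
  · rintro j hj ⟨hjp, hjq⟩
    have hj' : j ≤ 2 * r := by simp at hj; omega
    by_cases hj0 : j = 0
    · subst hj0; rw [sec_zero ht, sum_empty]
    have e1 : ∀ w ∈ sec t j, sg R (pt r j w) (t.erase (pt r j w)) *
        twoBlock F p q e (t.erase (pt r j w)) = (-1) ^ (∑ i ∈ range j, (sec t i).card) *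
        ((-1) ^ ((sec t j).filter (· < w)).card * open Classical in
          if ((sec t j).erase w).Nonempty then F (sec t p) (sec t q) else 0) := by
      intro w hw
      rw [twoBlock_erase ht hc (by omega) hj' hw, sg_erase hj',
        sec_erase hj' w t (by omega), sec_erase hj' w t hq, if_neg hjp.symm, if_neg hjq.symm,
        mul_assoc]
    rw [sum_congr rfl e1, ← mul_sum]
    by_cases h0 : F (sec t p) (sec t q) = 0
    · simp [h0]
    have h1 := hF _ _ h0
    have h2 := hcard j (by omega) hj' hjp hjq
    have h3 : (sec t j).card = 1 ∨ (sec t j).card = 2 := by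
      have := (sec_nonempty ht.1 (show 1 ≤ j by omega) hj').card_pos
      omega
    rcases h3 with h3 | h3
    -- Deleting an only colour leaves the complex; with two colours the two deletions have opposite
    -- signs and equal values of `F`.
    · obtain ⟨w, hw⟩ := card_eq_one.1 h3
      simp [hw]
    · obtain ⟨a, b, hab, hs⟩ := card_eq_two.1 h3
      have hs2 : sec t j = {b, a} := by rw [hs, pair_comm]
      wlog hlt : a < b generalizing a b
      · exact this b a hab.symm hs2 hs (lt_of_le_of_ne (not_lt.1 hlt) hab.symm)
      rw [hs, sum_pair hab, filter_insert, filter_singleton, filter_insert, filter_singleton,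
        if_neg (lt_irrefl a), if_neg hlt.not_gt, if_pos hlt, if_neg (lt_irrefl b),
        if_pos ⟨b, by simp [hab.symm]⟩, if_pos ⟨a, by simp [hab]⟩]
      simp
  · intro h; simp at h; omega
  · intro h; simp at h; omega

theorem sum_twoBlock_mul_bd {F : Finset (Fin n) → Finset (Fin n) → R} {p q e : ℕ} (hp : 1 ≤ p)
    (hpq : p < q) (hq : q ≤ 2 * r) (hodd : Odd (q - p)) (hF1 : ∀ W, F ∅ W = 0) (hF2 : ∀ U, F U ∅ = 0)
    (hF : ∀ U W, F U W ≠ 0 → U.card + W.card = e) {c : Finset (Vtx r n) → R} {i : ℕ}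
    (hc : c ∈ chains R (pathCells r n) i) (hi : i + 1 = e + 2 * r) :
    ∑ s, twoBlock F p q e s * bd R c s =
      (-1) ^ (p - 1) * ∑ t, coboundary F (sec t p) (sec t q) * c t := by
  rw [sum_mul_bd, mul_sum]
  refine sum_congr rfl fun t _ => ?_
  by_cases h : c t = 0
  · simp [h]
  · obtain ⟨h1, h2⟩ := hc t h
    rw [sum_twoBlock hp hpq hq hodd hF1 hF2 hF h1 (by omega), mul_assoc]

end

/-! ### Shuffle signs and their coboundary. -/

section

variable {R : Type} [CommRing R]
variable {r n : ℕ}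

variable (R) in
/-- The sign of the shuffle which sorts the elements of `U` followed by those of `W`. -/
def sh (U W : Finset (Fin n)) : R := (-1) ^ ((U ×ˢ W).filter fun p => p.2 < p.1).card

theorem sh_eq_prod (U W : Finset (Fin n)) :
    sh R U W = ∏ u ∈ U, ∏ w ∈ W, if w < u then -1 else 1 := by
  rw [sh, ← prod_product' (f := fun u w : Fin n => if w < u then (-1 : R) else 1),
    prod_ite, prod_const, prod_const_one, mul_one]

theorem prod_ite_neg_one (U : Finset (Fin n)) (p : Fin n → Prop) [DecidablePred p] :
    (∏ u ∈ U, if p u then (-1 : R) else 1) = (-1) ^ (U.filter p).card := by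
  rw [prod_ite, prod_const, prod_const_one, mul_one]

theorem sh_insert_left {x : Fin n} {U W : Finset (Fin n)} (hx : x ∉ U) :
    sh R (insert x U) W = sh R U W * (-1) ^ (W.filter (· < x)).card := by
  rw [sh_eq_prod, prod_insert hx, prod_ite_neg_one, ← sh_eq_prod, mul_comm]

theorem sh_insert_right {x : Fin n} {U W : Finset (Fin n)} (hx : x ∉ W) :
    sh R U (insert x W) = sh R U W * (-1) ^ (U.filter (x < ·)).card := by
  rw [sh_eq_prod, prod_comm, prod_insert hx, prod_ite_neg_one, prod_comm, ← sh_eq_prod, mul_comm]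

theorem sh_empty_left (W : Finset (Fin n)) : sh R ∅ W = 1 := by simp [sh]

theorem sh_empty_right (U : Finset (Fin n)) : sh R U ∅ = 1 := by simp [sh]

theorem sh_singleton_left (x : Fin n) (W : Finset (Fin n)) :
    sh R {x} W = (-1) ^ (W.filter (· < x)).card := by
  rw [← insert_empty_eq, sh_insert_left (notMem_empty x), sh_empty_left, one_mul]

theorem sh_singleton_right (x : Fin n) (U : Finset (Fin n)) :
    sh R U {x} = (-1) ^ (U.filter (x < ·)).card := by
  rw [← insert_empty_eq, sh_insert_right (notMem_empty x), sh_empty_right, one_mul]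

theorem card_lt_add_card_gt {x : Fin n} {U : Finset (Fin n)} (hx : x ∉ U) :
    (U.filter (· < x)).card + (U.filter (x < ·)).card = U.card := by
  have h : U.filter (x < ·) = U.filter fun y => ¬ y < x := by
    refine filter_congr fun y hy => ?_
    have : y ≠ x := fun h => hx (h ▸ hy)
    rw [not_lt, le_iff_lt_or_eq]
    simp [this.symm]
  rw [h]
  exact card_filter_add_card_filter_not _

theorem neg_one_pow_mul_self (k : ℕ) : (-1 : R) ^ k * (-1) ^ k = 1 := by
  rw [← pow_add, ← two_mul, pow_mul]; simp

/-- Each pair in `U × W` is inverted in exactly one of the two orders. -/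
theorem sh_comm {U W : Finset (Fin n)} (h : Disjoint U W) :
    sh R W U = (-1) ^ (U.card * W.card) * sh R U W := by
  induction U using Finset.induction_on with
  | empty => simp [sh_empty_left, sh_empty_right]
  | insert x U hx ih =>
    rw [disjoint_insert_left] at h
    rw [sh_insert_left hx, sh_insert_right hx, ih h.2, card_insert_of_notMem hx, add_mul, one_mul,
      pow_add, ← card_lt_add_card_gt h.1, pow_add ((-1 : R)) _ (W.filter (x < ·)).card]
    linear_combination (-(-1) ^ (U.card * ((W.filter (· < x)).card + (W.filter (x < ·)).card)) *
      sh R U W * (-1) ^ (W.filter (x < ·)).card) *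
      neg_one_pow_mul_self (R := R) (W.filter (· < x)).card

/-- The shuffle sign of the partitions of `N` into two nonempty parts. -/
def shuf (R : Type) [CommRing R] (N U W : Finset (Fin n)) : R :=
  open Classical in
  if U.Nonempty ∧ W.Nonempty ∧ Disjoint U W ∧ U ∪ W = N then sh R U W else 0

theorem shuf_empty_left (N W : Finset (Fin n)) : shuf R N ∅ W = 0 := by simp [shuf]

theorem shuf_empty_right (N U : Finset (Fin n)) : shuf R N U ∅ = 0 := by simp [shuf]

theorem of_shuf_ne_zero {N U W : Finset (Fin n)} (h : shuf R N U W ≠ 0) :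
    U.Nonempty ∧ W.Nonempty ∧ Disjoint U W ∧ U ∪ W = N := by
  unfold shuf at h
  by_contra hn
  exact h (if_neg hn)

theorem card_of_shuf_ne_zero {N U W : Finset (Fin n)} (h : shuf R N U W ≠ 0) :
    U.card + W.card = N.card := by
  obtain ⟨-, -, h1, h2⟩ := of_shuf_ne_zero h
  rw [← h2, card_union_of_disjoint h1]

theorem shuf_eq {N U W : Finset (Fin n)} (hU : U.Nonempty) (hW : W.Nonempty) (h : Disjoint U W)
    (hN : U ∪ W = N) : shuf R N U W = sh R U W := if_pos ⟨hU, hW, h, hN⟩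

/-- The two sets share `x`, and only deleting `x` from one of them can make them disjoint, so two
terms survive. -/
theorem coboundary_shuf_insert {N U W : Finset (Fin n)} {x : Fin n} (hU : x ∉ U) (hW : x ∉ W) :
    coboundary (shuf R N) (insert x U) (insert x W) =
      (-1) ^ (U.filter (· < x)).card * shuf R N U (insert x W) +
      (-1) ^ (U.card + 1 + (W.filter (· < x)).card) * shuf R N (insert x U) W := by
  unfold coboundary
  rw [sum_eq_single x, sum_eq_single x, erase_insert hU, erase_insert hW, filter_insert,
    if_neg (lt_irrefl x), filter_insert, if_neg (lt_irrefl x), card_insert_of_notMem hU,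
    pow_add _ (U.card + 1)]
  · ring
  · intro w hw hwx
    have : shuf R N (insert x U) ((insert x W).erase w) = 0 := by
      by_contra h
      exact disjoint_left.1 (of_shuf_ne_zero h).2.2.1 (mem_insert_self x U)
        (mem_erase.2 ⟨hwx.symm, mem_insert_self x W⟩)
    rw [this, mul_zero]
  · intro h; exact absurd (mem_insert_self x W) h
  · intro w hw hwx
    have : shuf R N ((insert x U).erase w) (insert x W) = 0 := by
      by_contra h
      exact disjoint_left.1 (of_shuf_ne_zero h).2.2.1 (mem_erase.2 ⟨hwx.symm, mem_insert_self x U⟩)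
        (mem_insert_self x W)
    rw [this, mul_zero]
  · intro h; exact absurd (mem_insert_self x U) h

/-- The two surviving terms are the ways to assign the common element to one side. Moving it across
changes the shuffle sign by exactly the factor that makes them cancel. -/
theorem coboundary_shuf_insert_eq_zero {N U W : Finset (Fin n)} {x : Fin n} (hU : x ∉ U)
    (hW : x ∉ W) (hd : Disjoint U W) (hN : insert x (U ∪ W) = N) (hU' : U.Nonempty)
    (hW' : W.Nonempty) : coboundary (shuf R N) (insert x U) (insert x W) = 0 := by
  rw [coboundary_shuf_insert hU hW, shuf_eq hU' ⟨x, mem_insert_self _ _⟩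
    (disjoint_insert_right.2 ⟨hU, hd⟩) (by rw [union_insert, hN]),
    shuf_eq ⟨x, mem_insert_self _ _⟩ hW' (disjoint_insert_left.2 ⟨hW, hd⟩) (by rw [insert_union, hN]),
    sh_insert_left hU, sh_insert_right hW, ← card_lt_add_card_gt hU]
  simp only [pow_add]
  linear_combination (-(-1) ^ (U.filter (· < x)).card * (-1) ^ (U.filter (x < ·)).card * sh R U W) *
      neg_one_pow_mul_self (R := R) (W.filter (· < x)).card

/-- If the coboundary of the shuffle sign is nonzero, one of its terms is nonzero. -/
theorem of_coboundary_ne_zero {F : Finset (Fin n) → Finset (Fin n) → R} {U W : Finset (Fin n)}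
    (h : coboundary F U W ≠ 0) : (∃ x ∈ U, F (U.erase x) W ≠ 0) ∨ ∃ x ∈ W, F U (W.erase x) ≠ 0 := by
  by_contra hn
  push Not at hn
  refine h ?_
  unfold coboundary
  rw [sum_eq_zero fun w hw => by rw [hn.1 w hw, mul_zero],
    sum_eq_zero fun w hw => by rw [hn.2 w hw, mul_zero], mul_zero, add_zero]

/-- If the coboundary of the shuffle sign of `N` does not vanish at two subsets of `N`, the subsets
have exactly one common element. -/
theorem exists_of_coboundary_shuf_ne_zero {N U W : Finset (Fin n)}
    (h : coboundary (shuf R N) U W ≠ 0) (hU : U ⊆ N) (hW : W ⊆ N) :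
    ∃ x U' W', x ∉ U' ∧ x ∉ W' ∧ Disjoint U' W' ∧ insert x (U' ∪ W') = N ∧ U = insert x U' ∧
      W = insert x W' := by
  obtain ⟨x, hx, h⟩ | ⟨x, hx, h⟩ := of_coboundary_ne_zero h
  · obtain ⟨-, -, h1, h2⟩ := of_shuf_ne_zero h
    have hxW : x ∈ W := by
      have := hU hx
      rw [← h2] at this
      simpa using this
    refine ⟨x, U.erase x, W.erase x, notMem_erase _ _, notMem_erase _ _,
      h1.mono_right (erase_subset _ _), ?_, (insert_erase hx).symm, (insert_erase hxW).symm⟩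
    rw [← union_insert, insert_erase hxW, h2]
  · obtain ⟨-, -, h1, h2⟩ := of_shuf_ne_zero h
    have hxU : x ∈ U := by
      have := hW hx
      rw [← h2] at this
      simpa using this
    refine ⟨x, U.erase x, W.erase x, notMem_erase _ _, notMem_erase _ _,
      h1.mono_left (erase_subset _ _), ?_, (insert_erase hxU).symm, (insert_erase hx).symm⟩
    rw [← insert_union, insert_erase hxU, h2]

/-- The shuffle sign is a cocycle apart from the requirement that both parts be nonempty; that
requirement removes a term only when one of the sets is all of `N`. -/
theorem coboundary_shuf_eq_zero {N U W : Finset (Fin n)} (hU : U ⊆ N) (hW : W ⊆ N) (hU' : U ≠ N)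
    (hW' : W ≠ N) : coboundary (shuf R N) U W = 0 := by
  by_contra h
  obtain ⟨x, U', W', h1, h2, h3, h4, rfl, rfl⟩ := exists_of_coboundary_shuf_ne_zero h hU hW
  refine h (coboundary_shuf_insert_eq_zero h1 h2 h3 h4 ?_ ?_)
  · rw [nonempty_iff_ne_empty]
    rintro rfl
    exact hW' (by rw [← h4, empty_union])
  · rw [nonempty_iff_ne_empty]
    rintro rfl
    exact hU' (by rw [← h4, union_empty])

/-- The shuffle sign on all colours is a coboundary up to two boundary terms. If `0` lies in one of
the sets, only its deletion counts, and as `0` is the least colour this gives the shuffle sign on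
all colours, except when the set was `{0}`. If `0` lies in neither, the cocycle property applies,
except when one set consists of all nonzero colours. In both exceptional situations one set is
`univ.erase 0`, which is what the correction terms record. -/
theorem coboundary_shuf_erase [NeZero n] {U W : Finset (Fin n)} (hn : 3 ≤ n) (hU : U.Nonempty)
    (hW : W.Nonempty) (hc : U.card + W.card = n) :
    coboundary (shuf R (univ.erase 0)) U W = shuf R univ U W -
      (if W = univ.erase 0 then 1 else 0) + (-1) ^ n * (if U = univ.erase 0 then 1 else 0) := by
  have hN : (univ.erase (0 : Fin n)).card = n - 1 := by
    rw [card_erase_of_mem (mem_univ _), card_univ, Fintype.card_fin]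
  have hlt : ∀ S : Finset (Fin n), S.filter (· < 0) = ∅ := fun S => by
    ext w; simp
  by_cases h0U : 0 ∈ U
  · have hUN : U ≠ univ.erase 0 := fun h => by simp [h] at h0U
    rw [if_neg hUN, mul_zero, add_zero]
    unfold coboundary
    rw [sum_eq_single 0, sum_eq_zero (s := W), mul_zero, add_zero, hlt, card_empty, pow_zero, one_mul]
    · by_cases hd : Disjoint U W
      · have hu : U ∪ W = univ := by
          rw [← card_eq_iff_eq_univ, card_union_of_disjoint hd, hc, Fintype.card_fin]
        have h0W : 0 ∉ W := disjoint_left.1 hd h0U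
        rw [shuf_eq hU hW hd hu]
        by_cases h1 : (U.erase 0).Nonempty
        · have hWN : W ≠ univ.erase 0 := by
            rintro rfl
            have := card_pos.2 h1
            rw [card_erase_of_mem h0U] at this
            omega
          rw [if_neg hWN, sub_zero, shuf_eq h1 hW (hd.mono_left (erase_subset _ _))
            (by rw [← hu, erase_union_distrib, erase_eq_of_notMem h0W])]
          conv_rhs => rw [← insert_erase h0U, sh_insert_left (notMem_erase _ _), hlt]
          simp
        · rw [not_nonempty_iff_eq_empty] at h1
          have hU0 : U = {0} := by rw [← insert_erase h0U, h1, insert_empty_eq]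
          have hWN : W = univ.erase 0 := by
            rw [← hu, erase_union_distrib, h1, empty_union, erase_eq_of_notMem h0W]
          rw [h1, shuf_empty_left, if_pos hWN, hU0, sh_singleton_left, hlt]
          simp
      · have e1 : shuf R univ U W = 0 := by
          by_contra h; exact hd (of_shuf_ne_zero h).2.2.1
        have e2 : shuf R (univ.erase 0) (U.erase 0) W = 0 := by
          by_contra h
          obtain ⟨-, -, h1, h2⟩ := of_shuf_ne_zero h
          refine hd ?_
          rw [← insert_erase h0U, disjoint_insert_left]
          refine ⟨fun h => ?_, h1⟩
          have : 0 ∈ univ.erase (0 : Fin n) := h2 ▸ mem_union_right _ h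
          simp at this
        have e3 : W ≠ univ.erase 0 := by
          rintro rfl
          have : U.card = 1 := by omega
          obtain ⟨a, rfl⟩ := card_eq_one.1 this
          simp only [mem_singleton] at h0U
          rw [← h0U] at hd
          simp at hd
        rw [e1, e2, if_neg e3, sub_zero]
    · intro w _
      have : shuf R (univ.erase 0) U (W.erase w) = 0 := by
        by_contra h
        have := (of_shuf_ne_zero h).2.2.2
        have : 0 ∈ univ.erase (0 : Fin n) := this ▸ mem_union_left _ h0U
        simp at this
      rw [this, mul_zero]
    · intro w _ hw
      have : shuf R (univ.erase 0) (U.erase w) W = 0 := by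
        by_contra h
        have := (of_shuf_ne_zero h).2.2.2
        have : 0 ∈ univ.erase (0 : Fin n) := this ▸ mem_union_left _ (mem_erase.2 ⟨hw.symm, h0U⟩)
        simp at this
      rw [this, mul_zero]
    · exact fun h => absurd h0U h
  by_cases h0W : 0 ∈ W
  · have hWN : W ≠ univ.erase 0 := fun h => by simp [h] at h0W
    rw [if_neg hWN, sub_zero]
    unfold coboundary
    rw [sum_eq_single (s := W) 0, sum_eq_zero (s := U), zero_add, hlt, card_empty, pow_zero, one_mul]
    · by_cases hd : Disjoint U W
      · have hu : U ∪ W = univ := by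
          rw [← card_eq_iff_eq_univ, card_union_of_disjoint hd, hc, Fintype.card_fin]
        have hgt : U.filter (0 < ·) = U := filter_true_of_mem fun w hw =>
          Fin.pos_iff_ne_zero.2 (by rintro rfl; exact h0U hw)
        rw [shuf_eq hU hW hd hu]
        by_cases h1 : (W.erase 0).Nonempty
        · have hUN : U ≠ univ.erase 0 := by
            rintro rfl
            have := card_pos.2 h1
            rw [card_erase_of_mem h0W] at this
            omega
          rw [if_neg hUN, mul_zero, add_zero, shuf_eq hU h1 (hd.mono_right (erase_subset _ _))
            (by rw [← hu, erase_union_distrib, erase_eq_of_notMem h0U])]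
          conv_rhs => rw [← insert_erase h0W, sh_insert_right (notMem_erase _ _), hgt]
          ring
        · rw [not_nonempty_iff_eq_empty] at h1
          have hW0 : W = {0} := by rw [← insert_erase h0W, h1, insert_empty_eq]
          have hUN : U = univ.erase 0 := by
            rw [← hu, erase_union_distrib, h1, union_empty, erase_eq_of_notMem h0U]
          rw [h1, shuf_empty_right, if_pos hUN, hW0, sh_singleton_right, hgt, hUN, hN, mul_zero]
          obtain ⟨m, rfl⟩ : ∃ m, n = m + 1 := ⟨n - 1, by omega⟩
          rw [Nat.add_sub_cancel, pow_succ]; ring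
      · have e1 : shuf R univ U W = 0 := by
          by_contra h; exact hd (of_shuf_ne_zero h).2.2.1
        have e2 : shuf R (univ.erase 0) U (W.erase 0) = 0 := by
          by_contra h
          obtain ⟨-, -, h1, h2⟩ := of_shuf_ne_zero h
          refine hd ?_
          rw [← insert_erase h0W, disjoint_insert_right]
          exact ⟨h0U, h1⟩
        have e3 : U ≠ univ.erase 0 := by
          rintro rfl
          have : W.card = 1 := by omega
          obtain ⟨a, rfl⟩ := card_eq_one.1 this
          simp only [mem_singleton] at h0W
          rw [← h0W] at hd
          simp at hd
        rw [e1, e2, if_neg e3]; simp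
    · intro w _
      have : shuf R (univ.erase 0) (U.erase w) W = 0 := by
        by_contra h
        have := (of_shuf_ne_zero h).2.2.2
        have : 0 ∈ univ.erase (0 : Fin n) := this ▸ mem_union_right _ h0W
        simp at this
      rw [this, mul_zero]
    · intro w _ hw
      have : shuf R (univ.erase 0) U (W.erase w) = 0 := by
        by_contra h
        have := (of_shuf_ne_zero h).2.2.2
        have : 0 ∈ univ.erase (0 : Fin n) := this ▸ mem_union_right _ (mem_erase.2 ⟨hw.symm, h0W⟩)
        simp at this
      rw [this, mul_zero]
    · exact fun h => absurd h0W h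
  have hUs : U ⊆ univ.erase 0 := fun w hw => by simpa using fun h : w = 0 => h0U (h ▸ hw)
  have hWs : W ⊆ univ.erase 0 := fun w hw => by simpa using fun h : w = 0 => h0W (h ▸ hw)
  have e1 : shuf R univ U W = 0 := by
    by_contra h
    have := (of_shuf_ne_zero h).2.2.2
    have : (0 : Fin n) ∈ U ∪ W := this ▸ mem_univ _
    rw [mem_union] at this
    tauto
  rw [e1]
  by_cases hWN : W = univ.erase 0
  · have hU1 : U.card = 1 := by rw [hWN] at hc; omega
    obtain ⟨x, rfl⟩ := card_eq_one.1 hU1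
    have hx : x ∈ W := hWN ▸ hUs (mem_singleton_self x)
    have hne : ({x} : Finset (Fin n)) ≠ univ.erase 0 := fun h => by
      have := congrArg card h; rw [hN, card_singleton] at this; omega
    have hW1 : (W.erase x).Nonempty := by
      rw [← card_pos, card_erase_of_mem hx]; rw [hU1] at hc; omega
    rw [if_pos hWN, if_neg hne]
    have := coboundary_shuf_insert (R := R) (N := univ.erase 0) (notMem_empty x)
      (notMem_erase x W)
    rw [insert_empty_eq, insert_erase hx] at this
    rw [this, shuf_empty_left, shuf_eq (singleton_nonempty x) hW1 (by simp)
      (by rw [singleton_union, insert_erase hx, hWN]), sh_singleton_left, card_empty, pow_add]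
    linear_combination -neg_one_pow_mul_self (R := R) ((W.erase x).filter (· < x)).card
  by_cases hUN : U = univ.erase 0
  · have hW1 : W.card = 1 := by rw [hUN] at hc; omega
    obtain ⟨x, rfl⟩ := card_eq_one.1 hW1
    have hx : x ∈ U := hUN ▸ hWs (mem_singleton_self x)
    have hU1 : (U.erase x).Nonempty := by
      rw [← card_pos, card_erase_of_mem hx]; rw [hW1] at hc; omega
    rw [if_pos hUN, if_neg hWN]
    have := coboundary_shuf_insert (R := R) (N := univ.erase 0) (notMem_erase x U)
      (notMem_empty x)
    rw [insert_empty_eq, insert_erase hx] at this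
    rw [this, shuf_empty_right, shuf_eq hU1 (singleton_nonempty x) (by simp)
      (by rw [union_comm, singleton_union, insert_erase hx, hUN]), sh_singleton_right, ← pow_add,
      card_lt_add_card_gt (notMem_erase x U), card_erase_of_mem hx]
    obtain ⟨m, hm⟩ : ∃ m, n = m + 2 := ⟨n - 2, by omega⟩
    have h2 : (-1 : R) ^ n = (-1) ^ m := (congrArg _ hm).trans (by rw [pow_add]; simp)
    rw [show U.card - 1 = m by rw [hW1] at hc; omega, h2]
    simp
  rw [if_neg hUN, if_neg hWN, coboundary_shuf_eq_zero hUs hWs hUN hWN]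
  simp

end

/-! ### The pairing of cochains with chains. -/

section

variable {T : Type} [LinearOrder T] [Fintype T] {R : Type} [CommRing R]

/-- The pairing of a cochain with chains. -/
def pair (g : Finset T → R) : (Finset T → R) →ₗ[R] R where
  toFun c := ∑ s, g s * c s
  map_add' c d := by simp [mul_add, sum_add_distrib]
  map_smul' a c := by
    simp only [Pi.smul_apply, smul_eq_mul, RingHom.id_apply, mul_sum]
    exact sum_congr rfl fun _ _ => by ring

theorem pair_apply (g c : Finset T → R) : pair g c = ∑ s, g s * c s := rfl

theorem pair_res {P : Set (Finset T)} {g : Finset T → R} (h : ∀ s, g s ≠ 0 → s ∈ P)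
    (c : Finset T → R) : pair g (res R P c) = pair g c := by
  rw [pair_apply, pair_apply]
  refine sum_congr rfl fun s _ => ?_
  by_cases hs : s ∈ P
  · rw [res_apply_mem _ hs]
  · rw [not_imp_comm.1 (h s) hs, zero_mul, zero_mul]

theorem pair_bd (g c : Finset T → R) :
    pair g (bd R c) = ∑ t, (∑ x ∈ t, sg R x (t.erase x) * g (t.erase x)) * c t := sum_mul_bd g c

theorem pair_single (g : Finset T → R) (s : Finset T) : pair g (Pi.single s 1) = g s := by
  rw [pair_apply, sum_eq_single s (fun t _ h => by rw [Pi.single_eq_of_ne h, mul_zero]) (by simp)]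
  simp

end

/-! ### The homology class of the cone. -/

section

variable {R : Type} [CommRing R]
variable {r n : ℕ}

theorem of_twoBlock_ne_zero {F : Finset (Fin n) → Finset (Fin n) → R} {p q e : ℕ}
    {s : Finset (Vtx r n)} (h : twoBlock F p q e s ≠ 0) :
    s ∈ pathCells r n ∧ s.card + 2 = e + 2 * r ∧ F (sec s p) (sec s q) ≠ 0 := by
  classical
  unfold twoBlock at h
  by_cases h1 : s ∈ pathCells r n ∧ s.card + 2 = e + 2 * r
  · rw [if_pos h1] at h
    exact ⟨h1.1, h1.2, h⟩
  · exact absurd (if_neg h1) h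

theorem twoBlock_eq {F : Finset (Fin n) → Finset (Fin n) → R} {p q e : ℕ} {s : Finset (Vtx r n)}
    (h1 : s ∈ pathCells r n) (h2 : s.card + 2 = e + 2 * r) :
    twoBlock F p q e s = F (sec s p) (sec s q) := if_pos ⟨h1, h2⟩

/-- Cocycles with two blocks vanish on boundaries of cycles of the path. -/
theorem sum_coboundary_mul_eq_zero {F : Finset (Fin n) → Finset (Fin n) → R} {p q e : ℕ} (hp : 1 ≤ p)
    (hpq : p < q) (hq : q ≤ 2 * r) (hodd : Odd (q - p)) (hF1 : ∀ W, F ∅ W = 0) (hF2 : ∀ U, F U ∅ = 0)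
    (hF : ∀ U W, F U W ≠ 0 → U.card + W.card = e) {z : Finset (Vtx r n) → R} {i : ℕ}
    (hz : z ∈ cyc R (pathCells r n) i) (hi : i + 1 = e + 2 * r) :
    ∑ t, coboundary F (sec t p) (sec t q) * z t = 0 := by
  obtain ⟨hz1, hz2⟩ := mem_cyc.1 hz
  have h := sum_twoBlock_mul_bd hp hpq hq hodd hF1 hF2 hF hz1 hi
  rw [sum_eq_zero fun s _ => ?_] at h
  · have h2 := congrArg (fun x => (-1) ^ (p - 1) * x) h
    simp only [mul_zero, ← mul_assoc, neg_one_pow_mul_self, one_mul] at h2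
    exact h2.symm
  · by_cases hs : twoBlock F p q e s = 0
    · rw [hs, zero_mul]
    · rw [hz2 s (of_twoBlock_ne_zero hs).1, mul_zero]

variable (R r n) in
/-- The cocycle which detects the first nonzero homology class of the cone. -/
def phi : (Finset (Vtx r n) → R) →ₗ[R] R := pair (twoBlock (shuf R univ) 1 (2 * r) n)

theorem of_phi_ne_zero {s : Finset (Vtx r n)} (h : twoBlock (shuf R univ) 1 (2 * r) n s ≠ 0) :
    s ∈ cone r n ∩ full r n := by
  obtain ⟨h1, -, h2⟩ := of_twoBlock_ne_zero h
  refine ⟨h1.1, fun w => ?_⟩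
  have := mem_univ w
  rw [← (of_shuf_ne_zero h2).2.2.2] at this
  simpa using this

/-- A member coloured at `0` has no face in the full part: such a face would make the member itself
full, and full members have no colour at `0`. On members uncoloured at `0` the shuffle sign is a
cocycle, because the nonempty vertices `2` and `2r - 1` prevent `1` and `2r` from carrying all
colours. -/
theorem phi_bd [NeZero n] (hr : 1 ≤ r) {b : Finset (Vtx r n) → R} {i : ℕ} (hb : b ∈ chains R (cone r n) i)
    (hi : i + 1 = n + 2 * r) : phi R r n (bd R b) = 0 := by
  have hbs : b = res R (zeroFull r n) b + res R (zeroFull r n)ᶜ b :=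
    (Set.indicator_self_add_compl _ b).symm
  have h1 := res_mem_chains (Q := zeroFull r n) hb
  have h2 := res_mem_chains (Q := (zeroFull r n)ᶜ) hb
  rw [hbs, map_add, map_add]
  have e1 : phi R r n (bd R (res R (zeroFull r n) b)) = 0 := by
    rw [phi, pair_bd]
    refine sum_eq_zero fun t _ => ?_
    by_cases ht : res R (zeroFull r n) b t = 0
    · rw [ht, mul_zero]
    obtain ⟨⟨h3, w, hw⟩, -⟩ := h1 t ht
    rw [sum_eq_zero fun x _ => ?_, zero_mul]
    by_cases hx : twoBlock (shuf R univ) 1 (2 * r) n (t.erase x) = 0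
    · rw [hx, mul_zero]
    · exact absurd hw (pt_zero_notMem h3
        (full_isUpperSet (erase_subset x t) (of_phi_ne_zero hx).2) w)
  rw [e1, zero_add, phi, pair_apply, sum_twoBlock_mul_bd (by omega) (by omega) le_rfl
    ⟨r - 1, by omega⟩ (shuf_empty_left _) (shuf_empty_right _)
    (fun U W h => by rw [card_of_shuf_ne_zero h, card_univ, Fintype.card_fin]) h2 hi,
    sum_eq_zero, mul_zero]
  intro t _
  by_cases ht : res R (zeroFull r n)ᶜ b t = 0
  · rw [ht, mul_zero]
  obtain ⟨⟨h3, -⟩, -⟩ := h2 t ht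
  obtain ⟨w, hw⟩ := h3.1 2 (by omega) (by omega)
  obtain ⟨x, hx⟩ := h3.1 (2 * r - 1) (by omega) (by omega)
  rw [coboundary_shuf_eq_zero (subset_univ _) (subset_univ _), zero_mul]
  · intro h
    have : w ∈ sec t 1 := h ▸ mem_univ w
    exact h3.2.1 1 le_rfl (by omega) w (by simpa using this) hw
  · intro h
    have : x ∈ sec t (2 * r) := h ▸ mem_univ x
    refine h3.2.1 (2 * r - 1) (by omega) (by omega) x hx ?_
    rw [show 2 * r - 1 + 1 = 2 * r by omega]
    simpa using this

theorem phi_res {P : Set (Finset (Vtx r n))} (h : cone r n ∩ full r n ⊆ P)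
    (c : Finset (Vtx r n) → R) : phi R r n (res R P c) = phi R r n c :=
  pair_res (fun _ hs => h (of_phi_ne_zero hs)) c

variable [NeZero n]

theorem card_le_of_mem_cone {s : Finset (Vtx r n)} (hr : 1 ≤ r) (hs : s ∈ cone r n) :
    (sec s 1).card + (sec s (2 * r)).card + 2 * r ≤ s.card + 2 := by
  have := card_ge hs {1, 2 * r} (by intro j; simp; omega)
  rw [sum_pair (by omega), card_pair (by omega)] at this
  omega

theorem card_le_of_mem_full {s : Finset (Vtx r n)} (hr : 1 ≤ r) (hs : s ∈ cone r n ∩ full r n) :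
    n + 2 * r ≤ s.card + 2 := by
  have := card_le_of_mem_cone hr hs.1
  have := le_card_add_card hs.2
  omega

theorem baseCell_mem_pathCells (hr : 2 ≤ r) {e : Fin n} (he : e ≠ 0) :
    baseCell r e ∈ pathCells r n := by
  refine ⟨(baseCell_mem hr he).1, ?_⟩
  rintro ⟨w, hw⟩
  exact pt_zero_notMem (baseCell_mem hr he).1 (baseCell_mem hr he).2 w hw

theorem phi_baseCell (hr : 2 ≤ r) {e : Fin n} (he : e ≠ 0) :
    phi R r n (Pi.single (baseCell r e) 1) = (-1) ^ (n - 1) := by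
  have hn := NeZero.pos n
  have hcol : col e (2 * r) = 0 := if_neg (by simp)
  rw [phi, pair_single, twoBlock_eq (baseCell_mem_pathCells hr he) (by rw [card_baseCell hr]; omega),
    sec_baseCell_one hr, sec_baseCell (by omega) le_rfl, hcol,
    shuf_eq ⟨e, by simpa using he⟩ (singleton_nonempty _) (by simp) (by ext; simp),
    sh_singleton_right, filter_true_of_mem (fun w hw => Fin.pos_iff_ne_zero.2 (ne_of_mem_erase hw)),
    card_erase_of_mem (mem_univ _), card_univ, Fintype.card_fin]

/-- On the full part the cycle is a multiple of `baseCell` up to boundaries. Since `phi` takes a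
unit value there, the multiple is zero, and the cycle can be pushed into the acyclic part outside
`full`. -/
theorem mem_bdry_cone_of_phi (hr : 2 ≤ r) (hn : 4 ≤ n) {i : ℕ} (hi : i + 2 = n + 2 * r)
    {c : Finset (Vtx r n) → R} (hc : c ∈ cyc R (cone r n) i) (h : phi R r n c = 0) :
    c ∈ bdry R (cone r n) i := by
  obtain ⟨e, he⟩ : ∃ e : Fin n, e ≠ 0 := ⟨⟨1, by omega⟩, by simp [Fin.ext_iff]⟩
  obtain ⟨a, h1, -⟩ := exists_smul_baseCell (i := i) hr he (by omega) (res_mem_cyc full_isUpperSet hc)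
  have ha : a = 0 := by
    obtain ⟨b, hb, hbe⟩ := h1
    have h2 := congrArg (phi R r n) hbe
    simp only [LinearMap.comp_apply] at h2
    rw [phi_res le_rfl, phi_bd (by omega) (chains_mono Set.inter_subset_left _ hb) (by omega),
      map_sub, map_smul, phi_baseCell hr he, phi_res Set.inter_subset_right, h, zero_sub, smul_eq_mul] at h2
    have h3 := congrArg (fun x => x * (-1) ^ (n - 1)) h2
    simp only [zero_mul, neg_mul, mul_assoc, neg_one_pow_mul_self, mul_one] at h3
    exact neg_eq_zero.1 h3.symm
  rw [ha, zero_smul, sub_zero] at h1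
  obtain ⟨c', hc', h2⟩ := exists_sub_mem_cyc_of_res cone_ordConnected hc h1
  have := add_mem h2 (bdry_lower_le full_isUpperSet (acyclicAt_cone_inter_compl_full (by omega) i hc'))
  simpa using this

theorem exists_phi_eq_one (hr : 2 ≤ r) (hn : 4 ≤ n) {i : ℕ} (hi : i + 2 = n + 2 * r) :
    ∃ c ∈ cyc R (cone r n) i, phi R r n c = 1 := by
  obtain ⟨e, he⟩ : ∃ e : Fin n, e ≠ 0 := ⟨⟨1, by omega⟩, by simp [Fin.ext_iff]⟩
  obtain ⟨i, rfl⟩ : ∃ k, i = k + 1 := ⟨i - 1, by omega⟩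
  set d : Finset (Vtx r n) → R := (-1 : R) ^ (n - 1) • Pi.single (baseCell r e) 1 with hd
  have h0 : d ∈ chains R (cone r n ∩ full r n) (i + 1) := by
    refine Submodule.smul_mem _ _ fun s hs => ?_
    have : s = baseCell r e := by
      by_contra h; exact hs (Pi.single_eq_of_ne h _)
    subst this
    exact ⟨baseCell_mem hr he, by rw [card_baseCell hr]; omega⟩
  have h1 : d ∈ cyc R (cone r n ∩ full r n) (i + 1) := by
    -- The base cell has the least cardinality possible in the full part, so it is a relative cycle
    -- there. It extends to the cone because the part outside `full` is acyclic.
    refine mem_cyc.2 ⟨h0, fun s hs => ?_⟩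
    by_contra h
    have := bd_card h0 h
    have := card_le_of_mem_full (by omega) hs
    omega
  obtain ⟨y, hy, h2⟩ := acyclicAt_cone_inter_compl_full (by omega) i
    (connecting_mem_cyc cone_ordConnected h1)
  refine ⟨d - y, sub_mem_cyc_of_connecting full_isUpperSet h1 hy h2, ?_⟩
  have : phi R r n y = 0 := by
    rw [← phi_res (P := full r n) Set.inter_subset_right, res_lower_eq_zero hy, map_zero]
  rw [map_sub, this, hd, map_smul, phi_baseCell hr he, smul_eq_mul, neg_one_pow_mul_self, sub_zero]

end

/-! ### Comparison of the classes of the path and of the cone. -/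

section

variable {R : Type} [CommRing R]
variable {r n : ℕ}

/-- The sum of the coefficients of the cells with given colours at two consecutive vertices. -/
def zeta (p : ℕ) (U W : Finset (Fin n)) : (Finset (Vtx r n) → R) →ₗ[R] R :=
  pair fun s => if sec s p = U ∧ sec s (p + 1) = W then 1 else 0

theorem sec_disjoint {s : Finset (Vtx r n)} (hs : s ∈ cone r n) {p : ℕ} (hp : 1 ≤ p)
    (hq : p + 1 ≤ 2 * r) : Disjoint (sec s p) (sec s (p + 1)) := by
  rw [disjoint_left]
  intro w h1 h2
  exact hs.2.1 p hp (by omega) w (by simpa using h1) (by simpa using h2)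

/-- Only the colour `y` is missing from the pair `(U₀, W₀)`, so a disjoint pair with this face
arises by adding `y` to one of the two sets. -/
theorem coboundary_indicator {U W U₀ W₀ : Finset (Fin n)} {y : Fin n} (hd : Disjoint U W)
    (hyU : y ∉ U₀) (hyW : y ∉ W₀) (hu : insert y (U₀ ∪ W₀) = univ) :
    coboundary (fun U W => if U = U₀ ∧ W = W₀ then (1 : R) else 0) U W =
      (-1) ^ (U₀.filter (· < y)).card * (if U = insert y U₀ ∧ W = W₀ then 1 else 0) +
      (-1) ^ (U₀.card + (W₀.filter (· < y)).card) *
        (if U = U₀ ∧ W = insert y W₀ then 1 else 0) := by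
  unfold coboundary
  beta_reduce
  have hy : ∀ w, w ∉ U₀ → w ∉ W₀ → w = y := fun w h1 h2 => by
    have := mem_univ w
    rw [← hu] at this
    simpa [h1, h2] using this
  congr 1
  · by_cases h : U = insert y U₀ ∧ W = W₀
    · obtain ⟨rfl, rfl⟩ := h
      rw [sum_eq_single y, erase_insert hyU, filter_insert, if_neg (lt_irrefl y), if_pos ⟨rfl, rfl⟩,
        if_pos ⟨rfl, rfl⟩]
      · intro w hw hwy
        rw [if_neg, mul_zero]
        rintro ⟨h, -⟩
        exact hwy (hy w (h ▸ notMem_erase w _) (disjoint_left.1 hd hw))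
      · intro h; exact absurd (mem_insert_self _ _) h
    · rw [if_neg h, mul_zero]
      refine sum_eq_zero fun w hw => ?_
      rw [if_neg, mul_zero]
      rintro ⟨h1, h2⟩
      have : w = y := hy w (h1 ▸ notMem_erase w _) (h2 ▸ disjoint_left.1 hd hw)
      exact h ⟨by rw [← h1, ← this, insert_erase hw], h2⟩
  · by_cases h : U = U₀ ∧ W = insert y W₀
    · obtain ⟨rfl, rfl⟩ := h
      rw [sum_eq_single y, erase_insert hyW, filter_insert, if_neg (lt_irrefl y), if_pos ⟨rfl, rfl⟩,
        if_pos ⟨rfl, rfl⟩, pow_add, mul_assoc]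
      · intro w hw hwy
        rw [if_neg, mul_zero]
        rintro ⟨-, h⟩
        exact hwy (hy w (disjoint_right.1 hd hw) (h ▸ notMem_erase w _))
      · intro h; exact absurd (mem_insert_self _ _) h
    · rw [if_neg h, mul_zero, sum_eq_zero, mul_zero]
      intro w hw
      rw [if_neg, mul_zero]
      rintro ⟨h1, h2⟩
      have : w = y := hy w (h1 ▸ disjoint_right.1 hd hw) (h2 ▸ notMem_erase w _)
      exact h ⟨h1, by rw [← h2, ← this, insert_erase hw]⟩

theorem zeta_rel {z : Finset (Vtx r n) → R} {i : ℕ} (hz : z ∈ cyc R (pathCells r n) i)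
    (hi : i + 2 = n + 2 * r) (hn : 1 ≤ n) {p : ℕ} (hp : 1 ≤ p) (hq : p + 1 ≤ 2 * r)
    {U W : Finset (Fin n)}
    {y : Fin n} (hyU : y ∉ U) (hyW : y ∉ W) (hU : U.Nonempty) (hW : W.Nonempty) (hd : Disjoint U W)
    (hu : insert y (U ∪ W) = univ) :
    (-1) ^ (U.filter (· < y)).card * zeta p (insert y U) W z +
      (-1) ^ (U.card + (W.filter (· < y)).card) * zeta p U (insert y W) z = 0 := by
  have hc : U.card + W.card = n - 1 := by
    have := congrArg card hu
    rw [card_insert_of_notMem (by simp [hyU, hyW]), card_union_of_disjoint hd, card_univ,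
      Fintype.card_fin] at this
    omega
  rw [← sum_coboundary_mul_eq_zero (F := fun A B => if A = U ∧ B = W then (1 : R) else 0)
    (e := n - 1) hp (lt_add_one p) hq (by simp) (fun B => if_neg fun h => hU.ne_empty h.1.symm)
    (fun B => if_neg fun h => hW.ne_empty h.2.symm) (fun A B h => ?_) hz (by omega)]
  · rw [zeta, zeta, pair_apply, pair_apply, mul_sum, mul_sum, ← sum_add_distrib]
    refine sum_congr rfl fun t _ => ?_
    by_cases ht : z t = 0
    · simp [ht]
    · rw [coboundary_indicator (sec_disjoint ((mem_cyc.1 hz).1 t ht).1.1 hp hq) hyU hyW hu]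
      ring
  · by_cases h1 : A = U ∧ B = W
    · rw [h1.1, h1.2, hc]
    · exact absurd (if_neg h1) h

/-- Moving one colour between complementary sets at consecutive vertices changes the coefficient sum
by a sign. With the factor `(-1)^|U|` and the shuffle sign, the sum is unchanged. -/
theorem zeta_insert {z : Finset (Vtx r n) → R} {i : ℕ} (hz : z ∈ cyc R (pathCells r n) i)
    (hi : i + 2 = n + 2 * r) (hn : 1 ≤ n) {p : ℕ} (hp : 1 ≤ p) (hq : p + 1 ≤ 2 * r)
    {U : Finset (Fin n)}
    {y : Fin n} (hyU : y ∉ U) (hU : U.Nonempty) (hW : insert y U ≠ univ) :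
    (-1) ^ (insert y U).card * sh R (insert y U) (insert y U)ᶜ * zeta p (insert y U) (insert y U)ᶜ z =
      (-1) ^ U.card * sh R U Uᶜ * zeta p U Uᶜ z := by
  have h1 : Uᶜ = insert y (insert y U)ᶜ := by
    ext w; simp only [mem_insert, mem_compl]
    by_cases h : w = y
    · simp [h, hyU]
    · simp [h]
  have hyW : y ∉ (insert y U)ᶜ := by simp
  have h2 := zeta_rel hz hi hn hp hq hyU hyW hU
    (by rw [nonempty_iff_ne_empty, ne_eq, compl_eq_empty_iff]; exact hW)
    (by rw [disjoint_left]; intro w hw; simp [hw])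
    (by rw [← union_insert, ← h1, union_compl])
  rw [← h1] at h2
  rw [show sh R U Uᶜ = sh R U (insert y (insert y U)ᶜ) by rw [← h1], sh_insert_right hyW,
    sh_insert_left hyU, card_insert_of_notMem hyU, pow_succ]
  rw [← card_lt_add_card_gt hyU] at h2 ⊢
  simp only [pow_add] at h2 ⊢
  have e2 := neg_one_pow_mul_self (R := R) ((insert y U)ᶜ.filter (· < y)).card
  generalize (-1 : R) ^ (U.filter (· < y)).card = a at *
  generalize (-1 : R) ^ ((insert y U)ᶜ.filter (· < y)).card = b at *
  generalize (-1 : R) ^ (U.filter (y < ·)).card = c at *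
  generalize sh R U (insert y U)ᶜ = s at *
  generalize zeta p (insert y U) (insert y U)ᶜ z = u at *
  generalize zeta p U Uᶜ z = v at *
  linear_combination (- c * s * b) * h2 + (a * c * c * s * v) * e2

theorem zeta_const {z : Finset (Vtx r n) → R} {i : ℕ} (hz : z ∈ cyc R (pathCells r n) i)
    (hi : i + 2 = n + 2 * r) (hn : 3 ≤ n) {p : ℕ} (hp : 1 ≤ p) (hq : p + 1 ≤ 2 * r) {x : Fin n}
    (U : Finset (Fin n)) (hU : U.Nonempty) (hU' : U ≠ univ) :
    (-1) ^ U.card * sh R U Uᶜ * zeta p U Uᶜ z =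
      (-1) ^ 1 * sh R {x} {x}ᶜ * zeta p {x} {x}ᶜ z := by
  induction U using Finset.induction_on with
  | empty => simp at hU
  | insert y U hy ih =>
    by_cases h : U.Nonempty
    · rw [zeta_insert hz hi (by omega) hp hq hy h hU', ih h]
      rintro rfl; simp at hy
    · rw [not_nonempty_iff_eq_empty] at h
      subst h
      rw [insert_empty_eq, card_singleton]
      by_cases hxy : x = y
      · rw [hxy]
      -- Two singletons are compared through their union, which is a proper subset because `n ≥ 3`.
      · have hne : (insert x {y} : Finset (Fin n)) ≠ univ := fun h => by
          have := congrArg card h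
          rw [card_pair hxy, card_univ, Fintype.card_fin] at this
          omega
        have h1 := zeta_insert hz hi (by omega) hp hq (U := {y}) (y := x) (by simpa using hxy)
          (singleton_nonempty _) hne
        have h2 := zeta_insert hz hi (by omega) hp hq (U := {x}) (y := y)
          (by simpa using fun h => hxy h.symm) (singleton_nonempty _) (by rwa [pair_comm])
        rw [pair_comm] at h2
        rw [card_singleton] at h1 h2
        rw [← h1, ← h2]

variable [NeZero n]

/-- The sum of the coefficients of the cells in which all colours but `0` occur at one vertex. -/
def alpha (p : ℕ) : (Finset (Vtx r n) → R) →ₗ[R] R :=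
  pair fun s => if sec s p = univ.erase 0 then 1 else 0

theorem eq_compl_of_disjoint {U W : Finset (Fin n)} (hU : U.Nonempty) (h : Disjoint U W)
    (hW : W = univ.erase 0) : U = {0} := by
  have : U ⊆ {0} := fun w hw => by
    have := disjoint_left.1 h hw
    rw [hW] at this
    simpa using this
  exact (subset_singleton_iff.1 this).resolve_left hU.ne_empty

theorem alpha_eq_zeta {z : Finset (Vtx r n) → R} {i : ℕ} (hz : z ∈ chains R (pathCells r n) i)
    {p : ℕ} (hp : 1 ≤ p) (hq : p + 1 ≤ 2 * r) :
    alpha p z = zeta p (univ.erase 0) {0} z := by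
  rw [alpha, zeta, pair_apply, pair_apply]
  refine sum_congr rfl fun t _ => ?_
  by_cases ht : z t = 0
  · simp [ht]
  have h := (hz t ht).1.1
  by_cases h1 : sec t p = univ.erase 0
  · rw [if_pos h1, if_pos ⟨h1, eq_compl_of_disjoint (sec_nonempty h (by omega) hq)
      (sec_disjoint h hp hq).symm h1⟩]
  · rw [if_neg h1, if_neg fun h => h1 h.1]

theorem alpha_succ_eq_zeta {z : Finset (Vtx r n) → R} {i : ℕ} (hz : z ∈ chains R (pathCells r n) i)
    {p : ℕ} (hp : 1 ≤ p) (hq : p + 1 ≤ 2 * r) :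
    alpha (p + 1) z = zeta p {0} (univ.erase 0) z := by
  rw [alpha, zeta, pair_apply, pair_apply]
  refine sum_congr rfl fun t _ => ?_
  by_cases ht : z t = 0
  · simp [ht]
  have h := (hz t ht).1.1
  by_cases h1 : sec t (p + 1) = univ.erase 0
  · rw [if_pos h1, if_pos ⟨eq_compl_of_disjoint (sec_nonempty h hp (by omega))
      (sec_disjoint h hp hq) h1, h1⟩]
  · rw [if_neg h1, if_neg fun h => h1 h.2]

/-- If a vertex has all nonzero colours, its neighbours have only `0`. So the two values of `alpha`
are coefficient sums for `(univ.erase 0, {0})` and `({0}, univ.erase 0)`; their normalising signs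
are `1` and `-1`. -/
theorem alpha_succ {z : Finset (Vtx r n) → R} {i : ℕ} (hz : z ∈ cyc R (pathCells r n) i)
    (hi : i + 2 = n + 2 * r) (hn : 3 ≤ n) {p : ℕ} (hp : 1 ≤ p) (hq : p + 1 ≤ 2 * r) :
    alpha (p + 1) z = -alpha p z := by
  rw [alpha_eq_zeta (mem_cyc.1 hz).1 hp hq, alpha_succ_eq_zeta (mem_cyc.1 hz).1 hp hq]
  have hc : (univ.erase (0 : Fin n)).card = n - 1 := by
    rw [card_erase_of_mem (mem_univ _), card_univ, Fintype.card_fin]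
  have h := zeta_const hz hi hn hp hq (x := 0) (univ.erase 0) (by rw [← card_pos, hc]; omega)
    (fun h => by simpa [h] using notMem_erase (0 : Fin n) univ)
  rw [hc, show (univ.erase (0 : Fin n))ᶜ = {0} by ext; simp,
    show ({0}ᶜ : Finset (Fin n)) = univ.erase 0 by ext; simp, sh_singleton_right, sh_singleton_left,
    filter_true_of_mem (fun w hw => Fin.pos_iff_ne_zero.2 (ne_of_mem_erase hw)), hc,
    neg_one_pow_mul_self, filter_false_of_mem (fun w _ => by simp)] at h
  rw [one_mul, card_empty, pow_zero, pow_one, mul_one, neg_one_mul] at h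
  rw [h, neg_neg]

theorem alpha_add_one {z : Finset (Vtx r n) → R} {i : ℕ} (hz : z ∈ cyc R (pathCells r n) i)
    (hi : i + 2 = n + 2 * r) (hn : 3 ≤ n) {p : ℕ} (hq : p + 1 ≤ 2 * r) :
    alpha (p + 1) z = (-1) ^ p * alpha 1 z := by
  induction p with
  | zero => simp
  | succ p ih => rw [alpha_succ hz hi hn (by omega) hq, ih (by omega), pow_succ]; ring

/-- A coboundary vanishes on cycles, so by `coboundary_shuf_erase` the value of `phi` equals `alpha
(2r) - (-1)^n alpha 1`. The sign of `alpha` alternates along the path, and `2r - 1` steps turn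
`alpha (2r)` into `-alpha 1`. -/
theorem phi_eq_alpha {z : Finset (Vtx r n) → R} {i : ℕ} (hz : z ∈ cyc R (pathCells r n) i)
    (hi : i + 2 = n + 2 * r) (hn : 3 ≤ n) (hr : 1 ≤ r) :
    phi R r n z = -(1 + (-1) ^ n) * alpha 1 z := by
  have hN : (univ.erase (0 : Fin n)).card = n - 1 := by
    rw [card_erase_of_mem (mem_univ _), card_univ, Fintype.card_fin]
  have h := sum_coboundary_mul_eq_zero (F := shuf R (univ.erase (0 : Fin n))) (e := n - 1) le_rfl
    (show 1 < 2 * r by omega) le_rfl ⟨r - 1, by omega⟩ (shuf_empty_left _) (shuf_empty_right _)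
    (fun U W h => by rw [card_of_shuf_ne_zero h, hN]) hz (by omega)
  have h2 : phi R r n z - alpha (2 * r) z + (-1) ^ n * alpha 1 z = 0 := by
    rw [← h, phi, alpha, alpha, pair_apply, pair_apply, pair_apply, mul_sum, ← sum_sub_distrib,
      ← sum_add_distrib]
    refine sum_congr rfl fun t _ => ?_
    by_cases ht : z t = 0
    · simp [ht]
    obtain ⟨h3, h4⟩ := (mem_cyc.1 hz).1 t ht
    have hU := sec_nonempty h3.1 le_rfl (by omega)
    have hW := sec_nonempty h3.1 (show 1 ≤ 2 * r by omega) le_rfl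
    have hle := card_le_of_mem_cone hr h3.1
    rw [twoBlock_eq h3 (by omega)]
    by_cases hc : (sec t 1).card + (sec t (2 * r)).card = n
    · rw [coboundary_shuf_erase hn hU hW hc]; ring
    -- In this degree the two colour sets have at most `n` elements together. If they have fewer,
    -- every term vanishes for reasons of size.
    · have e1 : shuf R univ (sec t 1) (sec t (2 * r)) = 0 := by
        by_contra h
        have := card_of_shuf_ne_zero h
        rw [card_univ, Fintype.card_fin] at this
        exact hc this
      have hU' := card_pos.2 hU
      have hW' := card_pos.2 hW
      have e2 : sec t 1 ≠ univ.erase 0 := fun h => by rw [h, hN] at hc hle; omega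
      have e3 : sec t (2 * r) ≠ univ.erase 0 := fun h => by rw [h, hN] at hc hle; omega
      have e4 : coboundary (shuf R (univ.erase 0)) (sec t 1) (sec t (2 * r)) = 0 := by
        by_contra h
        obtain ⟨x, hx, h⟩ | ⟨x, hx, h⟩ := of_coboundary_ne_zero h
        · have := card_of_shuf_ne_zero h
          rw [card_erase_of_mem hx, hN] at this
          omega
        · have := card_of_shuf_ne_zero h
          rw [card_erase_of_mem hx, hN] at this
          omega
      rw [e1, e4, if_neg e2, if_neg e3]; ring
  have h3 := alpha_add_one hz hi hn (p := 2 * r - 1) (by omega)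
  rw [show 2 * r - 1 + 1 = 2 * r by omega, (show Odd (2 * r - 1) from ⟨r - 1, by omega⟩).neg_one_pow]
    at h3
  linear_combination h2 + h3

end

/-! ### Functionals that detect homology, and connecting homomorphisms. -/

section

variable {T : Type} [LinearOrder T] [Fintype T] {R : Type} [CommRing R]
variable {P Q : Set (Finset T)} {i : ℕ}

theorem AcyclicAt.lower (hQ : IsUpperSet Q) (h1 : AcyclicAt R P i)
    (h2 : ∀ s ∈ P ∩ Q, s.card ≠ i + 1) : AcyclicAt R (P ∩ Qᶜ) i := by
  intro c hc
  obtain ⟨c', hc', h⟩ := exists_connecting hQ (mem_cyc.1 hc).1 (h1 (cyc_lower_le hQ hc))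
  have : c' = 0 := by
    ext s
    by_contra hs
    exact h2 s ((mem_cyc.1 hc').1 s hs).1 ((mem_cyc.1 hc').1 s hs).2
  rw [this, map_zero, map_zero, zero_sub] at h
  exact neg_mem_iff.1 h

theorem res_bd_res_bd_add (y : Finset T → R) {s : Finset T} (hs : s ∈ P ∩ Qᶜ) (hP : P.OrdConnected)
    {k : ℕ} (hy : y ∈ chains R P k) :
    bd R (res R (P ∩ Q) (bd R y)) s = -bd R (res R (P ∩ Qᶜ) (bd R y)) s := by
  have h := bd_res_bd hP hy hs.1
  have e : res R P (bd R y) = res R (P ∩ Q) (bd R y) + res R (P ∩ Qᶜ) (bd R y) := by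
    ext t
    by_cases ht : t ∈ P
    · by_cases htQ : t ∈ Q
      · simp [res_apply_mem _ ht, res_apply_mem (P := P ∩ Q) _ ⟨ht, htQ⟩,
          res_apply_notMem (P := P ∩ Qᶜ) _ fun h => h.2 htQ]
      · simp [res_apply_mem _ ht, res_apply_notMem (P := P ∩ Q) _ fun h => htQ h.2,
          res_apply_mem (P := P ∩ Qᶜ) _ ⟨ht, htQ⟩]
    · simp [res_apply_notMem _ ht, res_apply_notMem (P := P ∩ Q) _ fun h => ht h.1,
          res_apply_notMem (P := P ∩ Qᶜ) _ fun h => ht h.1]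
  rw [e, map_add, Pi.add_apply] at h
  exact eq_neg_of_add_eq_zero_left h

/-- The connecting homomorphism maps boundaries to boundaries. -/
theorem connecting_of_mem_bdry (hP : P.OrdConnected) {c : Finset T → R}
    (hc : c ∈ bdry R (P ∩ Q) (i + 1)) : res R (P ∩ Qᶜ) (bd R c) ∈ bdry R (P ∩ Qᶜ) i := by
  obtain ⟨b, hb, rfl⟩ := hc
  refine ⟨-res R (P ∩ Qᶜ) (bd R b), neg_mem (res_bd_mem_chains hb), ?_⟩
  ext s
  simp only [LinearMap.comp_apply]
  by_cases hs : s ∈ P ∩ Qᶜ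
  · rw [res_apply_mem _ hs, res_apply_mem _ hs,
      res_bd_res_bd_add b hs hP (chains_mono Set.inter_subset_left _ hb), map_neg]
    rfl
  · rw [res_apply_notMem _ hs, res_apply_notMem _ hs]

/-- The functional `α` induces an isomorphism from the homology of `P` to the coefficient ring. -/
structure Detects (P : Set (Finset T)) (i : ℕ) (α : (Finset T → R) →ₗ[R] R) : Prop where
  exists_eq_one : ∃ z ∈ cyc R P i, α z = 1
  mem_bdry : ∀ z ∈ cyc R P i, α z = 0 → z ∈ bdry R P i
  eq_zero : ∀ z ∈ bdry R P i, α z = 0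

/-- With `P` acyclic in both degrees the connecting homomorphism is an isomorphism, and a detecting
functional is transported along it. The factor `ε` is its own inverse and absorbs signs. -/
theorem Detects.upper (hP : P.OrdConnected) (hQ : IsUpperSet Q) {α β : (Finset T → R) →ₗ[R] R}
    {ε : R} (hε : ε * ε = 1) (h0 : AcyclicAt R P i) (h1 : AcyclicAt R P (i + 1))
    (hα : Detects (P ∩ Qᶜ) i α)
    (h : ∀ z ∈ chains R (P ∩ Q) (i + 1), α (res R (P ∩ Qᶜ) (bd R z)) = ε * β z) :
    Detects (P ∩ Q) (i + 1) β := by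
  refine ⟨?_, fun z hz hβ => ?_, fun z hz => ?_⟩
  · obtain ⟨a, ha, ha1⟩ := hα.exists_eq_one
    obtain ⟨c, hc, hca⟩ := exists_connecting hQ (mem_cyc.1 ha).1 (h0 (cyc_lower_le hQ ha))
    have := hα.eq_zero _ hca
    rw [map_sub, h c (mem_cyc.1 hc).1, ha1, sub_eq_zero] at this
    exact ⟨ε • c, Submodule.smul_mem _ _ hc, by rw [map_smul, smul_eq_mul, this]⟩
  · obtain ⟨y, hy, hy2⟩ := hα.mem_bdry _ (connecting_mem_cyc hP hz)
      (by rw [h z (mem_cyc.1 hz).1, hβ, mul_zero])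
    exact mem_bdry_of_connecting hQ h1 hz hy hy2
  · have := hα.eq_zero _ (connecting_of_mem_bdry hP hz)
    rw [h z (bdry_le_chains _ _ hz)] at this
    have := congrArg (ε * ·) this
    simpa [← mul_assoc, hε] using this

end

/-! ### The homology of the path, vertex by vertex. -/

section

variable {R : Type} [CommRing R]
variable {r n : ℕ}

variable (r n) in
/-- The cells of the path `1, …, j` which may be empty at `j`. -/
def half (j : ℕ) : Set (Finset (Vtx r n)) :=
  {s | (∀ i, 1 ≤ i → i < j → ∃ w, pt r i w ∈ s) ∧
    (∀ i, 1 ≤ i → i < 2 * r → ∀ w, pt r i w ∈ s → pt r (i + 1) w ∉ s) ∧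
    (∃ w, pt r 1 w ∉ s) ∧ ∀ i ≤ 2 * r, i = 0 ∨ j < i → ∀ w, pt r i w ∉ s}

variable (r n) in
/-- The cells which are nonempty at the vertex `j`. -/
def nonemptyAt (j : ℕ) : Set (Finset (Vtx r n)) := {s | ∃ w, pt r j w ∈ s}

theorem nonemptyAt_isUpperSet (j : ℕ) : IsUpperSet (nonemptyAt r n j) :=
  fun _ _ h hs => hs.imp fun _ hw => h hw

theorem half_ordConnected (j : ℕ) : (half r n j).OrdConnected :=
  ⟨fun _ hs _ hu _ ht => ⟨fun i h1 h2 => (hs.1 i h1 h2).imp fun _ h => ht.1 h,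
    fun i h1 h2 w h3 h4 => hu.2.1 i h1 h2 w (ht.2 h3) (ht.2 h4),
    hu.2.2.1.imp fun _ h h' => h (ht.2 h'), fun i h1 h2 w h => hu.2.2.2 i h1 h2 w (ht.2 h)⟩⟩

/-- The path up to `j + 1` with last vertex empty is the path up to `j` with last vertex nonempty.
Since `half r n (j + 1)` is acyclic, adding a vertex shifts homology by one degree. -/
theorem half_inter_compl {j : ℕ} (h1 : 1 ≤ j) (hj : j + 1 ≤ 2 * r) :
    half r n (j + 1) ∩ (nonemptyAt r n (j + 1))ᶜ = half r n j ∩ nonemptyAt r n j := by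
  ext s
  constructor
  · rintro ⟨⟨h2, h3, h4, h5⟩, h6⟩
    refine ⟨⟨fun i hi hi' => h2 i hi (by omega), h3, h4, fun i hi hi' w hw => ?_⟩,
      h2 j h1 (by omega)⟩
    by_cases hij : i = j + 1
    · subst hij; exact h6 ⟨w, hw⟩
    · exact h5 i hi (by omega) w hw
  · rintro ⟨⟨h2, h3, h4, h5⟩, h6⟩
    refine ⟨⟨fun i hi hi' => ?_, h3, h4, fun i hi hi' => h5 i hi (by omega)⟩, ?_⟩
    · by_cases hij : i = j
      · subst hij; exact h6
      · exact h2 i hi (by omega)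
    · rintro ⟨w, hw⟩; exact h5 (j + 1) hj (by omega) w hw

theorem half_inter_eq_pathCells (hr : 1 ≤ r) :
    half r n (2 * r) ∩ nonemptyAt r n (2 * r) = pathCells r n := by
  ext s
  constructor
  · rintro ⟨⟨h2, h3, h4, h5⟩, h6⟩
    refine ⟨⟨fun i hi hi' => ?_, h3, fun w hw => absurd hw (h5 0 (by omega) (by omega) w)⟩, ?_⟩
    · by_cases hij : i = 2 * r
      · subst hij; exact h6
      · exact h2 i hi (by omega)
    · rintro ⟨w, hw⟩; exact h5 0 (by omega) (by omega) w hw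
  · rintro ⟨⟨h2, h3, h4⟩, h5⟩
    refine ⟨⟨fun i hi hi' => h2 i hi (by omega), h3, ?_, fun i hi hi' w hw => ?_⟩,
      h2 (2 * r) (by omega) le_rfl⟩
    · obtain ⟨w, hw⟩ := h2 2 (by omega) (by omega)
      exact ⟨w, fun h => h3 1 le_rfl (by omega) w h hw⟩
    · obtain rfl : i = 0 := by omega
      exact h5 ⟨w, hw⟩

theorem acyclicAt_half {j : ℕ} (h1 : 1 ≤ j) (hj : j + 1 ≤ 2 * r) (i : ℕ) :
    AcyclicAt R (half r n (j + 1)) i := by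
  refine acyclicAt_of_toggle (half_ordConnected _) (j + 1) hj (fun s hs => ?_) i
  -- The vertex `j` never has all colours: for `j = 1` by definition of `half`, otherwise because `j
  -- - 1` is nonempty. A missing colour can be toggled at `j + 1`, which may be empty.
  have hw : ∃ w, pt r j w ∉ s := by
    by_cases h : j = 1
    · subst h; exact hs.2.2.1
    · obtain ⟨w, hw⟩ := hs.1 (j - 1) (by omega) (by omega)
      have := hs.2.1 (j - 1) (by omega) (by omega) w hw
      rw [show j - 1 + 1 = j by omega] at this
      exact ⟨w, this⟩
  obtain ⟨w, hw⟩ := hw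
  refine ⟨w, fun t ht hts => ?_⟩
  have hwt : pt r j w ∉ t := by rw [hts j (by omega) (by omega)]; exact hw
  obtain ⟨h2, h3, ⟨y, hy⟩, h5⟩ := ht
  refine ⟨⟨fun i hi hi' => (h2 i hi hi').imp fun _ h => mem_insert_of_mem h, fun i hi hi' x => ?_,
    ⟨y, ?_⟩, fun i hi hi' x => ?_⟩, ⟨fun i hi hi' => (h2 i hi hi').imp fun x h => ?_,
    fun i hi hi' x h6 h7 => h3 i hi hi' x (mem_of_mem_erase h6) (mem_of_mem_erase h7),
    ⟨y, fun h => hy (mem_of_mem_erase h)⟩, fun i hi hi' x h => h5 i hi hi' x (mem_of_mem_erase h)⟩⟩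
  · simp (disch := omega) only [pt_mem_insert]
    rintro (⟨rfl, rfl⟩ | h6) (⟨h7, h8⟩ | h7)
    · omega
    · exact h5 (j + 1 + 1) (by omega) (by omega) _ h7
    · obtain rfl : i = j := by omega
      exact hwt (h8 ▸ h6)
    · exact h3 i hi hi' x h6 h7
  · simp (disch := omega) only [pt_mem_insert]
    rintro (⟨h, -⟩ | h)
    · omega
    · exact hy h
  · simp (disch := omega) only [pt_mem_insert]
    rintro (⟨rfl, -⟩ | h)
    · omega
    · exact h5 i hi hi' x h
  · simp (disch := omega) only [pt_mem_erase]
    exact ⟨by omega, h⟩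

variable (r n) in
/-- The simplex on the colours of the vertex `1`. -/
def simplexOne : Set (Finset (Vtx r n)) := {s | ∀ i ≤ 2 * r, i ≠ 1 → ∀ w, pt r i w ∉ s}

variable (r n) in
/-- The cells with all colours at the vertex `1`. -/
def fullOne : Set (Finset (Vtx r n)) := {s | ∀ w, pt r 1 w ∈ s}

theorem fullOne_isUpperSet : IsUpperSet (fullOne r n) := fun _ _ h hs w => h (hs w)

theorem simplexOne_inter_compl : simplexOne r n ∩ (fullOne r n)ᶜ = half r n 1 := by
  ext s
  constructor
  · rintro ⟨h1, h2⟩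
    refine ⟨fun i hi hi' => by omega, fun i hi hi' w hw => h1 (i + 1) (by omega) (by omega) w,
      not_forall.1 h2, fun i hi hi' => h1 i hi (by omega)⟩
  · rintro ⟨-, -, h1, h2⟩
    exact ⟨fun i hi hi' => h2 i hi (by omega), not_forall.2 h1⟩

theorem acyclicAt_simplexOne [NeZero n] (hr : 1 ≤ r) (i : ℕ) : AcyclicAt R (simplexOne r n) i := by
  refine acyclicAt_of_cone (P := simplexOne r n) (pt r 1 0) (fun s hs => ⟨fun i hi hi' w => ?_,
    fun i hi hi' w h => hs i hi hi' w (mem_of_mem_erase h)⟩) i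
  simp (disch := omega) only [pt_mem_insert]
  rintro (⟨h, -⟩ | h)
  · exact hi' h
  · exact hs i hi hi' w h

theorem card_of_simplexOne (hr : 1 ≤ r) {s : Finset (Vtx r n)} (hs : s ∈ simplexOne r n) :
    s.card = (sec s 1).card := by
  rw [card_eq_sum_sec, sum_eq_single 1]
  · intro j hj h1
    rw [card_eq_zero]
    ext w
    simpa using hs j (by simp at hj; omega) h1 w
  · intro h; simp at h; omega

/-- This family is the augmented boundary of the simplex of colours at the vertex `1`; only removing
the top simplex creates homology. -/
theorem acyclicAt_half_one [NeZero n] (hr : 1 ≤ r) {i : ℕ} (hi : i + 1 ≠ n) :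
    AcyclicAt R (half r n 1) i := by
  rw [← simplexOne_inter_compl]
  refine AcyclicAt.lower fullOne_isUpperSet (acyclicAt_simplexOne hr i) fun s hs h => hi ?_
  rw [← h, card_of_simplexOne hr hs.1]
  have : sec s 1 = univ := by ext w; simpa using hs.2 w
  rw [this, card_univ, Fintype.card_fin]

theorem eq_empty_of_half_one {s : Finset (Vtx r n)}
    (hs : s ∈ half r n 1 ∩ (nonemptyAt r n 1)ᶜ) : s = ∅ := by
  rw [eq_empty_iff_forall_notMem]
  intro x hx
  obtain ⟨j, hj, w, rfl⟩ := exists_pt x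
  by_cases h : j = 1
  · subst h; exact hs.2 ⟨w, hx⟩
  · exact hs.1.2.2.2 j hj (by omega) w hx

/-- The homology of the path is that of the boundary of a simplex. Starting in cardinality `i + 1 ≥
2` avoids the class caused by the empty set. -/
theorem acyclicAt_half_inter_nonemptyAt [NeZero n] {i : ℕ} (h1 : 1 ≤ i)
    (hi : i + 2 ≠ n) {j : ℕ} (hj : j + 1 ≤ 2 * r) :
    AcyclicAt R (half r n (j + 1) ∩ nonemptyAt r n (j + 1)) (i + 1 + j) := by
  induction j with
  | zero =>
    refine AcyclicAt.upper (half_ordConnected 1) (nonemptyAt_isUpperSet 1)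
      (acyclicAt_half_one (by omega) (by omega)) (acyclicAt_of_card fun s hs h => ?_)
    rw [eq_empty_of_half_one hs, card_empty] at h
    omega
  | succ j ih =>
    refine AcyclicAt.upper (half_ordConnected _) (nonemptyAt_isUpperSet _)
      (acyclicAt_half (by omega) hj _) ?_
    rw [half_inter_compl (by omega) hj]
    exact ih (by omega)

theorem acyclicAt_pathCells [NeZero n] (hr : 1 ≤ r) {i : ℕ} (h1 : 2 * r < i)
    (hi : i + 2 ≠ n + 2 * r) : AcyclicAt R (pathCells r n) i := by
  rw [← half_inter_eq_pathCells hr]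
  have := acyclicAt_half_inter_nonemptyAt (R := R) (n := n) (i := i - 2 * r) (j := 2 * r - 1)
    (r := r) (by omega) (by omega) (by omega)
  rwa [show 2 * r - 1 + 1 = 2 * r by omega, show i - 2 * r + 1 + (2 * r - 1) = i by omega] at this

/-- The functional which evaluates `ω` at the colours of the vertex `1`. -/
def weight (ω : Finset (Fin n) → R) : (Finset (Vtx r n) → R) →ₗ[R] R := pair fun s => ω (sec s 1)

theorem card_of_half {j : ℕ} (hj : j ≤ 2 * r) {s : Finset (Vtx r n)} (hs : s ∈ half r n j) :
    s.card = ∑ i ∈ Ico 1 (j + 1), (sec s i).card := by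
  rw [card_eq_sum_sec]
  symm
  refine sum_subset (fun i hi => by simp at hi ⊢; omega) fun i hi hi' => ?_
  rw [card_eq_zero]
  ext w
  simp at hi hi'
  simpa using hs.2.2.2 i (by omega) (by omega) w

/-- Where `ω` does not vanish, the vertex `1` has `e` colours, and the cardinality `e + j` leaves
one colour for each later vertex. Only deleting the colour at `j + 1` leads to the shorter path; it
is the last element, so its sign depends only on the cardinality. -/
theorem weight_connecting {j e : ℕ} (h1 : 1 ≤ j) (hj : j + 1 ≤ 2 * r) {ω : Finset (Fin n) → R}
    (hω : ∀ U, ω U ≠ 0 → U.card = e) {z : Finset (Vtx r n) → R}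
    (hz : z ∈ chains R (half r n (j + 1) ∩ nonemptyAt r n (j + 1)) (e + j)) :
    weight ω (res R (half r n j ∩ nonemptyAt r n j) (bd R z)) = (-1) ^ (e + j - 1) * weight ω z := by
  classical
  have e1 : weight ω (res R (half r n j ∩ nonemptyAt r n j) (bd R z)) =
      pair (fun s => if s ∈ half r n j ∩ nonemptyAt r n j then ω (sec s 1) else 0) (bd R z) := by
    rw [weight, pair_apply, pair_apply]
    refine sum_congr rfl fun s _ => ?_
    by_cases hs : s ∈ half r n j ∩ nonemptyAt r n j
    · rw [res_apply_mem _ hs, if_pos hs]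
    · rw [res_apply_notMem _ hs, if_neg hs, zero_mul, mul_zero]
  rw [e1, pair_bd, weight, pair_apply, mul_sum]
  refine sum_congr rfl fun t _ => ?_
  by_cases ht : z t = 0
  · simp [ht]
  obtain ⟨⟨ht1, x, hx⟩, ht2⟩ := hz t ht
  rw [← mul_assoc]
  congr 1
  have hlow : ∀ y ∈ t, t.erase y ∈ half r n j ∩ nonemptyAt r n j → y = pt r (j + 1) x := by
    intro y hy h
    by_contra hne
    exact h.1.2.2.2 (j + 1) hj (by omega) x (mem_erase.2 ⟨Ne.symm hne, hx⟩)
  have hsec : sec (t.erase (pt r (j + 1) x)) 1 = sec t 1 := by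
    rw [sec_erase hj x t (by omega), if_neg (by omega)]
  rw [sum_eq_single (pt r (j + 1) x) (fun y hy hne => by rw [if_neg fun h => hne (hlow y hy h), mul_zero])
    fun h => absurd hx h, hsec]
  by_cases h0 : ω (sec t 1) = 0
  · simp [h0]
  have hc := card_of_half hj ht1
  rw [sum_eq_sum_Ico_succ_bot (by omega), hω _ h0, sum_Ico_succ_top (by omega), ht2] at hc
  have h2 : ∑ i ∈ Ico (1 + 1) (j + 1), 1 ≤ ∑ i ∈ Ico (1 + 1) (j + 1), (sec t i).card :=
    sum_le_sum fun i hi => by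
      simp at hi
      obtain ⟨w, hw⟩ := ht1.1 i (by omega) (by omega)
      exact card_pos.2 ⟨w, by simpa using hw⟩
  have h3 : x ∈ sec t (j + 1) := by simpa using hx
  have h4 := card_pos.2 ⟨x, h3⟩
  simp only [sum_const, Nat.card_Ico, smul_eq_mul, mul_one] at h2
  have h5 : (sec t (j + 1)).card = 1 := by omega
  obtain ⟨x', hx'⟩ := card_eq_one.1 h5
  have hall : ∀ w, pt r (j + 1) w ∈ t → w = x := by
    intro w hw
    have h6 : w ∈ sec t (j + 1) := by simpa using hw
    rw [hx', mem_singleton] at h6 h3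
    rw [h6, h3]
  have hmem : t.erase (pt r (j + 1) x) ∈ half r n j ∩ nonemptyAt r n j := by
    rw [← half_inter_compl h1 hj]
    refine ⟨⟨fun i hi hi' => (ht1.1 i hi hi').imp fun w h => ?_,
      fun i hi hi' w h7 h8 => ht1.2.1 i hi hi' w (mem_of_mem_erase h7) (mem_of_mem_erase h8),
      ht1.2.2.1.imp fun w h h' => h (mem_of_mem_erase h'),
      fun i hi hi' w h => ht1.2.2.2 i hi hi' w (mem_of_mem_erase h)⟩, ?_⟩
    · simp (disch := omega) only [pt_mem_erase]
      exact ⟨by omega, h⟩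
    · rintro ⟨w, hw⟩
      simp (disch := omega) only [pt_mem_erase] at hw
      exact hw.1 ⟨trivial, hall w hw.2⟩
  rw [if_pos hmem, sg, filter_true_of_mem, card_erase_of_mem hx, ht2]
  intro y hy
  obtain ⟨i, hi, w, rfl⟩ := exists_pt y
  rw [pt_lt_pt hi hj]
  rw [pt_mem_erase hi hj] at hy
  by_contra hlt
  by_cases hij : i = j + 1
  · subst hij; exact hy.1 ⟨rfl, hall w hy.2⟩
  · exact ht1.2.2.2 i hi (by omega) w hy.2

theorem detects_half {e : ℕ} {ω : Finset (Fin n) → R} (hω : ∀ U, ω U ≠ 0 → U.card = e)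
    (h : Detects (half r n 1 ∩ nonemptyAt r n 1) e (weight ω)) {j : ℕ} (hj : j + 1 ≤ 2 * r) :
    Detects (half r n (j + 1) ∩ nonemptyAt r n (j + 1)) (e + j) (weight ω) := by
  induction j with
  | zero => exact h
  | succ j ih =>
    rw [← add_assoc e]
    refine Detects.upper (half_ordConnected _) (nonemptyAt_isUpperSet _)
      (neg_one_pow_mul_self (e + j)) (acyclicAt_half (by omega) hj _)
      (acyclicAt_half (by omega) hj _) (α := weight ω) ?_ fun z hz => ?_
    · rw [half_inter_compl (by omega) hj]
      exact ih (by omega)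
    · rw [half_inter_compl (by omega) hj, weight_connecting (by omega) hj hω hz]
      congr 2

theorem detects_pathCells (hr : 1 ≤ r) {e : ℕ} {ω : Finset (Fin n) → R}
    (hω : ∀ U, ω U ≠ 0 → U.card = e)
    (h : Detects (half r n 1 ∩ nonemptyAt r n 1) e (weight ω)) {i : ℕ} (hi : i + 1 = e + 2 * r) :
    Detects (pathCells r n) i (weight ω) := by
  rw [← half_inter_eq_pathCells hr]
  have := detects_half hω h (j := 2 * r - 1) (by omega)
  rwa [show 2 * r - 1 + 1 = 2 * r by omega, show e + (2 * r - 1) = i by omega] at this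

/-- The class is the boundary of the top simplex. The functional reads its coefficient at the face
opposite to `0`, which has sign `1` as `0` is the least vertex. -/
theorem detects_half_one_top [NeZero n] (hr : 1 ≤ r) {m : ℕ} (h1m : 1 ≤ m) (hm : m + 2 = n) :
    Detects (half r n 1 ∩ nonemptyAt r n 1) (m + 1)
      (weight (fun U => if U = univ.erase 0 then (1 : R) else 0)) := by
  set full1 : Finset (Vtx r n) := univ.filter fun x => (ofLex x).1.val = 1 with hfull
  have hmem : ∀ j ≤ 2 * r, ∀ w, pt r j w ∈ full1 ↔ j = 1 := fun j hj w => by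
    simp [hfull, pt, Nat.mod_eq_of_lt (show j < 2 * r + 1 by omega)]
  have hS : full1 ∈ simplexOne r n := fun j hj h1 w => by rw [hmem j hj]; exact h1
  have hcard : full1.card = n := by
    rw [card_of_simplexOne hr hS, show sec full1 1 = univ by ext w; simp [hmem 1 (by omega)],
      card_univ, Fintype.card_fin]
  have hsingle : Pi.single full1 1 ∈ chains R (simplexOne r n) (m + 1 + 1) := by
    intro s hs
    have : s = full1 := by
      by_contra h; exact hs (Pi.single_eq_of_ne h _)
    rw [this]; exact ⟨hS, hcard.trans hm.symm⟩
  have hlt : ∀ s ∈ half r n 1 ∩ nonemptyAt r n 1, s.card < n := by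
    intro s hs
    have h1 := hs.1
    rw [← simplexOne_inter_compl] at h1
    rw [card_of_simplexOne hr h1.1]
    obtain ⟨w, hw⟩ := hs.1.2.2.1
    have := card_lt_univ_of_notMem (s := sec s 1) (x := w) (by simpa using hw)
    rwa [Fintype.card_fin] at this
  have hweight : ∀ b ∈ chains R (simplexOne r n) (m + 1 + 1),
      weight (fun U => if U = univ.erase 0 then (1 : R) else 0)
        (res R (half r n 1 ∩ nonemptyAt r n 1) (bd R b)) = b full1 := by
    intro b hb
    have hfe : full1.erase (pt r 1 0) ∈ half r n 1 ∩ nonemptyAt r n 1 := by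
      rw [← simplexOne_inter_compl]
      refine ⟨⟨fun i hi hi' w h => hS i hi hi' w (mem_of_mem_erase h), fun h => ?_⟩,
        ⟨⟨1, by omega⟩, ?_⟩⟩
      · exact notMem_erase _ _ (h 0)
      · simp (disch := omega) only [pt_mem_erase, hmem]
        simp [Fin.ext_iff]
    have hsec : sec (full1.erase (pt r 1 0)) 1 = univ.erase 0 := by
      ext w; simp (disch := omega) only [mem_sec, pt_mem_erase, hmem]; simp
    rw [weight, pair_apply, sum_eq_single (full1.erase (pt r 1 0)), res_apply_mem _ hfe, bd_apply,
      sum_eq_single (pt r 1 0), insert_erase ((hmem 1 (by omega) 0).2 rfl), if_pos hsec, sg,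
      filter_false_of_mem, card_empty, pow_zero, one_mul, one_mul]
    · intro x hx hlt
      obtain ⟨j, hj, w, rfl⟩ := exists_pt x
      rw [pt_lt_pt hj (by omega)] at hlt
      rw [pt_mem_erase hj (by omega), hmem j hj] at hx
      have := hx.2
      subst this
      simp at hlt
    · intro x hx hne
      obtain ⟨j, hj, w, rfl⟩ := exists_pt x
      rw [chains_apply_of_notMem hb, mul_zero]
      intro h
      rw [mem_compl, pt_mem_erase hj (by omega), hmem j hj] at hx
      by_cases h1 : j = 1
      · subst h1
        exact hx ⟨fun h => hne (by rw [h.2]), rfl⟩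
      · exact h j hj h1 w (mem_insert_self _ _)
    · intro h
      exact absurd (mem_compl.2 (notMem_erase _ _)) h
    · intro s _ hs
      by_cases h1 : sec s 1 = univ.erase 0
      · rw [if_pos h1, res_apply_notMem, mul_zero]
        intro h
        apply hs
        ext x
        obtain ⟨j, hj, w, rfl⟩ := exists_pt x
        simp (disch := omega) only [pt_mem_erase, hmem]
        by_cases hj1 : j = 1
        · subst hj1
          rw [← mem_sec, h1]; simp
        · simp only [hj1, and_false, iff_false]
          exact h.1.2.2.2 j hj (by omega) w
      · rw [if_neg h1, zero_mul]
    · simp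
  have hsub : half r n 1 ∩ nonemptyAt r n 1 ⊆ simplexOne r n := fun s hs => by
    have h1 := hs.1
    rw [← simplexOne_inter_compl] at h1
    exact h1.1
  have hoc : (simplexOne r n).OrdConnected :=
    ⟨fun _ _ _ hu _ ht i hi hi' w h => hu i hi hi' w (ht.2 h)⟩
  have hcoef : ∀ b ∈ chains R (simplexOne r n) (m + 1 + 1), b full1 = 0 → b = 0 := by
    intro b hb h
    ext s
    by_contra hs
    have h1 := hb s hs
    have : s = full1 := eq_of_subset_of_card_le (fun x hx => by
      obtain ⟨j, hj, w, rfl⟩ := exists_pt x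
      rw [hmem j hj]
      by_contra h2
      exact h1.1 j hj h2 w hx) (by rw [h1.2, hcard, ← hm])
    rw [this] at hs
    exact hs h
  have hcyc : ∀ s ∈ simplexOne r n, 1 ≤ s.card → s.card < n → s ∈ half r n 1 ∩ nonemptyAt r n 1 := by
    intro s hs hc hc2
    have hc' := card_of_simplexOne hr hs
    refine ⟨?_, ?_⟩
    · rw [← simplexOne_inter_compl]
      refine ⟨hs, fun h => ?_⟩
      have : sec s 1 = univ := by ext w; simpa using h w
      rw [this, card_univ, Fintype.card_fin] at hc'
      omega
    · obtain ⟨w, hw⟩ := card_pos.1 (show 0 < (sec s 1).card by omega)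
      exact ⟨w, by simpa using hw⟩
  have hres : ∀ b ∈ chains R (simplexOne r n) (m + 1 + 1), res R (simplexOne r n) (bd R b) =
      res R (half r n 1 ∩ nonemptyAt r n 1) (bd R b) := by
    intro b hb
    ext s
    by_cases h2 : s ∈ simplexOne r n
    · by_cases h3 : s ∈ half r n 1 ∩ nonemptyAt r n 1
      · rw [res_apply_mem _ h2, res_apply_mem _ h3]
      · rw [res_apply_mem _ h2, res_apply_notMem _ h3]
        by_contra h1
        have := bd_card hb h1
        exact h3 (hcyc s h2 (by omega) (by omega))
    · rw [res_apply_notMem _ h2, res_apply_notMem _ fun h => h2 (hsub h)]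
  refine ⟨⟨res R (simplexOne r n) (bd R (Pi.single full1 1)), ?_, ?_⟩, fun z hz h => ?_, ?_⟩
  · refine mem_cyc.2 ⟨?_, fun s hs => bd_res_bd hoc hsingle (hsub hs)⟩
    rw [hres _ hsingle]
    exact res_bd_mem_chains hsingle
  · rw [hres _ hsingle, hweight _ hsingle, Pi.single_eq_same]
  -- The cycle bounds in the full simplex, where the filling is a multiple of the only set of
  -- cardinality `n`; the functional is that multiple.
  · obtain ⟨hz1, hz2⟩ := mem_cyc.1 hz
    obtain ⟨b, hb, rfl⟩ := acyclicAt_simplexOne hr (m + 1) (mem_cyc.2 ⟨chains_mono hsub _ hz1,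
      fun s hs => by
        by_contra h1
        have := bd_card hz1 h1
        exact h1 (hz2 s (hcyc s hs (by omega) (by omega)))⟩)
    simp only [LinearMap.comp_apply] at h ⊢
    rw [hres b hb, hweight b hb] at h
    rw [hcoef b hb h, map_zero, map_zero]
    exact zero_mem _
  · rintro _ ⟨b, hb, rfl⟩
    have : b = 0 := by
      ext s
      by_contra hs
      have := hlt s (hb s hs).1
      have := (hb s hs).2
      omega
    rw [this, map_zero, map_zero]

/-- The connecting homomorphism to the empty set is the augmentation, that is the sum of the
coefficients of all points. -/
theorem detects_half_one_bot [NeZero n] (hr : 1 ≤ r) (hn : 3 ≤ n) :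
    Detects (half r n 1 ∩ nonemptyAt r n 1) 1
      (weight (fun U => if U.card = 1 then (1 : R) else 0)) := by
  have hempty : (∅ : Finset (Vtx r n)) ∈ half r n 1 ∩ (nonemptyAt r n 1)ᶜ := by
    refine ⟨⟨fun i hi hi' => by omega, fun i _ _ w h => ?_, ⟨0, ?_⟩, fun i _ _ w => ?_⟩, ?_⟩
    · simp at h
    · simp
    · simp
    · rintro ⟨w, hw⟩; simp at hw
  refine Detects.upper (half_ordConnected 1) (nonemptyAt_isUpperSet 1) (one_mul (1 : R))
    (acyclicAt_half_one hr (by omega)) (acyclicAt_half_one hr (by omega))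
    (α := LinearMap.proj ∅) ⟨⟨Pi.single ∅ 1, ?_, ?_⟩, fun z hz h => ?_, ?_⟩ fun z hz => ?_
  · refine mem_cyc.2 ⟨fun s hs => ?_, fun s hs => ?_⟩
    · have : s = ∅ := by
        by_contra h; exact hs (Pi.single_eq_of_ne h _)
      rw [this]; exact ⟨hempty, card_empty⟩
    · rw [bd_apply]
      refine sum_eq_zero fun x _ => ?_
      rw [Pi.single_eq_of_ne (insert_ne_empty x s), mul_zero]
  · simp
  · have : z = 0 := by
      ext s
      by_contra hs
      rw [eq_empty_of_half_one ((mem_cyc.1 hz).1 s hs).1] at hs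
      exact hs h
    rw [this]; exact zero_mem _
  · rintro _ ⟨b, hb, rfl⟩
    have : b = 0 := by
      ext s
      by_contra hs
      have h1 := (hb s hs).2
      rw [eq_empty_of_half_one (hb s hs).1] at h1
      simp at h1
    rw [this, map_zero, map_zero]
  · rw [LinearMap.proj_apply, res_apply_mem _ hempty, bd_apply, one_mul, weight, pair_apply,
      compl_empty]
    have h1 : ∀ x : Vtx r n, sg R x ∅ * z (insert x ∅) = z {x} := by
      intro x; simp [sg]
    rw [sum_congr rfl fun x _ => h1 x]
    symm
    rw [← sum_subset (subset_univ (univ.map ⟨fun x : Vtx r n => ({x} : Finset (Vtx r n)),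
      singleton_injective⟩)), sum_map]
    · refine sum_congr rfl fun x _ => ?_
      simp only [Function.Embedding.coeFn_mk]
      by_cases hx : z {x} = 0
      · rw [hx, mul_zero]
      · have h2 := (hz _ hx).1.1
        rw [← simplexOne_inter_compl] at h2
        have h3 := card_of_simplexOne hr h2.1
        rw [card_singleton] at h3
        rw [if_pos h3.symm, one_mul]
    · intro s _ hs
      by_cases h : z s = 0
      · rw [h, mul_zero]
      · obtain ⟨x, rfl⟩ := card_eq_one.1 (hz s h).2
        simp at hs

end

/-! ### The homology of the cycle from the cone and the path. -/

section

variable {R : Type} [CommRing R]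
variable {r n : ℕ} [NeZero n]

variable (r n) in
/-- The cells of the cycle. -/
def cycleCells : Set (Finset (Vtx r n)) := cone r n ∩ zeroFull r n

theorem acyclicAt_cone' (hr : 2 ≤ r) (hn : 2 ≤ n) {i : ℕ}
    (hi : i + 5 < 2 * n + 2 * r) (hne : i + 2 ≠ n + 2 * r) : AcyclicAt R (cone r n) i :=
  acyclicAt_cone (e := ⟨1, by omega⟩) hr (by simp [Fin.ext_iff]) hi (by omega)

theorem acyclicAt_cycleCells (hr : 2 ≤ r) {i : ℕ} (h1 : 2 * r + 1 < i)
    (hi : i + 2 < n + 2 * r) : AcyclicAt R (cycleCells r n) i := by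
  obtain ⟨i, rfl⟩ : ∃ j, i = j + 1 := ⟨i - 1, by omega⟩
  exact AcyclicAt.upper cone_ordConnected zeroFull_isUpperSet
    (acyclicAt_cone' hr (by omega) (by omega) (by omega))
    (acyclicAt_pathCells (by omega) (by omega) (by omega))

theorem exists_detects_cycleCells (hr : 2 ≤ r) (hn : 4 ≤ n) {i : ℕ} (hi : i = 2 * r + 1) :
    ∃ β : (Finset (Vtx r n) → R) →ₗ[R] R, Detects (cycleCells r n) i β := by
  subst hi
  refine ⟨_, Detects.upper (i := 2 * r) cone_ordConnected zeroFull_isUpperSet (one_mul (1 : R))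
    (acyclicAt_cone' hr (by omega) (by omega) (by omega))
    (acyclicAt_cone' hr (by omega) (by omega) (by omega))
    (detects_pathCells (by omega) (e := 1) (fun U h => ?_)
      (detects_half_one_bot (by omega) (by omega)) (by omega))
    (β := weight (fun U => if U.card = 1 then (1 : R) else 0) ∘ₗ res R (pathCells r n) ∘ₗ bd R)
    fun z _ => (one_mul _).symm⟩
  by_contra h1
  exact h (if_neg h1)

theorem detects_alpha (hr : 1 ≤ r) (hn : 3 ≤ n) {i : ℕ} (hi : i + 2 = n + 2 * r) :
    Detects (pathCells r n) i (alpha 1 : (Finset (Vtx r n) → R) →ₗ[R] R) := by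
  have h := detects_half_one_top (R := R) (n := n) hr (m := n - 2) (by omega) (by omega)
  refine detects_pathCells hr (fun U hU => ?_) h (by omega)
  have : U = univ.erase 0 := by
    by_contra h1
    exact hU (if_neg h1)
  rw [this, card_erase_of_mem (mem_univ _), card_univ, Fintype.card_fin]
  omega

/-- The homology above the first nonzero degree. -/
theorem exists_top (hr : 2 ≤ r) (hn : 5 ≤ n) {i : ℕ} (hi : i + 1 = n + 2 * r) :
    ∃ γ : (Finset (Vtx r n) → R) →ₗ[R] R,
      (∀ z ∈ cyc R (cycleCells r n) i, γ z = 0 ↔ z ∈ bdry R (cycleCells r n) i) ∧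
      (∀ z ∈ cyc R (cycleCells r n) i, (1 + (-1) ^ n) * γ z = 0) ∧
      ∀ a : R, (1 + (-1) ^ n) * a = 0 → ∃ z ∈ cyc R (cycleCells r n) i, γ z = a := by
  obtain ⟨i, rfl⟩ : ∃ j, i = j + 1 := ⟨i - 1, by omega⟩
  have hα := detects_alpha (R := R) (r := r) (n := n) (i := i) (by omega) (by omega) (by omega)
  -- The functional is `alpha 1` after the connecting homomorphism. Its image consists of the values
  -- whose class dies in the cone, which by `phi_eq_alpha` means annihilation by `1 + (-1)^n`.
  refine ⟨alpha 1 ∘ₗ res R (pathCells r n) ∘ₗ bd R, fun z hz => ⟨fun h => ?_, fun h => ?_⟩,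
    fun z hz => ?_, fun a ha => ?_⟩
  · obtain ⟨y, hy, hy2⟩ := hα.mem_bdry _ (connecting_mem_cyc cone_ordConnected hz) h
    -- The cone is needed to be acyclic in cardinality `n + 2r - 1`, which lies in the range `i + 5
    -- < 2n + 2r` exactly when `n ≥ 5`.
    exact mem_bdry_of_connecting zeroFull_isUpperSet
      (acyclicAt_cone' hr (by omega) (by omega) (by omega)) hz hy hy2
  · exact hα.eq_zero _ (connecting_of_mem_bdry cone_ordConnected h)
  · have h1 := phi_eq_alpha (connecting_mem_cyc cone_ordConnected hz) (i := i) (by omega) (by omega)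
      (by omega)
    have h2 : phi R r n (res R (pathCells r n) (bd R z)) = phi R r n (bd R z) :=
      pair_res (fun s hs => (of_twoBlock_ne_zero hs).1) _
    have h3 := phi_bd (by omega) (chains_mono Set.inter_subset_left _ (mem_cyc.1 hz).1) hi
    have h4 := h1.symm.trans (h2.trans h3)
    rw [neg_mul, neg_eq_zero] at h4
    exact h4
  · obtain ⟨z, hz, hz1⟩ := hα.exists_eq_one
    have h1 := phi_eq_alpha hz (by omega) (by omega) (by omega)
    have haz : a • z ∈ cyc R (pathCells r n) i := Submodule.smul_mem _ _ hz
    obtain ⟨c, hc, h2⟩ := exists_connecting zeroFull_isUpperSet (mem_cyc.1 haz).1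
      (mem_bdry_cone_of_phi hr (by omega) (by omega) (cyc_lower_le zeroFull_isUpperSet haz) (by
        rw [map_smul, h1, hz1, smul_eq_mul, mul_one, mul_neg, mul_comm, ha, neg_zero]))
    refine ⟨c, hc, ?_⟩
    have h3 := hα.eq_zero _ h2
    rw [map_sub, map_smul, hz1, smul_eq_mul, mul_one, sub_eq_zero] at h3
    exact h3

/-- A cycle below the degree of `phi` extends to a cycle of the cone. -/
theorem exists_extension (hr : 2 ≤ r) (hn : 4 ≤ n) {i : ℕ} (hi : i + 2 = n + 2 * r)
    {z : Finset (Vtx r n) → R} (hz : z ∈ cyc R (cycleCells r n) i) :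
    ∃ u ∈ cyc R (cone r n) i, res R (zeroFull r n) u = z := by
  obtain ⟨i, rfl⟩ : ∃ j, i = j + 1 := ⟨i - 1, by omega⟩
  obtain ⟨y, hy, h2⟩ := acyclicAt_pathCells (by omega) (by omega) (by omega)
    (connecting_mem_cyc cone_ordConnected hz)
  refine ⟨z - y, sub_mem_cyc_of_connecting zeroFull_isUpperSet hz hy h2, ?_⟩
  rw [map_sub, res_upper_eq (mem_cyc.1 hz).1, res_lower_eq_zero hy, sub_zero]

/-- The first nonzero homology in positive degrees. -/
theorem exists_bot (hr : 2 ≤ r) (hn : 4 ≤ n) {i : ℕ} (hi : i + 2 = n + 2 * r) :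
    ∃ e ∈ cyc R (cycleCells r n) i,
      (∀ z ∈ cyc R (cycleCells r n) i, ∃ a : R, z - a • e ∈ bdry R (cycleCells r n) i) ∧
      ∀ a : R, a • e ∈ bdry R (cycleCells r n) i ↔ ∃ b, a = (1 + (-1) ^ n) * b := by
  obtain ⟨e, he, he1⟩ := exists_phi_eq_one (R := R) hr hn hi
  refine ⟨res R (zeroFull r n) e, res_mem_cyc zeroFull_isUpperSet he, fun z hz => ?_,
    fun a => ⟨fun h => ?_, fun h => ?_⟩⟩
  · obtain ⟨u, hu, rfl⟩ := exists_extension hr hn hi hz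
    refine ⟨phi R r n u, ?_⟩
    rw [← map_smul, ← map_sub]
    refine res_mem_bdry zeroFull_isUpperSet (mem_bdry_cone_of_phi hr hn hi
      (sub_mem hu (Submodule.smul_mem _ _ he)) ?_)
    rw [map_sub, map_smul, he1, smul_eq_mul, mul_one, sub_self]
  · obtain ⟨b, hb, hb2⟩ := h
    have hb' := chains_mono (R := R) (Set.inter_subset_left (s := cone r n) (t := zeroFull r n)) _ hb
    -- Subtracting the boundary moves `a • e` into the path without changing `phi`. So `a` is a
    -- value of `phi` on a path cycle, hence a multiple of `1 + (-1)^n`.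
    have hw : a • e - res R (cone r n) (bd R b) ∈ cyc R (cone r n) i :=
      sub_mem (Submodule.smul_mem _ _ he) (bdry_le_cyc cone_ordConnected i ⟨b, hb', rfl⟩)
    have hw2 : a • e - res R (cone r n) (bd R b) ∈ cyc R (pathCells r n) i := by
      refine mem_cyc.2 ⟨fun s hs => ?_, fun s hs => (mem_cyc.1 hw).2 s hs.1⟩
      obtain ⟨h1, h2⟩ := (mem_cyc.1 hw).1 s hs
      refine ⟨⟨h1, fun hsQ => hs ?_⟩, h2⟩
      have := congrFun hb2 s
      rw [LinearMap.comp_apply, res_apply_mem (P := cycleCells r n) _ ⟨h1, hsQ⟩, Pi.smul_apply,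
        res_apply_mem _ hsQ] at this
      rw [Pi.sub_apply, res_apply_mem _ h1, this, Pi.smul_apply, sub_self]
    have h3 := phi_eq_alpha hw2 hi (by omega) (by omega)
    rw [map_sub, map_smul, he1, phi_res Set.inter_subset_left, phi_bd (by omega) hb' (by omega),
      sub_zero, smul_eq_mul, mul_one] at h3
    exact ⟨_, h3.trans (neg_mul_comm _ _)⟩
  -- Adding `b` times the generator of the path makes `phi` vanish, and this correction is invisible
  -- on the members coloured at `0`.
  · obtain ⟨b, rfl⟩ := h
    obtain ⟨z, hz, hz1⟩ := (detects_alpha (R := R) (r := r) (n := n) (i := i) (by omega) (by omega)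
      hi).exists_eq_one
    have h1 := phi_eq_alpha hz hi (by omega) (by omega)
    have h2 := res_mem_bdry zeroFull_isUpperSet (mem_bdry_cone_of_phi hr hn hi
      (add_mem (Submodule.smul_mem _ ((1 + (-1) ^ n) * b) he)
        (Submodule.smul_mem _ b (cyc_lower_le zeroFull_isUpperSet hz)))
      (by rw [map_add, map_smul, map_smul, he1, h1, hz1, smul_eq_mul, smul_eq_mul]; ring))
    rwa [map_add, map_smul, map_smul, res_lower_eq_zero (mem_cyc.1 hz).1, smul_zero, add_zero] at h2

end

/-! ### Action of permutations of the ground set. -/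

section

variable {T : Type} [LinearOrder T] [Fintype T] {R : Type} [CommRing R]

/-- The number of inversions of a permutation on a set. -/
def inv (f : T ≃ T) (s : Finset T) : ℕ :=
  ∑ x ∈ s, ∑ y ∈ s, if x < y ∧ f y < f x then 1 else 0

theorem inv_insert (f : T ≃ T) {x : T} {s : Finset T} (hx : x ∉ s) :
    inv f (insert x s) = inv f s + ∑ y ∈ s, ((if x < y ∧ f y < f x then 1 else 0) +
      if y < x ∧ f x < f y then 1 else 0) := by
  unfold inv
  rw [sum_insert hx, sum_insert hx, if_neg (by simp), zero_add,
    sum_congr rfl fun y _ => sum_insert hx, sum_add_distrib, sum_add_distrib]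
  ring

/-- For each `y ∈ s`, an even number of the following hold: `y < x`, `f y < f x`, and the pair of
`x` and `y` is inverted by `f`. -/
theorem sg_mul_inv_insert (f : T ≃ T) {x : T} {s : Finset T} (hx : x ∉ s) :
    sg R x s * (-1) ^ inv f (insert x s) = (-1) ^ inv f s * sg R (f x) (s.map f.toEmbedding) := by
  have h : Even (∑ y ∈ s, ((if y < x then 1 else 0) + ((if x < y ∧ f y < f x then 1 else 0) +
      if y < x ∧ f x < f y then 1 else 0) + if f y < f x then 1 else 0)) := by
    refine even_sum _ fun y hy => ?_
    have hne : y ≠ x := fun h => hx (h ▸ hy)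
    have hne' : f y ≠ f x := fun h => hne (f.injective h)
    rcases lt_or_gt_of_ne hne with h1 | h1 <;> rcases lt_or_gt_of_ne hne' with h2 | h2 <;>
      simp [h1, h2, h1.not_gt, h2.not_gt]
  rw [sum_add_distrib, sum_add_distrib, ← card_filter, ← card_filter] at h
  have h2 : ((s.map f.toEmbedding).filter (· < f x)).card = (s.filter fun y => f y < f x).card := by
    rw [filter_map, card_map]; rfl
  rw [inv_insert f hx, sg, sg, h2, ← pow_add, ← pow_add]
  apply neg_one_pow_congr
  rw [Nat.even_iff] at h
  simp only [Nat.even_iff]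
  omega

variable (R) in
/-- The action of a permutation of the vertices on the chains of the simplex. -/
def reindex (f : T ≃ T) : (Finset T → R) →ₗ[R] (Finset T → R) where
  toFun c s := (-1) ^ inv f s * c (s.map f.toEmbedding)
  map_add' c d := by ext s; simp [mul_add]
  map_smul' a c := by ext s; simp only [Pi.smul_apply, smul_eq_mul, RingHom.id_apply]; ring

theorem reindex_apply (f : T ≃ T) (c : Finset T → R) (s : Finset T) :
    reindex R f c s = (-1) ^ inv f s * c (s.map f.toEmbedding) := rfl

theorem bd_reindex (f : T ≃ T) (c : Finset T → R) : bd R (reindex R f c) = reindex R f (bd R c) := by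
  ext s
  have h : (s.map f.toEmbedding)ᶜ = sᶜ.map f.toEmbedding := by
    ext x; simp [mem_map_equiv]
  rw [bd_apply, reindex_apply, bd_apply, mul_sum, h, sum_map]
  refine sum_congr rfl fun x hx => ?_
  rw [mem_compl] at hx
  rw [reindex_apply, ← mul_assoc, sg_mul_inv_insert f hx, map_insert, mul_assoc]
  rfl

variable {P : Set (Finset T)} {i : ℕ} {f : T ≃ T}

theorem reindex_mem_chains (hf : ∀ s, s.map f.toEmbedding ∈ P ↔ s ∈ P) {c : Finset T → R}
    (hc : c ∈ chains R P i) : reindex R f c ∈ chains R P i := by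
  intro s hs
  obtain ⟨h1, h2⟩ := hc _ (right_ne_zero_of_mul hs)
  exact ⟨(hf s).1 h1, by rwa [card_map] at h2⟩

theorem res_reindex (hf : ∀ s, s.map f.toEmbedding ∈ P ↔ s ∈ P) (c : Finset T → R) :
    res R P (reindex R f c) = reindex R f (res R P c) := by
  ext s
  rw [reindex_apply]
  by_cases hs : s ∈ P
  · rw [res_apply_mem _ hs, res_apply_mem _ ((hf s).2 hs), reindex_apply]
  · rw [res_apply_notMem _ hs, res_apply_notMem _ (fun h => hs ((hf s).1 h)), mul_zero]

theorem reindex_mem_cyc (hf : ∀ s, s.map f.toEmbedding ∈ P ↔ s ∈ P) {c : Finset T → R}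
    (hc : c ∈ cyc R P i) : reindex R f c ∈ cyc R P i := by
  obtain ⟨h1, h2⟩ := mem_cyc.1 hc
  refine mem_cyc.2 ⟨reindex_mem_chains hf h1, fun s hs => ?_⟩
  rw [bd_reindex, reindex_apply, h2 _ ((hf s).2 hs), mul_zero]

end

/-! ### The reflection of the cycle. -/

section

variable {R : Type} [CommRing R]
variable {r n : ℕ}

/-- The reflection of the cycle on the vertices of the complex. -/
def flip (r n : ℕ) : Vtx r n ≃ Vtx r n :=
  ofLex.trans (((Equiv.neg (Fin (2 * r + 1))).prodCongr (Equiv.refl (Fin n))).trans toLex)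

/-- The reflection of the cycle. -/
def rf (r j : ℕ) : ℕ := if j = 0 then 0 else 2 * r + 1 - j

theorem rf_le {j : ℕ} : rf r j ≤ 2 * r := by unfold rf; split_ifs <;> omega

theorem rf_rf {j : ℕ} (hj : j ≤ 2 * r) : rf r (rf r j) = j := by unfold rf; split_ifs <;> omega

theorem val_neg (x : Fin (2 * r + 1)) : (-x).val = rf r x.val := by
  rw [Fin.val_neg']
  unfold rf
  split_ifs with h
  · rw [h]; simp
  · exact Nat.mod_eq_of_lt (by omega)

theorem flip_pt {j : ℕ} (hj : j ≤ 2 * r) (w : Fin n) : flip r n (pt r j w) = pt r (rf r j) w := by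
  have : -(Fin.ofNat (2 * r + 1) j) = Fin.ofNat (2 * r + 1) (rf r j) := by
    rw [Fin.ext_iff, val_neg, Fin.val_ofNat, Fin.val_ofNat, Nat.mod_eq_of_lt (by omega),
      Nat.mod_eq_of_lt (Nat.lt_succ_of_le rf_le)]
  exact congrArg (fun x => (toLex (x, w) : Vtx r n)) this

theorem pt_mem_map {j : ℕ} (hj : j ≤ 2 * r) (w : Fin n) (s : Finset (Vtx r n)) :
    pt r j w ∈ s.map (flip r n).toEmbedding ↔ pt r (rf r j) w ∈ s := by
  rw [mem_map_equiv]
  have : (flip r n).symm (pt r j w) = pt r (rf r j) w := by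
    rw [Equiv.symm_apply_eq, flip_pt rf_le, rf_rf hj]
  rw [this]

theorem sec_map {j : ℕ} (hj : j ≤ 2 * r) (s : Finset (Vtx r n)) :
    sec (s.map (flip r n).toEmbedding) j = sec s (rf r j) := by
  ext w; rw [mem_sec, pt_mem_map hj, mem_sec]

theorem map_map_flip (s : Finset (Vtx r n)) :
    (s.map (flip r n).toEmbedding).map (flip r n).toEmbedding = s := by
  ext x
  obtain ⟨j, hj, w, rfl⟩ := exists_pt x
  rw [pt_mem_map hj, pt_mem_map rf_le, rf_rf hj]

theorem map_mem_cone {s : Finset (Vtx r n)} (hs : s ∈ cone r n) :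
    s.map (flip r n).toEmbedding ∈ cone r n := by
  obtain ⟨h1, h2, h3⟩ := hs
  refine ⟨fun j hj hj' => ?_, fun j hj hj' w => ?_, fun w => ?_⟩
  · simp only [pt_mem_map hj']
    rw [rf, if_neg (by omega)]
    exact h1 _ (by omega) (by omega)
  · simp (disch := omega) only [pt_mem_map]
    rw [rf, if_neg (by omega), rf, if_neg (by omega)]
    intro h4 h5
    refine h2 (2 * r + 1 - (j + 1)) (by omega) (by omega) w h5 ?_
    rwa [show 2 * r + 1 - (j + 1) + 1 = 2 * r + 1 - j by omega]
  · by_cases hr : r = 0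
    · subst hr
      intro h
      rw [pt_mem_map (by omega)] at h
      have := h3 w h
      exact absurd h this.2
    · simp (disch := omega) only [pt_mem_map]
      rw [rf, if_pos rfl, rf, if_neg (by omega), rf, if_neg (by omega)]
      intro h
      rw [show 2 * r + 1 - 1 = 2 * r by omega, show 2 * r + 1 - 2 * r = 1 by omega]
      exact (h3 w h).symm

theorem map_mem_cone_iff (s : Finset (Vtx r n)) :
    s.map (flip r n).toEmbedding ∈ cone r n ↔ s ∈ cone r n :=
  ⟨fun h => by have := map_mem_cone h; rwa [map_map_flip] at this, map_mem_cone⟩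

theorem map_mem_zeroFull_iff (s : Finset (Vtx r n)) :
    s.map (flip r n).toEmbedding ∈ zeroFull r n ↔ s ∈ zeroFull r n :=
  exists_congr fun w => by rw [pt_mem_map (by omega), rf, if_pos rfl]

theorem map_mem_pathCells_iff (s : Finset (Vtx r n)) :
    s.map (flip r n).toEmbedding ∈ pathCells r n ↔ s ∈ pathCells r n :=
  and_congr (map_mem_cone_iff s) (not_congr (map_mem_zeroFull_iff s))

theorem map_mem_cycleCells_iff (s : Finset (Vtx r n)) :
    s.map (flip r n).toEmbedding ∈ cycleCells r n ↔ s ∈ cycleCells r n :=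
  and_congr (map_mem_cone_iff s) (map_mem_zeroFull_iff s)

/-- The sum of the products `b i * b j` for `1 ≤ i < j < N`. -/
def pairSum (N : ℕ) (b : ℕ → ℕ) : ℕ := ∑ j ∈ Ico 1 N, ∑ i ∈ Ico 1 j, b i * b j

theorem pairSum_sq (N : ℕ) (hN : 1 ≤ N) (b : ℕ → ℕ) :
    2 * pairSum N b + ∑ j ∈ Ico 1 N, b j ^ 2 = (∑ j ∈ Ico 1 N, b j) ^ 2 := by
  induction N, hN using Nat.le_induction with
  | base => simp [pairSum]
  | succ N hN ih =>
    unfold pairSum at ih ⊢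
    rw [sum_Ico_succ_top hN, sum_Ico_succ_top hN, sum_Ico_succ_top hN, ← sum_mul, add_sq, ← ih]
    ring

theorem sum_ite_eq_pairSum (N : ℕ) (b : ℕ → ℕ) :
    ∑ i ∈ range N, ∑ j ∈ range N, (if i < j ∧ 1 ≤ i then b i * b j else 0) = pairSum N b := by
  rw [sum_comm, pairSum, ← sum_subset (s₁ := Ico 1 N) (fun j hj => by simp at hj ⊢; omega)]
  · refine sum_congr rfl fun j hj => ?_
    rw [← sum_subset (s₁ := Ico 1 j) (fun i hi => by simp at hi hj ⊢; omega)]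
    · refine sum_congr rfl fun i hi => ?_
      rw [if_pos (by simp at hi; omega)]
    · intro i _ hi
      rw [if_neg (by simp at hi; omega)]
  · intro j hj hj'
    refine sum_eq_zero fun i _ => ?_
    rw [if_neg (by simp at hj hj'; omega)]

/-- The reflection fixes the vertex `0`, reverses `1, …, 2r` and keeps the order of colours at each
vertex, so the inverted pairs are those at two different nonzero vertices. -/
theorem inv_flip (s : Finset (Vtx r n)) :
    inv (flip r n) s = pairSum (2 * r + 1) fun j => (sec s j).card := by
  rw [inv, ← sum_ite_eq_pairSum, sum_eq_sum_sec]
  refine sum_congr rfl fun i hi => ?_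
  rw [sum_congr rfl fun w _ => sum_eq_sum_sec s _, sum_comm]
  refine sum_congr rfl fun j hj => ?_
  simp only [mem_range] at hi hj
  by_cases h : i < j ∧ 1 ≤ i
  · rw [if_pos h, sum_congr rfl fun w _ => sum_congr rfl fun x _ => if_pos ?_]
    · simp
    · rw [flip_pt (by omega), flip_pt (by omega), pt_lt_pt (by omega) (by omega),
        pt_lt_pt rf_le rf_le]
      refine ⟨Or.inl h.1, Or.inl ?_⟩
      rw [rf, if_neg (by omega), rf, if_neg (by omega)]
      omega
  · rw [if_neg h]
    refine sum_eq_zero fun w _ => sum_eq_zero fun x _ => if_neg ?_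
    rw [flip_pt (by omega), flip_pt (by omega), pt_lt_pt (by omega) (by omega), pt_lt_pt rf_le rf_le]
    rintro ⟨h1, h2⟩
    rcases h1 with h1 | ⟨rfl, h1⟩
    · obtain rfl : i = 0 := by omega
      have e1 : rf r 0 = 0 := if_pos rfl
      have e2 : rf r j = 2 * r + 1 - j := if_neg (by omega)
      rw [e1, e2] at h2
      omega
    · have := h1.not_gt
      simp [this] at h2

theorem shuf_comm (N U W : Finset (Fin n)) :
    shuf R N W U = (-1) ^ (U.card * W.card) * shuf R N U W := by
  by_cases h : U.Nonempty ∧ W.Nonempty ∧ Disjoint U W ∧ U ∪ W = N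
  · obtain ⟨h1, h2, h3, h4⟩ := h
    rw [shuf_eq h1 h2 h3 h4, shuf_eq h2 h1 h3.symm (by rw [union_comm, h4]), sh_comm h3]
  · have e1 : shuf R N U W = 0 := if_neg h
    have e2 : shuf R N W U = 0 := if_neg fun ⟨h1, h2, h3, h4⟩ =>
      h ⟨h2, h1, h3.symm, by rw [union_comm, h4]⟩
    rw [e1, e2, mul_zero]

/-- Besides the colour sets at `1` and `2r` there are `2r - 2` singletons. Pairs of a singleton with
a colour of the two blocks are even in number, and pairs of singletons number `(r - 1)(2r - 3)`,
which has the parity of `r - 1`. -/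
theorem inv_of_twoBlock (hr : 2 ≤ r) {s : Finset (Vtx r n)} (hs : s ∈ pathCells r n)
    (hc : s.card + 2 = n + 2 * r) (h : (sec s 1).card + (sec s (2 * r)).card = n) :
    (-1 : R) ^ inv (flip r n) s = -(-1) ^ r * (-1) ^ ((sec s 1).card * (sec s (2 * r)).card) := by
  have hone : ∀ j, 2 ≤ j → j < 2 * r → (sec s j).card = 1 := by
    intro j h1 h2
    have := card_ge hs.1 {1, 2 * r, j} (by intro j; simp; omega)
    rw [sum_insert (by simp; omega), sum_pair (by omega), card_insert_of_notMem (by simp; omega),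
      card_pair (by omega)] at this
    have := card_pos.2 (sec_nonempty hs.1 (j := j) (by omega) (by omega))
    omega
  have hsum : ∀ f : ℕ → ℕ, ∑ j ∈ Ico 1 (2 * r + 1), f j =
      f 1 + ∑ j ∈ Ico 2 (2 * r), f j + f (2 * r) := fun f => by
    rw [sum_Ico_succ_top (by omega), sum_eq_sum_Ico_succ_bot (by omega)]
  have h1 := pairSum_sq (2 * r + 1) (by omega) fun j => (sec s j).card
  have h2 : ∀ k, ∑ j ∈ Ico 2 (2 * r), (sec s j).card ^ k = 2 * r - 2 := fun k => by
    rw [sum_congr rfl (g := fun _ => 1) fun j hj => by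
      rw [hone j (mem_Ico.1 hj).1 (mem_Ico.1 hj).2, one_pow]]
    simp
  have h3 := h2 1
  simp only [pow_one] at h3
  rw [hsum, hsum, h2, h3, ← inv_flip] at h1
  obtain ⟨m, rfl⟩ : ∃ m, r = m + 1 := ⟨r - 1, by omega⟩
  rw [show 2 * (m + 1) - 2 = 2 * m by omega] at h1
  have h4 : inv (flip (m + 1) n) s = (sec s 1).card * (sec s (2 * (m + 1))).card +
      2 * (m * ((sec s 1).card + (sec s (2 * (m + 1))).card) + m * m - m) + m := by
    have h5 : m ≤ m * ((sec s 1).card + (sec s (2 * (m + 1))).card) + m * m := by nlinarith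
    zify [h5] at h1 ⊢
    linarith
  rw [h4, pow_add, pow_add, pow_mul (-1 : R) 2, neg_one_sq, one_pow, pow_succ]
  ring

/-- The reflection exchanges the colour sets `U` and `W` at `1` and `2r`. The sign `(-1)^(|U||W|)`
from the shuffle cancels the same sign in the inversion count. -/
theorem phi_reindex (hr : 2 ≤ r) (c : Finset (Vtx r n) → R) :
    phi R r n (reindex R (flip r n) c) = -(-1) ^ r * phi R r n c := by
  rw [phi, pair_apply, pair_apply, mul_sum]
  refine Fintype.sum_equiv (flip r n).finsetCongr _ _ fun s => ?_
  rw [Equiv.finsetCongr_apply, reindex_apply, ← mul_assoc, ← mul_assoc]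
  congr 1
  by_cases hs : s ∈ pathCells r n ∧ s.card + 2 = n + 2 * r
  · rw [twoBlock_eq hs.1 hs.2, twoBlock_eq ((map_mem_pathCells_iff s).2 hs.1)
      (by rw [card_map]; exact hs.2), sec_map (by omega), sec_map le_rfl, rf, if_neg (by omega), rf,
      if_neg (by omega), Nat.add_sub_cancel, show 2 * r + 1 - 2 * r = 1 by omega,
      shuf_comm _ (sec s 1)]
    by_cases h : shuf R univ (sec s 1) (sec s (2 * r)) = 0
    · rw [h]; ring
    · have h1 := card_of_shuf_ne_zero h
      rw [card_univ, Fintype.card_fin] at h1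
      rw [inv_of_twoBlock hr hs.1 hs.2 h1]
      ring
  · have e1 : twoBlock (shuf R univ) 1 (2 * r) n s = 0 := if_neg hs
    have e2 : twoBlock (shuf R univ) 1 (2 * r) n (s.map (flip r n).toEmbedding) = 0 :=
      if_neg fun h => hs ⟨(map_mem_pathCells_iff s).1 h.1, by rw [card_map] at h; exact h.2⟩
    rw [e1, e2]; ring

/-- The cycle extends to the cone, where `phi` of the same combination is zero. The factor `(-1)^r`
is the one that `pullbackChains_toCell` attaches to `reindex`. -/
theorem reindex_add_mem_bdry [NeZero n] (hr : 2 ≤ r) (hn : 4 ≤ n) {i : ℕ} (hi : i + 2 = n + 2 * r)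
    {z : Finset (Vtx r n) → R} (hz : z ∈ cyc R (cycleCells r n) i) :
    (-1 : R) ^ r • reindex R (flip r n) z + z ∈ bdry R (cycleCells r n) i := by
  obtain ⟨u, hu, rfl⟩ := exists_extension hr hn hi hz
  rw [← res_reindex map_mem_zeroFull_iff, ← map_smul, ← map_add]
  refine res_mem_bdry zeroFull_isUpperSet (mem_bdry_cone_of_phi hr hn hi
    (add_mem (Submodule.smul_mem _ _ (reindex_mem_cyc map_mem_cone_iff hu)) hu) ?_)
  rw [map_add, map_smul, phi_reindex hr, smul_eq_mul]
  linear_combination (-phi R r n u) * neg_one_pow_mul_self (R := R) r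

end

open HomComplex

/-! ### Translation between cellular chains and chains of sets. -/

section

variable {R : Type} [CommRing R]
variable {r n : ℕ}

/-- The set of pairs which corresponds to a family of sets of colours. -/
def cellSet (η : Fin (2 * r + 1) → Finset (Fin n)) : Finset (Vtx r n) :=
  univ.filter fun x => (ofLex x).2 ∈ η (ofLex x).1

theorem mem_cellSet {η : Fin (2 * r + 1) → Finset (Fin n)} {x : Vtx r n} :
    x ∈ cellSet η ↔ (ofLex x).2 ∈ η (ofLex x).1 := by simp [cellSet]

theorem pt_val (v : Fin (2 * r + 1)) (w : Fin n) : pt r v.val w = toLex (v, w) := by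
  simp [pt]

theorem sec_cellSet (η : Fin (2 * r + 1) → Finset (Fin n)) (v : Fin (2 * r + 1)) :
    sec (cellSet η) v.val = η v := by
  ext w; rw [mem_sec, pt_val, mem_cellSet]; rfl

theorem cellSet_injective : Function.Injective (cellSet (r := r) (n := n)) := fun η τ h => by
  funext v
  rw [← sec_cellSet η v, h, sec_cellSet]

theorem cellSet_colours (s : Finset (Vtx r n)) : cellSet (fun v => sec s v.val) = s := by
  ext x
  rw [mem_cellSet, mem_sec, pt_val]
  rfl

theorem card_cellSet {η : Fin (2 * r + 1) → Finset (Fin n)} (h : ∀ v, (η v).Nonempty) :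
    (cellSet η).card = cellDim η + (2 * r + 1) := by
  rw [card_eq_sum_sec, ← Fin.sum_univ_eq_sum_range (fun j => (sec (cellSet η) j).card), cellDim]
  have : 2 * r + 1 = ∑ v : Fin (2 * r + 1), 1 := by simp
  conv_rhs => enter [2]; rw [this]
  rw [← sum_add_distrib]
  refine sum_congr rfl fun v _ => ?_
  rw [sec_cellSet]
  have := (h v).card_pos
  omega

theorem cycleGraph_adj_iff (hr : 1 ≤ r) (u v : Fin (2 * r + 1)) :
    (SimpleGraph.cycleGraph (2 * r + 1)).Adj u v ↔ nb r u.val v.val := by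
  rw [SimpleGraph.cycleGraph_adj', nb]
  simp only [Fin.sub_def]
  have hu := u.2
  have hv := v.2
  rcases lt_trichotomy u.val v.val with h | h | h
  · rw [Nat.mod_eq_of_lt (show 2 * r + 1 - v.val + u.val < 2 * r + 1 by omega),
      show 2 * r + 1 - u.val + v.val = v.val - u.val + (2 * r + 1) by omega, Nat.add_mod_right,
      Nat.mod_eq_of_lt (by omega)]
    omega
  · rw [h, show 2 * r + 1 - v.val + v.val = 2 * r + 1 by omega, Nat.mod_self]
    omega
  · rw [Nat.mod_eq_of_lt (show 2 * r + 1 - u.val + v.val < 2 * r + 1 by omega),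
      show 2 * r + 1 - v.val + u.val = u.val - v.val + (2 * r + 1) by omega, Nat.add_mod_right,
      Nat.mod_eq_of_lt (by omega)]
    omega

theorem isCell_iff (hr : 1 ≤ r) (η : Fin (2 * r + 1) → Finset (Fin n)) :
    IsCell (SimpleGraph.cycleGraph (2 * r + 1)) (⊤ : SimpleGraph (Fin n)) η ↔
      cellSet η ∈ cycleCells r n := by
  have hpt : ∀ j (hj : j ≤ 2 * r) w, pt r j w ∈ cellSet η ↔ w ∈ η ⟨j, by omega⟩ := fun j hj w => by
    rw [show pt r j w = toLex (⟨j, by omega⟩, w) from pt_val (⟨j, by omega⟩ : Fin (2 * r + 1)) w,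
      mem_cellSet]
    rfl
  have hnb : IsCell (SimpleGraph.cycleGraph (2 * r + 1)) (⊤ : SimpleGraph (Fin n)) η →
      ∀ i j, i ≤ 2 * r → j ≤ 2 * r → nb r i j → ∀ w, pt r i w ∈ cellSet η → pt r j w ∉ cellSet η := by
    intro h i j hi hj hij w h1 h2
    rw [hpt i hi] at h1
    rw [hpt j hj] at h2
    exact (h.2 _ _ ((cycleGraph_adj_iff hr _ _).2 hij) _ h1 _ h2).ne rfl
  constructor
  · intro h
    have h2 := hnb h
    refine ⟨⟨fun j h1 hj => ?_, fun j h1 hj w => h2 j (j + 1) (by omega) (by omega) (Or.inl rfl) w,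
      fun w hw => ⟨h2 0 1 (by omega) (by omega) (Or.inl rfl) w hw,
        h2 0 (2 * r) (by omega) le_rfl (by unfold nb; omega) w hw⟩⟩, ?_⟩
    · simp only [hpt j hj]; exact h.1 _
    · exact (h.1 0).imp fun w hw => (hpt 0 (by omega) w).2 hw
  · intro h
    refine ⟨fun v => ?_, fun u v huv a ha b hb => ?_⟩
    · rw [← sec_cellSet η v]
      by_cases h0 : v.val = 0
      · rw [h0]
        exact h.2.imp fun w hw => by simpa using hw
      · exact sec_nonempty h.1 (by omega) (by omega)
    · rw [SimpleGraph.top_adj]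
      rintro rfl
      rw [← sec_cellSet η, mem_sec] at ha hb
      exact notMem_of_nb h.1 (by omega) (by omega) ((cycleGraph_adj_iff hr _ _).1 huv) ha hb

/-- The cells of the complex of homomorphisms from a cycle to a complete graph. -/
abbrev CycleCell (r n i : ℕ) : Type :=
  Cell (SimpleGraph.cycleGraph (2 * r + 1)) (⊤ : SimpleGraph (Fin n)) i

theorem cellSet_mem (hr : 1 ≤ r) {i : ℕ} (η : CycleCell r n i) :
    cellSet η.val ∈ cycleCells r n ∧ (cellSet η.val).card = i + (2 * r + 1) :=
  ⟨(isCell_iff hr _).1 η.isCell, by rw [card_cellSet η.isCell.1, η.dim_eq]⟩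

theorem exists_cell (hr : 1 ≤ r) {i : ℕ} {s : Finset (Vtx r n)} (h1 : s ∈ cycleCells r n)
    (h2 : s.card = i + (2 * r + 1)) : ∃ η : CycleCell r n i, cellSet η.val = s := by
  have h3 : IsCell (SimpleGraph.cycleGraph (2 * r + 1)) (⊤ : SimpleGraph (Fin n))
      fun v => sec s v.val := by
    rw [isCell_iff hr, cellSet_colours]; exact h1
  have h4 := card_cellSet h3.1
  rw [cellSet_colours, h2] at h4
  exact ⟨⟨_, h3, by omega⟩, cellSet_colours s⟩

theorem sum_ite_cellSet (hr : 1 ≤ r) {i : ℕ} {d : Finset (Vtx r n) → R}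
    (hd : d ∈ chains R (cycleCells r n) (i + (2 * r + 1))) (s : Finset (Vtx r n)) :
    ∑ η : CycleCell r n i, (if cellSet η.val = s then d (cellSet η.val) else 0) = d s := by
  by_cases h : d s = 0
  · rw [h]
    refine sum_eq_zero fun η _ => ?_
    split_ifs with h1
    · rw [h1, h]
    · rfl
  · obtain ⟨η, rfl⟩ := exists_cell hr (hd s h).1 (hd s h).2
    rw [sum_eq_single η, if_pos rfl]
    · intro τ _ hτ
      exact if_neg fun h => hτ (Cell.ext (cellSet_injective h))
    · intro h; exact absurd (mem_univ η) h

/-- The exponent of the sign which compares the orientations of products and joins of simplices. -/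
def gauge (s : Finset (Vtx r n)) : ℕ := ∑ x ∈ s, (ofLex x).1.val

/-- The product orientation counts the dimension of each earlier factor, the simplex counts its
vertices. The difference is one for each of the `v` earlier factors. -/
theorem signExp_add {η : Fin (2 * r + 1) → Finset (Fin n)}
    (hη : ∀ v, (η v).Nonempty) (v : Fin (2 * r + 1)) (w : Fin n) :
    signExp η v w + v.val =
      ((cellSet (del η v w)).filter (· < (toLex (v, w) : Vtx r n))).card := by
  rw [← pt_val, card_filter_lt (by omega), sec_cellSet]
  have h1 : (del η v w v).filter (· < w) = (η v).filter (· < w) := by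
    rw [del, Function.update_self, filter_erase, erase_eq_of_notMem (by simp)]
  have h2 : ∑ i ∈ range v.val, (sec (cellSet (del η v w)) i).card =
      ∑ u ∈ univ.filter (· < v), (η u).card := by
    rw [sum_filter, show (∑ u : Fin (2 * r + 1), if u < v then (η u).card else 0) =
      ∑ u : Fin (2 * r + 1), (fun j => if j < v.val then (sec (cellSet (del η v w)) j).card else 0) u.val
      from sum_congr rfl fun u _ => ?_,
      Fin.sum_univ_eq_sum_range (fun j => if j < v.val then (sec (cellSet (del η v w)) j).card else 0),
      ← sum_filter]
    · refine sum_congr ?_ fun _ _ => rfl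
      ext j; simp; omega
    · simp only [Fin.lt_def, sec_cellSet]
      split_ifs with h
      · rw [del, Function.update_of_ne (Fin.lt_def.2 h).ne]
      · rfl
  have h3 : v.val = ∑ u ∈ univ.filter (· < v), 1 := by
    rw [← card_eq_sum_ones, ← Fin.card_Iio v]
    congr 1
    ext; simp
  have h4 : ∑ u ∈ univ.filter (· < v), (η u).card =
      ∑ u ∈ univ.filter (· < v), ((η u).card - 1) + v.val := by
    conv_rhs => enter [2]; rw [h3]
    rw [← sum_add_distrib]
    refine sum_congr rfl fun u _ => ?_
    have := (hη u).card_pos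
    omega
  rw [h1, h2, h4, signExp]
  ring

theorem incidence_cond {η τ : Fin (2 * r + 1) → Finset (Fin n)} (p : Fin (2 * r + 1) × Fin n) :
    (p.2 ∈ η p.1 ∧ τ = del η p.1 p.2) ↔
      (toLex p ∉ cellSet τ ∧ cellSet η = insert (toLex p) (cellSet τ)) := by
  have hdel : cellSet (del η p.1 p.2) = (cellSet η).erase (toLex p) := by
    ext x
    rw [mem_cellSet, mem_del, mem_erase, mem_cellSet, and_comm]
    rfl
  rw [← cellSet_injective.eq_iff (a := τ), hdel]
  have hm : p.2 ∈ η p.1 ↔ toLex p ∈ cellSet η := by rw [mem_cellSet]; rfl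
  rw [hm]
  constructor
  · rintro ⟨h1, h2⟩
    rw [h2]
    exact ⟨notMem_erase _ _, (insert_erase h1).symm⟩
  · rintro ⟨h1, h2⟩
    rw [h2]
    exact ⟨mem_insert_self _ _, (erase_insert h1).symm⟩

/-- The discrepancy `(-1)^v` between the two incidence signs is a coboundary: it is the quotient of
the values of `gauge` at a cell and at its facet obtained at `v`. -/
theorem incidence_eq_sum {η τ : Fin (2 * r + 1) → Finset (Fin n)} (hη : ∀ v, (η v).Nonempty) :
    ((incidence η τ : ℤ) : R) = ∑ x ∈ (cellSet τ)ᶜ, if cellSet η = insert x (cellSet τ) then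
      (-1) ^ gauge (cellSet η) * (-1) ^ gauge (cellSet τ) * sg R x (cellSet τ) else 0 := by
  have hf : (cellSet τ)ᶜ = univ.filter fun x => x ∉ cellSet τ := by ext x; simp
  rw [incidence_eq, hf, sum_filter]
  push_cast
  refine Fintype.sum_equiv toLex _ _ fun p => ?_
  rw [← ite_and]
  by_cases h : p.2 ∈ η p.1 ∧ τ = del η p.1 p.2
  · have h' := (incidence_cond p).1 h
    rw [if_pos h, if_pos h', h'.2, gauge, sum_insert h'.1, ← gauge, sg, h.2,
      show (toLex p : Vtx r n) = toLex (p.1, p.2) from rfl, ← signExp_add hη, pow_add, pow_add]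
    simp only [ofLex_toLex]
    linear_combination (-(-1) ^ signExp η p.1 p.2) *
      (neg_one_pow_mul_self (R := R) (p.1.val) + (-1) ^ p.1.val * (-1) ^ p.1.val *
        neg_one_pow_mul_self (R := R) (gauge (cellSet (del η p.1 p.2))))
  · rw [if_neg h, if_neg fun h' => h ((incidence_cond p).2 h')]

theorem boundary_apply {i : ℕ}
    (c : Chains R (SimpleGraph.cycleGraph (2 * r + 1)) (⊤ : SimpleGraph (Fin n)) (i + 1))
    (τ : CycleCell r n i) : boundary R _ _ i c τ =
      ∑ η : CycleCell r n (i + 1), c η * ((incidence η.val τ.val : ℤ) : R) := by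
  classical
  rw [boundary, Finsupp.linearCombination_apply, Finsupp.sum_fintype _ _ (by simp),
    Finsupp.finsetSum_apply]
  refine sum_congr rfl fun η _ => ?_
  rw [Finsupp.smul_apply, Finsupp.finsetSum_apply, sum_eq_single τ]
  · simp
  · intro σ _ hσ
    rw [Finsupp.single_apply, if_neg hσ]
  · intro h; exact absurd (mem_univ τ) h

variable (R r n) in
/-- The cellular chain with the coefficients of a given chain of the simplex. -/
def toCell (i : ℕ) : (Finset (Vtx r n) → R) →ₗ[R]
    Chains R (SimpleGraph.cycleGraph (2 * r + 1)) (⊤ : SimpleGraph (Fin n)) i where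
  toFun d := Finsupp.equivFunOnFinite.symm fun η =>
    (-1) ^ gauge (cellSet η.val) * d (cellSet η.val)
  map_add' c d := by ext η; simp [mul_add]
  map_smul' a c := by
    ext η
    simp only [Finsupp.equivFunOnFinite_symm_apply_apply, Pi.smul_apply, smul_eq_mul,
      RingHom.id_apply, Finsupp.smul_apply]
    ring

theorem toCell_apply {i : ℕ} (d : Finset (Vtx r n) → R) (η : CycleCell r n i) :
    toCell R r n i d η = (-1) ^ gauge (cellSet η.val) * d (cellSet η.val) := rfl

theorem toCell_inj (hr : 1 ≤ r) {i : ℕ} {c d : Finset (Vtx r n) → R}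
    (hc : c ∈ chains R (cycleCells r n) (i + (2 * r + 1)))
    (hd : d ∈ chains R (cycleCells r n) (i + (2 * r + 1)))
    (h : toCell R r n i c = toCell R r n i d) : c = d := by
  have key : ∀ s : Finset (Vtx r n), s ∈ cycleCells r n → s.card = i + (2 * r + 1) → c s = d s := by
    intro s h1 h2
    obtain ⟨η, rfl⟩ := exists_cell hr h1 h2
    have h3 := DFunLike.congr_fun h η
    rw [toCell_apply, toCell_apply] at h3
    have h4 := congrArg (fun x => (-1) ^ gauge (cellSet η.val) * x) h3
    simpa only [← mul_assoc, neg_one_pow_mul_self, one_mul] using h4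
  ext s
  by_cases h1 : c s = 0
  · by_cases h2 : d s = 0
    · rw [h1, h2]
    · exact key s (hd s h2).1 (hd s h2).2
  · exact key s (hc s h1).1 (hc s h1).2

theorem exists_toCell_eq (hr : 1 ≤ r) {i : ℕ}
    (c : Chains R (SimpleGraph.cycleGraph (2 * r + 1)) (⊤ : SimpleGraph (Fin n)) i) :
    ∃ d ∈ chains R (cycleCells r n) (i + (2 * r + 1)), toCell R r n i d = c := by
  refine ⟨fun s => ∑ η : CycleCell r n i, if cellSet η.val = s then
    (-1) ^ gauge (cellSet η.val) * c η else 0, fun s hs => ?_, ?_⟩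
  · obtain ⟨η, -, h⟩ := exists_ne_zero_of_sum_ne_zero hs
    have : cellSet η.val = s := by
      by_contra h1; exact h (if_neg h1)
    rw [← this]
    exact cellSet_mem hr η
  · ext η
    rw [toCell_apply, sum_eq_single η, if_pos rfl, ← mul_assoc, neg_one_pow_mul_self, one_mul]
    · intro τ _ hτ
      exact if_neg fun h => hτ (Cell.ext (cellSet_injective h))
    · intro h; exact absurd (mem_univ η) h

theorem boundary_toCell (hr : 1 ≤ r) {i : ℕ} {d : Finset (Vtx r n) → R}
    (hd : d ∈ chains R (cycleCells r n) (i + (2 * r + 1) + 1)) :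
    boundary R _ _ i (toCell R r n (i + 1) d) = toCell R r n i (bd R d) := by
  ext τ
  have hd' : d ∈ chains R (cycleCells r n) (i + 1 + (2 * r + 1)) := by
    rwa [show i + 1 + (2 * r + 1) = i + (2 * r + 1) + 1 by ring]
  rw [boundary_apply, toCell_apply, bd_apply, mul_sum]
  rw [sum_congr rfl fun η _ => by
    rw [toCell_apply, incidence_eq_sum η.isCell.1, mul_sum], sum_comm]
  refine sum_congr rfl fun x _ => ?_
  rw [← sum_ite_cellSet hr hd' (insert x (cellSet τ.val)), mul_sum, mul_sum]
  refine sum_congr rfl fun η _ => ?_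
  split_ifs with h
  · linear_combination (d (cellSet η.val) * (-1) ^ gauge (cellSet τ.val) * sg R x (cellSet τ.val)) *
      neg_one_pow_mul_self (R := R) (gauge (cellSet η.val))
  · simp

end

/-! ### The reflection on cellular chains. -/

section

variable {R : Type} [CommRing R]
variable {r n : ℕ}

/-- Inversions count pairs of vertices of the factors, whereas `permExp` multiplies dimensions. Both
sums are compared by applying `pairSum_sq` to `b` and to `b - 1`. -/
theorem pairSum_sub_one {N : ℕ} {b : ℕ → ℕ} (hb : ∀ j, 1 ≤ j → j < N + 1 → 1 ≤ b j) :
    2 * pairSum (N + 1) b + N * N + 2 * ∑ j ∈ Ico 1 (N + 1), b j =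
      2 * pairSum (N + 1) (fun j => b j - 1) + 2 * N * (∑ j ∈ Ico 1 (N + 1), b j) + N := by
  have h1 := pairSum_sq (N + 1) (by omega) b
  have h2 := pairSum_sq (N + 1) (by omega) fun j => b j - 1
  have h3 : ∑ j ∈ Ico 1 (N + 1), b j = ∑ j ∈ Ico 1 (N + 1), (b j - 1) + N := by
    have : N = ∑ j ∈ Ico 1 (N + 1), 1 := by simp
    conv_rhs => enter [2]; rw [this]
    rw [← sum_add_distrib]
    refine sum_congr rfl fun j hj => ?_
    have := hb j (mem_Ico.1 hj).1 (mem_Ico.1 hj).2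
    omega
  have h4 : ∑ j ∈ Ico 1 (N + 1), b j ^ 2 + N =
      ∑ j ∈ Ico 1 (N + 1), (b j - 1) ^ 2 + 2 * ∑ j ∈ Ico 1 (N + 1), b j := by
    have : N = ∑ j ∈ Ico 1 (N + 1), 1 := by simp
    conv_lhs => enter [2]; rw [this]
    rw [mul_sum, ← sum_add_distrib, ← sum_add_distrib]
    refine sum_congr rfl fun j hj => ?_
    have := hb j (mem_Ico.1 hj).1 (mem_Ico.1 hj).2
    obtain ⟨m, hm⟩ : ∃ m, b j = m + 1 := ⟨b j - 1, by omega⟩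
    rw [hm, Nat.add_sub_cancel]
    ring
  generalize ∑ j ∈ Ico 1 (N + 1), b j = S at *
  generalize ∑ j ∈ Ico 1 (N + 1), (b j - 1) = S' at *
  subst h3
  nlinarith

theorem gauge_add_gauge_map (s : Finset (Vtx r n)) :
    gauge s + gauge (s.map (flip r n).toEmbedding) =
      (2 * r + 1) * ∑ j ∈ Ico 1 (2 * r + 1), (sec s j).card := by
  have h : ∀ x : Vtx r n, (ofLex x).1.val + (ofLex (flip r n x)).1.val =
      if (ofLex x).1.val = 0 then 0 else 2 * r + 1 := by
    intro x
    have : (ofLex (flip r n x)).1 = -(ofLex x).1 := rfl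
    rw [this, val_neg, rf]
    split_ifs with h0
    · omega
    · omega
  rw [gauge, gauge, sum_map, ← sum_add_distrib]
  refine (sum_congr rfl fun x _ => h x).trans ?_
  rw [sum_eq_sum_sec,
    range_eq_Ico, sum_eq_sum_Ico_succ_bot (by omega), mul_sum]
  rw [sum_eq_zero fun w _ => by simp [pt], zero_add]
  refine sum_congr rfl fun j hj => ?_
  have hj' := mem_Ico.1 hj
  rw [sum_congr rfl (g := fun _ => 2 * r + 1) fun w _ => if_neg (by
    simp [pt, Nat.mod_eq_of_lt hj'.2]; omega), sum_const, smul_eq_mul, mul_comm]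

theorem cellSet_comp_neg (η : Fin (2 * r + 1) → Finset (Fin n)) :
    cellSet (fun v => η (-v)) = (cellSet η).map (flip r n).toEmbedding := by
  ext x
  obtain ⟨j, hj, w, rfl⟩ := exists_pt x
  rw [pt_mem_map hj, ← flip_pt hj, mem_cellSet, mem_cellSet]
  rfl

theorem permExp_neg (η : Fin (2 * r + 1) → Finset (Fin n)) :
    permExp (Equiv.neg (Fin (2 * r + 1))) η =
      pairSum (2 * r + 1) fun j => (sec (cellSet fun v => η (-v)) j).card - 1 := by
  rw [← sum_ite_eq_pairSum, permExp, ← Fin.sum_univ_eq_sum_range (fun i =>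
    ∑ j ∈ range (2 * r + 1), if i < j ∧ 1 ≤ i then ((sec (cellSet fun v => η (-v)) i).card - 1) *
      ((sec (cellSet fun v => η (-v)) j).card - 1) else 0)]
  refine sum_congr rfl fun x _ => ?_
  rw [← Fin.sum_univ_eq_sum_range (fun j => if x.val < j ∧ 1 ≤ x.val then
    ((sec (cellSet fun v => η (-v)) x.val).card - 1) *
      ((sec (cellSet fun v => η (-v)) j).card - 1) else 0)]
  refine sum_congr rfl fun y _ => ?_
  rw [sec_cellSet, sec_cellSet]
  refine if_congr ?_ rfl rfl
  rw [Fin.lt_def, Fin.lt_def, show (Equiv.neg (Fin (2 * r + 1))) x = -x from rfl,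
    show (Equiv.neg (Fin (2 * r + 1))) y = -y from rfl, val_neg, val_neg, rf, rf]
  split_ifs <;> omega

/-- Modulo two, passing from cardinalities to dimensions changes the inversion count by `S + r`,
with `S` the number of elements at nonzero vertices. The two gauges add up to `S`, so only `r`
remains. -/
theorem neg_one_pow_permExp {η : Fin (2 * r + 1) → Finset (Fin n)} (hη : ∀ v, (η v).Nonempty) :
    (-1 : R) ^ permExp (Equiv.neg (Fin (2 * r + 1))) η * (-1) ^ gauge (cellSet η) =
      (-1) ^ gauge (cellSet fun v => η (-v)) * ((-1) ^ r *
        (-1) ^ inv (flip r n) (cellSet fun v => η (-v))) := by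
  rw [permExp_neg, inv_flip, ← pow_add, ← pow_add, ← pow_add]
  have h1 := pairSum_sub_one (N := 2 * r) (b := fun j => (sec (cellSet fun v => η (-v)) j).card)
    fun j _ h2 => by
      have := sec_cellSet (fun v => η (-v)) ⟨j, h2⟩
      simp only at this ⊢
      rw [this]
      exact (hη _).card_pos
  have h2 := gauge_add_gauge_map (cellSet fun v => η (-v))
  rw [cellSet_comp_neg, map_map_flip, ← cellSet_comp_neg] at h2
  generalize ∑ j ∈ Ico 1 (2 * r + 1), (sec (cellSet fun v => η (-v)) j).card = S at *
  generalize pairSum (2 * r + 1) (fun j => (sec (cellSet fun v => η (-v)) j).card) = a at *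
  generalize pairSum (2 * r + 1) (fun j => (sec (cellSet fun v => η (-v)) j).card - 1) = b at *
  generalize gauge (cellSet fun v => η (-v)) = x at *
  generalize gauge (cellSet η) = y at *
  have h3 : a + 2 * (r * r) + S = b + 2 * (r * S) + r := by nlinarith
  have h4 : x + y = 2 * (r * S) + S := by rw [h2]; ring
  apply neg_one_pow_congr
  simp only [Nat.even_iff]
  omega

theorem pullbackChains_apply {G : SimpleGraph (Fin (2 * r + 1))} (φ : G ≃g G)
    {H : SimpleGraph (Fin n)} {i : ℕ} (c : Chains R G H i) (η : Cell G H i) :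
    pullbackChains R φ H i c (η.pullback φ H) = (-1) ^ permExp φ.toEquiv η.val * c η := by
  classical
  rw [pullbackChains, Finsupp.linearCombination_apply, Finsupp.sum_fintype _ _ (by simp),
    Finsupp.finsetSum_apply, sum_eq_single η]
  · rw [Finsupp.smul_apply, Finsupp.single_eq_same, smul_eq_mul, mul_comm]
  · intro τ _ hτ
    rw [Finsupp.smul_apply, Finsupp.single_apply, if_neg, smul_zero]
    intro h
    refine hτ (Cell.ext (funext fun u => ?_))
    have := congrFun (congrArg Cell.val h) (φ.symm u)
    simpa [Cell.pullback] using this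
  · intro h; exact absurd (mem_univ η) h

theorem pullbackChains_toCell {i : ℕ} (d : Finset (Vtx r n) → R) :
    pullbackChains R (cycleReflection (2 * r + 1)) (⊤ : SimpleGraph (Fin n)) i (toCell R r n i d) =
      toCell R r n i ((-1 : R) ^ r • reindex R (flip r n) d) := by
  ext τ
  set η := τ.pullback (cycleReflection (2 * r + 1)) ⊤ with hη
  have hval : ∀ v, η.val v = τ.val (-v) := fun v => rfl
  have hτ : η.pullback (cycleReflection (2 * r + 1)) ⊤ = τ :=
    Cell.ext (funext fun v => by
      change η.val (-v) = _
      rw [hval, neg_neg])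
  have hτ' : (fun v => η.val (-v)) = τ.val := funext fun v => by rw [hval, neg_neg]
  conv_lhs => rw [← hτ]
  rw [pullbackChains_apply, toCell_apply, toCell_apply, Pi.smul_apply, reindex_apply, smul_eq_mul,
    ← mul_assoc]
  have h := neg_one_pow_permExp (R := R) η.isCell.1
  rw [hτ'] at h
  have h2 : (cellSet τ.val).map (flip r n).toEmbedding = cellSet η.val := by
    rw [← cellSet_comp_neg]
    rfl
  rw [h2]
  refine (congrArg (· * d (cellSet η.val)) h).trans ?_
  ring

end

/-! ### Categorical homology in terms of cycles and boundaries. -/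

section

variable {R : Type} [CommRing R]

/-- The homology of a chain complex of modules is presented by cycles and boundaries. -/
theorem exists_homology_presentation (K : ChainComplex (ModuleCat.{0} R) ℕ) (i j : ℕ)
    (hj : (ComplexShape.down ℕ).next i = j) {M : Type} [AddCommGroup M] [Module R M]
    (k : M →ₗ[R] K.X i) (hk : ∀ m, K.d i j (k m) = 0) (hs : ∀ x, K.d i j x = 0 → ∃ m, k m = x) :
    ∃ f : M →ₗ[R] K.homology i, Function.Surjective f ∧
      (∀ m, f m = 0 ↔ ∃ b : K.X (i + 1), K.d (i + 1) i b = k m) ∧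
      ∀ (φ : K ⟶ K) (m m' : M), φ.f i (k m) = k m' →
        HomologicalComplex.homologyMap φ i (f m) = f m' := by
  have hk' : ModuleCat.ofHom k ≫ K.d i j = 0 := by
    ext m; exact hk m
  have hinj := (ModuleCat.mono_iff_injective (K.iCycles i)).1 inferInstance
  have hsurj := (ModuleCat.epi_iff_surjective (K.homologyπ i)).1 inferInstance
  set l := K.liftCycles (ModuleCat.ofHom k) j hj hk' with hl
  have hli : ∀ m, K.iCycles i (l m) = k m := fun m =>
    congrArg (fun g => g.hom m) (K.liftCycles_i (ModuleCat.ofHom k) j hj hk')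
  refine ⟨(l ≫ K.homologyπ i).hom, fun y => ?_, fun m => ⟨fun h => ?_, ?_⟩, fun φ m m' h => ?_⟩
  · obtain ⟨x, rfl⟩ := hsurj y
    obtain ⟨m, hm⟩ := hs (K.iCycles i x) (by
      have := congrArg (fun g => g.hom x) (K.iCycles_d i j)
      exact this)
    refine ⟨m, ?_⟩
    have : l m = x := hinj ((hli m).trans hm)
    rw [← this]
    rfl
  · have hex := ShortComplex.exact_of_g_is_cokernel (ShortComplex.mk _ _ (K.toCycles_comp_homologyπ (i + 1) i))
      (K.homologyIsCokernel (i + 1) i (by simp))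
    obtain ⟨b, hb⟩ := (ShortComplex.moduleCat_exact_iff _).1 hex (l m) h
    refine ⟨b, ?_⟩
    rw [← hli m, ← hb]
    exact (congrArg (fun g => g.hom b) (K.toCycles_i (i + 1) i)).symm
  · rintro ⟨b, hb⟩
    have h1 : K.toCycles (i + 1) i b = l m := hinj (by
      rw [hli m, ← hb]
      exact congrArg (fun g => g.hom b) (K.toCycles_i (i + 1) i))
    change K.homologyπ i (l m) = 0
    rw [← h1]
    exact congrArg (fun g => g.hom b) (K.toCycles_comp_homologyπ (i + 1) i)
  · have h1 : HomologicalComplex.cyclesMap φ i (l m) = l m' := hinj (by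
      rw [hli m', ← h, ← hli m]
      exact congrArg (fun g => g.hom (l m)) (HomologicalComplex.cyclesMap_i φ i))
    change HomologicalComplex.homologyMap φ i (K.homologyπ i (l m)) = K.homologyπ i (l m')
    rw [← h1]
    exact congrArg (fun g => g.hom (l m)) (HomologicalComplex.homologyπ_naturality φ i)

/-- Two quotients of a module by the same submodule are isomorphic. -/
theorem nonempty_linearEquiv_of_ker {A M N : Type} [AddCommGroup A] [Module R A] [AddCommGroup M]
    [Module R M] [AddCommGroup N] [Module R N] (f : A →ₗ[R] M) (g : A →ₗ[R] N)
    (hf : Function.Surjective f) (hg : Function.Surjective g) (h : ∀ a, f a = 0 ↔ g a = 0) :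
    Nonempty (M ≃ₗ[R] N) := by
  have hk : LinearMap.ker f = LinearMap.ker g := by
    ext a; exact h a
  exact ⟨(f.quotKerEquivOfSurjective hf).symm ≪≫ₗ Submodule.quotEquivOfEq _ _ hk ≪≫ₗ
    g.quotKerEquivOfSurjective hg⟩

variable {r n : ℕ}

theorem next_eq (i : ℕ) : (ComplexShape.down ℕ).next i = i - 1 := by
  cases i with
  | zero => exact ChainComplex.next_nat_zero
  | succ i => exact ChainComplex.next_nat_succ i

theorem chainComplex_d_apply (i : ℕ)
    (c : Chains R (SimpleGraph.cycleGraph (2 * r + 1)) (⊤ : SimpleGraph (Fin n)) (i + 1)) :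
    (chainComplex R (SimpleGraph.cycleGraph (2 * r + 1)) (⊤ : SimpleGraph (Fin n))).d (i + 1) i c =
      boundary R _ _ i c := by
  have : (chainComplex R (SimpleGraph.cycleGraph (2 * r + 1)) (⊤ : SimpleGraph (Fin n))).d (i + 1) i
      = ModuleCat.ofHom (boundary R _ _ i) := by
    simp only [chainComplex, ChainComplex.of_d]
  rw [this]
  rfl

theorem le_card_of_mem_cycleCells (hr : 1 ≤ r) {s : Finset (Vtx r n)} (hs : s ∈ cycleCells r n) :
    2 * r + 1 ≤ s.card := by
  have h := (isCell_iff hr (fun v => sec s v.val)).2 (by rwa [cellSet_colours])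
  have := card_cellSet h.1
  rw [cellSet_colours] at this
  omega

theorem toCell_res (hr : 1 ≤ r) {i : ℕ} (d : Finset (Vtx r n) → R) :
    toCell R r n i (res R (cycleCells r n) d) = toCell R r n i d := by
  ext η
  rw [toCell_apply, toCell_apply, res_apply_mem _ (cellSet_mem hr η).1]

theorem d_toCell_eq_zero_iff (hr : 1 ≤ r) {i : ℕ} {d : Finset (Vtx r n) → R}
    (hd : d ∈ chains R (cycleCells r n) (i + (2 * r + 1))) :
    (chainComplex R (SimpleGraph.cycleGraph (2 * r + 1)) (⊤ : SimpleGraph (Fin n))).d i (i - 1)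
      (toCell R r n i d) = 0 ↔ d ∈ cyc R (cycleCells r n) (i + (2 * r + 1)) := by
  cases i with
  | zero =>
    -- In degree zero the truncated `i - 1` is again `0`, where the differential vanishes by shape.
    -- Correspondingly, no cycle cell has fewer than `2r + 1` elements, so every chain is a relative
    -- cycle.
    refine iff_of_true ?_ (mem_cyc.2 ⟨hd, fun s hs => ?_⟩)
    · rw [(chainComplex R (SimpleGraph.cycleGraph (2 * r + 1)) (⊤ : SimpleGraph (Fin n))).shape _ _
        (by simp)]
      rfl
    · by_contra h
      rw [zero_add] at hd
      have := bd_card hd h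
      have := le_card_of_mem_cycleCells hr hs
      omega
  | succ i =>
    have hd' : d ∈ chains R (cycleCells r n) (i + (2 * r + 1) + 1) := by
      rwa [show i + (2 * r + 1) + 1 = i + 1 + (2 * r + 1) by ring]
    have e : (chainComplex R (SimpleGraph.cycleGraph (2 * r + 1)) (⊤ : SimpleGraph (Fin n))).d (i + 1) i
        (toCell R r n (i + 1) d) = toCell R r n i (bd R d) :=
      (chainComplex_d_apply i (toCell R r n (i + 1) d)).trans
        (boundary_toCell hr hd')
    rw [Nat.add_sub_cancel, e, ← toCell_res hr]
    refine ⟨fun h => mem_cyc.2 ⟨hd, fun s hs => ?_⟩, fun h => ?_⟩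
    · have := toCell_inj hr (res_bd_mem_chains (Q := cycleCells r n) hd') (zero_mem _)
        (h.trans (map_zero _).symm)
      have := congrFun this s
      rwa [res_apply_mem _ hs] at this
    · have : res R (cycleCells r n) (bd R d) = 0 := h.2
      rw [this, map_zero]
      rfl

/-- The homology of the complex of homomorphisms in terms of the family of its cells. -/
theorem exists_homology_map (hr : 1 ≤ r) (i : ℕ) :
    ∃ f : cyc R (cycleCells r n) (i + (2 * r + 1)) →ₗ[R]
        homology R (SimpleGraph.cycleGraph (2 * r + 1)) (⊤ : SimpleGraph (Fin n)) i,
      Function.Surjective f ∧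
      (∀ z, f z = 0 ↔ z.1 ∈ bdry R (cycleCells r n) (i + (2 * r + 1))) ∧
      ∀ z z' : cyc R (cycleCells r n) (i + (2 * r + 1)),
        (-1 : R) ^ r • reindex R (flip r n) z.1 = z'.1 →
        homologyPullback R (cycleReflection (2 * r + 1)) (⊤ : SimpleGraph (Fin n)) i (f z) = f z' := by
  obtain ⟨f, h1, h2, h3⟩ := exists_homology_presentation
    (chainComplex R (SimpleGraph.cycleGraph (2 * r + 1)) (⊤ : SimpleGraph (Fin n))) i (i - 1)
    (next_eq i) (M := cyc R (cycleCells r n) (i + (2 * r + 1)))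
    (toCell R r n i ∘ₗ Submodule.subtype _)
    (fun m => (d_toCell_eq_zero_iff hr (mem_cyc.1 m.2).1).2 m.2)
    (fun x hx => by
      obtain ⟨d, hd, rfl⟩ := exists_toCell_eq hr x
      exact ⟨⟨d, (d_toCell_eq_zero_iff hr hd).1 hx⟩, rfl⟩)
  refine ⟨f, h1, fun z => (h2 z).trans ⟨?_, ?_⟩, fun z z' h => h3 _ z z' ?_⟩
  · rintro ⟨b, hb⟩
    obtain ⟨d, hd, rfl⟩ := exists_toCell_eq hr b
    have hd' : d ∈ chains R (cycleCells r n) (i + (2 * r + 1) + 1) := by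
      rwa [show i + (2 * r + 1) + 1 = i + 1 + (2 * r + 1) by ring]
    refine ⟨d, hd', toCell_inj hr (res_bd_mem_chains hd') (mem_cyc.1 z.2).1 ?_⟩
    rw [LinearMap.comp_apply, toCell_res hr, ← boundary_toCell hr hd']
    exact (chainComplex_d_apply i (toCell R r n (i + 1) d)).symm.trans hb
  · rintro ⟨d, hd, hdz⟩
    refine ⟨toCell R r n (i + 1) d, ?_⟩
    refine (chainComplex_d_apply i (toCell R r n (i + 1) d)).trans ?_
    refine (boundary_toCell hr hd).trans ?_
    rw [← toCell_res hr]
    exact congrArg (toCell R r n i) hdz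
  · refine (pullbackChains_toCell z.1).trans ?_
    rw [h]
    rfl

end

/-! ### Conclusion: the homology groups. -/

section

variable {R : Type} [CommRing R]
variable {r n : ℕ} [NeZero n]

theorem subsingleton_homology (hr : 1 ≤ r) {i : ℕ}
    (h : AcyclicAt R (cycleCells r n) (i + (2 * r + 1))) :
    Subsingleton (homology R (SimpleGraph.cycleGraph (2 * r + 1)) (⊤ : SimpleGraph (Fin n)) i) := by
  obtain ⟨f, h1, h2, -⟩ := exists_homology_map (R := R) (n := n) hr i
  refine subsingleton_of_forall_eq 0 fun x => ?_
  obtain ⟨z, rfl⟩ := h1 x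
  exact (h2 z).2 (h z.2)

theorem homology_of_functional (hr : 1 ≤ r) {i : ℕ} (β : (Finset (Vtx r n) → R) →ₗ[R] R)
    (h1 : ∀ a, ∃ z ∈ cyc R (cycleCells r n) (i + (2 * r + 1)), β z = a)
    (h2 : ∀ z ∈ cyc R (cycleCells r n) (i + (2 * r + 1)),
      β z = 0 ↔ z ∈ bdry R (cycleCells r n) (i + (2 * r + 1))) :
    Nonempty (homology R (SimpleGraph.cycleGraph (2 * r + 1)) (⊤ : SimpleGraph (Fin n)) i ≃ₗ[R] R) := by
  obtain ⟨f, h3, h4, -⟩ := exists_homology_map (R := R) (n := n) hr i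
  refine nonempty_linearEquiv_of_ker f (β ∘ₗ Submodule.subtype _) h3 (fun a => ?_) fun z =>
    (h4 z).trans (h2 z.1 z.2).symm
  obtain ⟨z, hz, rfl⟩ := h1 a
  exact ⟨⟨z, hz⟩, rfl⟩

theorem homology_zero (hr : 2 ≤ r) (hn : 4 ≤ n) :
    Nonempty (homology R (SimpleGraph.cycleGraph (2 * r + 1)) (⊤ : SimpleGraph (Fin n)) 0 ≃ₗ[R] R) := by
  obtain ⟨β, hβ⟩ := exists_detects_cycleCells (R := R) hr hn (zero_add (2 * r + 1))
  obtain ⟨z, hz, hz1⟩ := hβ.exists_eq_one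
  exact homology_of_functional (by omega) β
    (fun a => ⟨a • z, Submodule.smul_mem _ _ hz, by rw [map_smul, hz1, smul_eq_mul, mul_one]⟩)
    fun z hz => ⟨hβ.mem_bdry z hz, hβ.eq_zero z⟩

/-- The map `g` presents the cokernel of multiplication by `1 + (-1)^n`, so one statement covers
both a free module of rank one and the integers modulo two. -/
theorem homology_bot (hr : 2 ≤ r) (hn : 4 ≤ n) {N : Type} [AddCommGroup N] [Module R N] (g : R →ₗ[R] N)
    (hg : Function.Surjective g) (h : ∀ a, g a = 0 ↔ ∃ b, a = (1 + (-1) ^ n) * b) :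
    Nonempty (homology R (SimpleGraph.cycleGraph (2 * r + 1)) (⊤ : SimpleGraph (Fin n)) (n - 3)
      ≃ₗ[R] N) := by
  obtain ⟨f, h3, h4, -⟩ := exists_homology_map (R := R) (n := n) (r := r) (by omega) (n - 3)
  obtain ⟨e, he, h1, h2⟩ := exists_bot (R := R) (n := n) (i := n - 3 + (2 * r + 1)) hr hn (by omega)
  refine nonempty_linearEquiv_of_ker (f ∘ₗ LinearMap.toSpanSingleton R _ ⟨e, he⟩) g
    (fun x => ?_) hg fun a => ?_
  · obtain ⟨z, rfl⟩ := h3 x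
    obtain ⟨a, ha⟩ := h1 z.1 z.2
    refine ⟨a, ?_⟩
    rw [LinearMap.comp_apply, LinearMap.toSpanSingleton_apply, eq_comm, ← sub_eq_zero, ← map_sub]
    exact (h4 _).2 ha
  · rw [LinearMap.comp_apply, LinearMap.toSpanSingleton_apply, h a, ← h2 a]
    exact h4 _

theorem homology_top (hr : 2 ≤ r) (hn : 5 ≤ n) (h : (1 : R) + (-1) ^ n = 0) :
    Nonempty (homology R (SimpleGraph.cycleGraph (2 * r + 1)) (⊤ : SimpleGraph (Fin n)) (n - 2)
      ≃ₗ[R] R) := by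
  obtain ⟨γ, h1, -, h3⟩ := exists_top (R := R) (n := n) (i := n - 2 + (2 * r + 1)) hr hn (by omega)
  exact homology_of_functional (by omega) γ (fun a => h3 a (by rw [h, zero_mul])) h1

theorem homologyPullback_eq_neg (hr : 2 ≤ r) (hn : 4 ≤ n)
    (z : homology R (SimpleGraph.cycleGraph (2 * r + 1)) (⊤ : SimpleGraph (Fin n)) (n - 3)) :
    homologyPullback R (cycleReflection (2 * r + 1)) (⊤ : SimpleGraph (Fin n)) (n - 3) z = -z := by
  obtain ⟨f, h3, h4, h5⟩ := exists_homology_map (R := R) (n := n) (r := r) (by omega) (n - 3)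
  obtain ⟨z, rfl⟩ := h3 z
  rw [h5 z ⟨_, Submodule.smul_mem _ _ (reindex_mem_cyc map_mem_cycleCells_iff z.2)⟩ rfl,
    eq_neg_iff_add_eq_zero, ← map_add]
  exact (h4 _).2 (reindex_add_mem_bdry hr hn (by omega) z.2)

end

end SetComplex

theorem mainTheorem5 (r n : ℕ) (hr : 2 ≤ r) (hn : 5 ≤ n) :
    (∀ i : ℕ, i = 0 ∨ i = n - 3 ∨ i = n - 2 →
      Nonempty (HomComplex.homology (ZMod 2) (SimpleGraph.cycleGraph (2 * r + 1))
        (⊤ : SimpleGraph (Fin n)) i ≃ₗ[ZMod 2] ZMod 2)) ∧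
    (∀ i : ℕ, 1 ≤ i → i ≤ n - 4 →
      Subsingleton (HomComplex.homology (ZMod 2) (SimpleGraph.cycleGraph (2 * r + 1))
        (⊤ : SimpleGraph (Fin n)) i)) ∧
    (∀ i : ℕ, 1 ≤ i → i ≤ n - 4 →
      Subsingleton (HomComplex.homology ℤ (SimpleGraph.cycleGraph (2 * r + 1))
        (⊤ : SimpleGraph (Fin n)) i)) ∧
    (Odd n →
      Nonempty (HomComplex.homology ℤ (SimpleGraph.cycleGraph (2 * r + 1))
        (⊤ : SimpleGraph (Fin n)) (n - 3) ≃ₗ[ℤ] ℤ) ∧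
      Nonempty (HomComplex.homology ℤ (SimpleGraph.cycleGraph (2 * r + 1))
        (⊤ : SimpleGraph (Fin n)) (n - 2) ≃ₗ[ℤ] ℤ) ∧
      ∀ z : HomComplex.homology ℤ (SimpleGraph.cycleGraph (2 * r + 1))
          (⊤ : SimpleGraph (Fin n)) (n - 3),
        HomComplex.homologyPullback ℤ (HomComplex.cycleReflection (2 * r + 1))
          (⊤ : SimpleGraph (Fin n)) (n - 3) z = -z) ∧
    (Even n →
      Nonempty (HomComplex.homology ℤ (SimpleGraph.cycleGraph (2 * r + 1))
        (⊤ : SimpleGraph (Fin n)) (n - 3) ≃ₗ[ℤ] ZMod 2) ∧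
      Subsingleton (HomComplex.homology ℤ (SimpleGraph.cycleGraph (2 * r + 1))
        (⊤ : SimpleGraph (Fin n)) (n - 2))) := by
  have : NeZero n := ⟨by omega⟩
  have hbot : ∀ (R : Type) [CommRing R], (1 : R) + (-1) ^ n = 0 →
      Nonempty (HomComplex.homology R (SimpleGraph.cycleGraph (2 * r + 1))
        (⊤ : SimpleGraph (Fin n)) (n - 3) ≃ₗ[R] R) := fun R _ h =>
    SetComplex.homology_bot hr (by omega) LinearMap.id (fun a => ⟨a, rfl⟩) fun a =>
      ⟨fun ha => ⟨0, by rw [mul_zero]; exact ha⟩, fun ⟨b, hb⟩ => by rw [hb, h, zero_mul, map_zero]⟩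
  have h2 : (1 : ZMod 2) + (-1) ^ n = 0 := by
    rw [show (-1 : ZMod 2) = 1 by decide, one_pow]; decide
  refine ⟨?_, fun i h1 h2 => ?_, fun i h1 h2 => ?_, fun hodd => ⟨?_, ?_, fun z => ?_⟩,
    fun heven => ⟨?_, ?_⟩⟩
  · rintro i (rfl | rfl | rfl)
    · exact SetComplex.homology_zero hr (by omega)
    · exact hbot (ZMod 2) h2
    · exact SetComplex.homology_top hr hn h2
  · exact SetComplex.subsingleton_homology (by omega)
      (SetComplex.acyclicAt_cycleCells hr (by omega) (by omega))
  · exact SetComplex.subsingleton_homology (by omega)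
      (SetComplex.acyclicAt_cycleCells hr (by omega) (by omega))
  · exact hbot ℤ (by rw [hodd.neg_one_pow]; rfl)
  · exact SetComplex.homology_top hr hn (by rw [hodd.neg_one_pow]; rfl)
  · exact SetComplex.homologyPullback_eq_neg hr (by omega) z
  -- For even `n` the factor `1 + (-1)^n` is `2`, whose cokernel on the integers is given by
  -- reduction modulo two.
  · refine SetComplex.homology_bot hr (by omega) (Int.castAddHom (ZMod 2)).toIntLinearMap
      (fun a => ⟨a.val, ?_⟩) fun a => ?_
    · simp
    · rw [heven.neg_one_pow]
      exact ZMod.intCast_zmod_eq_zero_iff_dvd a 2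
  -- For even `n` twice the detecting functional vanishes, and the integers have no two-torsion.
  · obtain ⟨γ, h1, h3, -⟩ := SetComplex.exists_top (R := ℤ) (r := r) (n := n)
      (i := n - 2 + (2 * r + 1)) hr hn (by omega)
    refine SetComplex.subsingleton_homology (by omega) fun z hz => (h1 z hz).1 ?_
    have := h3 z hz
    rw [heven.neg_one_pow] at this
    omega
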